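/- Let $(M^n,g)$ be a smooth Riemannian manifold (without boundary, Hausdorff, second countable) and let $k\in\mathbb N$. For $\phi\in C^\infty(M)$ put $\Delta_\phi f=\Delta f-g(\nabla\phi,\nabla f)$ and $R_\phi=R+2\Delta\phi-|\nabla\phi|^2$, let $[\phi]=\{\phi+\omega:\omega\in C^\infty(M)\}$ be the weighted conformal class of $\phi$, and for $w\in\mathbb R$ let $$\mathcal E[w]=\{f:[\phi]\to C^\infty(M)\ :\ f(\psi-v)=e^{wv}f(\psi)\ \text{ for all }\psi\in[\phi],\ v\in C^\infty(M)\}$$ be the space of conformal densities of weight $w$. A normal weighted ambient space of $(M,g,\phi)$ (with parameter $\lambda=0$) consists of an open neighbourhood $W$ of $M\times\{0\}$ in $M\times\mathbb R$ whose fibres over $M$ are intervals, and of a smooth family of Riemannian metrics $g_u(x)$ and a smooth function $\phi_u(x)$, $(x,u)\in W$, with $(g_0,\phi_0)=(g,\phi)$, such that the Lorentzian metric $\widetilde g=2\,du\,dv+g_u$ and the function $\widetilde\phi=\phi_u-v$ on $\{(v,x,u):(x,u)\in W\}\subset\mathbb R\times M\times\mathbb R$ satisfy $$\mathrm{Ric}_{\widetilde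 g}+\widetilde\nabla^2\widetilde\phi=O(u^\infty),\qquad \widetilde\Delta\widetilde\phi-|\widetilde\nabla\widetilde\phi|^2=O(u^\infty)$$ at $u=0$. Write $\widetilde\Delta_\phi F=\widetilde\Delta F-\widetilde g(\widetilde\nabla\widetilde\phi,\widetilde\nabla F)$. Then there are linear operators $L_{2k,\phi}:C^\infty(M)\to C^\infty(M)$, one for each $\phi\in C^\infty(M)$, such that: 1. $L_{2k,\phi}=\left(\Delta_\phi-\tfrac14R_\phi\right)^k$. 2. (Conformal invariance) $f\mapsto\big(\psi\mapsto L_{2k,\psi}(f(\psi))\big)$ is a well-defined linear map $\mathcal E[-1/2]\to\mathcal E[-1/2]$. 3. (Formal self-adjointness) $\int_M (L_{2k,\phi}f)\,h\,e^{-\phi}\,\mathrm{dvol}_g=\int_M f\,(L_{2k,\phi}h)\,e^{-\phi}\,\mathrm{dvol}_g$ for all compactly supported $f,h\in C^\infty(M)$. 4. (Leading term) $L_{2k,\phi}-\Delta_\phi^k$ is a linear differential operator of order less than $2k$ (it vanishes for $k=0$). 5. (Ambient construction) For every normal weighted ambient space of $(M,g,\phi)$, every $f\in C^\infty(M)$ and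 every smooth extension $f_u$ of $f$ to $W$ (so $f_0=f$), $$L_{2k,\phi}f=e^{\frac12v}\,\widetilde\Delta_\phi^{\,k}\big(e^{-\frac12v}f_u\big)\Big|_{u=0}.$$ -/

import Mathlib

set_option maxSynthPendingDepth 3

open scoped Manifold ContDiff Topology
open MeasureTheory

noncomputable section

namespace WeightedGJMS

/-! ### Pseudo-Riemannian geometry in a coordinate space

`G : E → E →L[ℝ] E →L[ℝ] ℝ` is the coordinate expression of a metric of arbitrary signature. -/

section Coordinates

variable {E : Type*} [NormedAddCommGroup E] [NormedSpace ℝ E]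

/-- Christoffel symbols of the first kind:
`(X, Y, Z) ↦ ½ (∂_X G(Y, Z) + ∂_Y G(X, Z) - ∂_Z G(X, Y))`. -/
def christoffelLower (G : E → E →L[ℝ] E →L[ℝ] ℝ) (y : E) : E →L[ℝ] E →L[ℝ] E →L[ℝ] ℝ :=
  let flip₂ : (E →L[ℝ] E →L[ℝ] ℝ) →L[ℝ] (E →L[ℝ] E →L[ℝ] ℝ) :=
    (ContinuousLinearMap.flipₗᵢ ℝ E E ℝ).toContinuousLinearEquiv.toContinuousLinearMap
  (2⁻¹ : ℝ) • (fderiv ℝ G y + (fderiv ℝ G y).flip - flip₂ ∘L (fderiv ℝ G y).flip)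

theorem christoffelLower_apply (G : E → E →L[ℝ] E →L[ℝ] ℝ) (y X Y Z : E) :
    christoffelLower G y X Y Z =
      2⁻¹ * (fderiv ℝ G y X Y Z + fderiv ℝ G y Y X Z - fderiv ℝ G y Z X Y) := rfl

/-- Christoffel symbols of the second kind, `Γ(X, Y)`: the index is raised with the inverse of
the isomorphism `E → E*` given by the metric. -/
def christoffel (G : E → E →L[ℝ] E →L[ℝ] ℝ) (y : E) : E →L[ℝ] E →L[ℝ] E :=
  (ContinuousLinearMap.compL ℝ E (E →L[ℝ] ℝ) E (G y).inverse) ∘L christoffelLower G y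

theorem christoffel_apply (G : E → E →L[ℝ] E →L[ℝ] ℝ) (y X Y : E) :
    christoffel G y X Y = (G y).inverse (christoffelLower G y X Y) := rfl

/-- The endomorphism `X ↦ R(X, Y) Z` of the Levi-Civita curvature
`R(X, Y) Z = ∇_X ∇_Y Z - ∇_Y ∇_X Z - ∇_[X, Y] Z`. -/
def curvatureEnd (G : E → E →L[ℝ] E →L[ℝ] ℝ) (y Y Z : E) : E →L[ℝ] E :=
  ((fderiv ℝ (christoffel G) y).flip Y).flip Z - (fderiv ℝ (christoffel G) y Y).flip Z
    + (christoffel G y).flip (christoffel G y Y Z)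
    - (christoffel G y Y) ∘L ((christoffel G y).flip Z)

theorem curvatureEnd_apply (G : E → E →L[ℝ] E →L[ℝ] ℝ) (y X Y Z : E) :
    curvatureEnd G y Y Z X =
      fderiv ℝ (christoffel G) y X Y Z - fderiv ℝ (christoffel G) y Y X Z
        + christoffel G y X (christoffel G y Y Z)
        - christoffel G y Y (christoffel G y X Z) := rfl

/-- The Ricci tensor `Ric(Y, Z) = tr (X ↦ R(X, Y) Z)`. -/
def ricciForm (G : E → E →L[ℝ] E →L[ℝ] ℝ) (y : E) : LinearMap.BilinForm ℝ E :=
  LinearMap.mk₂ ℝ (fun Y Z => LinearMap.trace ℝ E (curvatureEnd G y Y Z : E →ₗ[ℝ] E))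
    (fun Y Y' Z => by
      rw [← map_add]; congr 1; ext X; simp [curvatureEnd_apply]; abel)
    (fun c Y Z => by
      rw [← map_smul]; congr 1; ext X; simp [curvatureEnd_apply, smul_sub, smul_add])
    (fun Y Z Z' => by
      rw [← map_add]; congr 1; ext X; simp [curvatureEnd_apply]; abel)
    (fun c Y Z => by
      rw [← map_smul]; congr 1; ext X; simp [curvatureEnd_apply, smul_sub, smul_add])

theorem ricciForm_apply (G : E → E →L[ℝ] E →L[ℝ] ℝ) (y Y Z : E) :
    ricciForm G y Y Z = LinearMap.trace ℝ E (curvatureEnd G y Y Z : E →ₗ[ℝ] E) := rfl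

/-- The Hessian `∇²f(X, Y) = ∂_X ∂_Y f - df(Γ(X, Y))`. -/
def hessianForm (G : E → E →L[ℝ] E →L[ℝ] ℝ) (f : E → ℝ) (y : E) : LinearMap.BilinForm ℝ E :=
  LinearMap.mk₂ ℝ (fun X Y => fderiv ℝ (fderiv ℝ f) y X Y - fderiv ℝ f y (christoffel G y X Y))
    (fun X X' Y => by simp; ring) (fun c X Y => by simp; ring)
    (fun X Y Y' => by simp; ring) (fun c X Y => by simp; ring)

theorem hessianForm_apply (G : E → E →L[ℝ] E →L[ℝ] ℝ) (f : E → ℝ) (y X Y : E) :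
    hessianForm G f y X Y =
      fderiv ℝ (fderiv ℝ f) y X Y - fderiv ℝ f y (christoffel G y X Y) := rfl

/-- The trace `B^{ij} T_{ij}` of a bilinear form `T` with respect to a metric `B`. -/
def metricTrace [FiniteDimensional ℝ E] (B : E →L[ℝ] E →L[ℝ] ℝ) (T : LinearMap.BilinForm ℝ E) :
    ℝ :=
  LinearMap.trace ℝ E
    ((B.inverse : (E →L[ℝ] ℝ) →ₗ[ℝ] E) ∘ₗ
      (LinearMap.toContinuousLinearMap : (E →ₗ[ℝ] ℝ) ≃ₗ[ℝ] (E →L[ℝ] ℝ)).toLinearMap ∘ₗ T)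

end Coordinates

/-! ### Pseudo-Riemannian geometry on a manifold without boundary

A metric is a field `g` of bilinear forms on the tangent spaces. Every object at `x` is computed in
the preferred chart at `x`; Mathlib identifies `TangentSpace I x` with the model space `E` through
the differential of that chart at `x`. -/

section Geometry

variable {E : Type*} [NormedAddCommGroup E] [NormedSpace ℝ E]
  {H : Type*} [TopologicalSpace H] (I : ModelWithCorners ℝ E H)
  {M : Type*} [TopologicalSpace M] [ChartedSpace H M]

/-- The expression of the metric `g` in the chart at `x`: its pullback under the inverse chart. -/
def chartMetric (g : ∀ x : M, TangentSpace I x →L[ℝ] TangentSpace I x →L[ℝ] ℝ) (x : M) :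
    E → E →L[ℝ] E →L[ℝ] ℝ := fun y =>
  let gz : E →L[ℝ] E →L[ℝ] ℝ := g ((extChartAt I x).symm y)
  let dz : E →L[ℝ] E := mfderiv 𝓘(ℝ, E) I (extChartAt I x).symm y
  gz.bilinearComp dz dz

/-- The Ricci tensor of `g` at `x`. -/
def ricci (g : ∀ x : M, TangentSpace I x →L[ℝ] TangentSpace I x →L[ℝ] ℝ) (x : M) :
    LinearMap.BilinForm ℝ E :=
  ricciForm (chartMetric I g x) (extChartAt I x x)

/-- The Hessian `∇²f` at `x`. -/
def hessian (g : ∀ x : M, TangentSpace I x →L[ℝ] TangentSpace I x →L[ℝ] ℝ) (f : M → ℝ) (x : M) :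
    LinearMap.BilinForm ℝ E :=
  hessianForm (chartMetric I g x) (f ∘ (extChartAt I x).symm) (extChartAt I x x)

/-- The inner product `g(∇f, ∇h)` of gradients. -/
def gradInner (g : ∀ x : M, TangentSpace I x →L[ℝ] TangentSpace I x →L[ℝ] ℝ) (f h : M → ℝ)
    (x : M) : ℝ :=
  fderiv ℝ (f ∘ (extChartAt I x).symm) (extChartAt I x x)
    ((chartMetric I g x (extChartAt I x x)).inverse
      (fderiv ℝ (h ∘ (extChartAt I x).symm) (extChartAt I x x)))

variable [FiniteDimensional ℝ E]

/-- The scalar curvature `R`. -/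
def scalarCurvature (g : ∀ x : M, TangentSpace I x →L[ℝ] TangentSpace I x →L[ℝ] ℝ) (x : M) : ℝ :=
  metricTrace (chartMetric I g x (extChartAt I x x)) (ricci I g x)

/-- The Laplacian `Δf = tr_g ∇²f`. -/
def laplacian (g : ∀ x : M, TangentSpace I x →L[ℝ] TangentSpace I x →L[ℝ] ℝ) (f : M → ℝ)
    (x : M) : ℝ :=
  metricTrace (chartMetric I g x (extChartAt I x x)) (hessian I g f x)

/-- The weighted Laplacian `Δ_φ f = Δf - g(∇φ, ∇f)`. -/
def weightedLaplacian (g : ∀ x : M, TangentSpace I x →L[ℝ] TangentSpace I x →L[ℝ] ℝ)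
    (φ f : M → ℝ) (x : M) : ℝ :=
  laplacian I g f x - gradInner I g φ f x

/-- The weighted scalar curvature `R_φ = R + 2Δφ - |∇φ|²` (with parameter `λ = 0`). -/
def weightedScalarCurvature (g : ∀ x : M, TangentSpace I x →L[ℝ] TangentSpace I x →L[ℝ] ℝ)
    (φ : M → ℝ) (x : M) : ℝ :=
  scalarCurvature I g x + 2 * laplacian I g φ x - gradInner I g φ φ x

/-- The tensor `P_φ = Ric + ∇²φ` (with parameter `λ = 0`). -/
def weightedP (g : ∀ x : M, TangentSpace I x →L[ℝ] TangentSpace I x →L[ℝ] ℝ)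
    (φ : M → ℝ) (x : M) : LinearMap.BilinForm ℝ E :=
  ricci I g x + hessian I g φ x

/-- The function `F_φ = Δφ - |∇φ|²` (with parameter `λ = 0`). -/
def weightedF (g : ∀ x : M, TangentSpace I x →L[ℝ] TangentSpace I x →L[ℝ] ℝ)
    (φ : M → ℝ) (x : M) : ℝ :=
  laplacian I g φ x - gradInner I g φ φ x

/-- The second order operator `Δ_φ - ¼ R_φ`. -/
def gjmsFactor (g : ∀ x : M, TangentSpace I x →L[ℝ] TangentSpace I x →L[ℝ] ℝ)
    (φ f : M → ℝ) (x : M) : ℝ :=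
  weightedLaplacian I g φ f x - 1 / 4 * weightedScalarCurvature I g φ x * f x

end Geometry

/-- A linear endomorphism `D` of a commutative algebra `A` (here `A = C^∞(M)`) is a differential
operator of order `< m`: for `m = 0` it vanishes, and for `m + 1` all of its commutators with
multiplication operators are of order `< m`. On `C^∞(M)` these are the usual linear differential
operators with smooth coefficients. -/
def IsDiffOpOfOrderLT {A : Type*} [CommRing A] [Algebra ℝ A] : ℕ → Module.End ℝ A → Prop
  | 0, D => D = 0
  | m + 1, D => ∀ a : A,
      IsDiffOpOfOrderLT m (D * LinearMap.mulLeft ℝ a - LinearMap.mulLeft ℝ a * D)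

section Manifold

variable {n : ℕ} {M : Type*} [TopologicalSpace M] [ChartedSpace (EuclideanSpace ℝ (Fin n)) M]

/-- Smooth real-valued functions on the `n`-manifold `M`. -/
abbrev SmoothFn (n : ℕ) (M : Type*) [TopologicalSpace M]
    [ChartedSpace (EuclideanSpace ℝ (Fin n)) M] : Type _ :=
  C^∞⟮𝓡 n, M; 𝓘(ℝ, ℝ), ℝ⟯

/-- Smooth Riemannian metrics on the `n`-manifold `M`. -/
abbrev RMetric (n : ℕ) (M : Type*) [TopologicalSpace M]
    [ChartedSpace (EuclideanSpace ℝ (Fin n)) M] [IsManifold (𝓡 n) ∞ M] : Type _ :=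
  Bundle.ContMDiffRiemannianMetric (𝓡 n) ∞ (EuclideanSpace ℝ (Fin n))
    (fun x : M => TangentSpace (𝓡 n) x)

/-! ### The Riemannian measure -/

/-- The Riemannian measure on the domain of the chart at `x`, namely `√(det g_{ij}) dy¹ ⋯ dyⁿ`
in the coordinates of the chart, extended by zero to `M`. -/
def chartVolume [MeasurableSpace M]
    (g : ∀ x : M, TangentSpace (𝓡 n) x →L[ℝ] TangentSpace (𝓡 n) x →L[ℝ] ℝ) (x : M) : Measure M :=
  ((volume.restrict (extChartAt (𝓡 n) x).target).withDensity fun y =>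
    ENNReal.ofReal (Real.sqrt (Matrix.det (Matrix.of fun i j : Fin n =>
      chartMetric (𝓡 n) g x y (EuclideanSpace.single i 1) (EuclideanSpace.single j 1))))).map
    (extChartAt (𝓡 n) x).symm

/-- The Riemannian measure `dvol_g`: the smallest measure that dominates the Riemannian measure of
each chart. As the chart measures agree on overlaps, on a second countable manifold it restricts to
the chart measure on the domain of each chart. -/
def riemannianVolume [MeasurableSpace M]
    (g : ∀ x : M, TangentSpace (𝓡 n) x →L[ℝ] TangentSpace (𝓡 n) x →L[ℝ] ℝ) : Measure M :=
  ⨆ x : M, chartVolume g x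

/-- The weighted measure `e^{-φ} dvol_g`. -/
def weightedVolume [MeasurableSpace M]
    (g : ∀ x : M, TangentSpace (𝓡 n) x →L[ℝ] TangentSpace (𝓡 n) x →L[ℝ] ℝ) (φ : M → ℝ) :
    Measure M :=
  (riemannianVolume g).withDensity fun x => ENNReal.ofReal (Real.exp (-φ x))

/-! ### The conformal class and conformal densities -/

/-- The weighted conformal class `[φ] = {φ + w : w ∈ C^∞(M)}`. -/
def conformalClass (φ : SmoothFn n M) : Set (SmoothFn n M) := {ψ | ∃ w : SmoothFn n M, ψ = φ + w}

/-- Conformal densities of weight `w`: assignments `f : [φ] → C^∞(M)` with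
`f(ψ - v)(x) = e^{w v(x)} f(ψ)(x)` for `v ∈ C^∞(M)`. The sign of `v` is that of the fibre
coordinate `v` of the cone and of the ambient space, in which the potential is `φ - v`. -/
def ConformalDensity (φ : SmoothFn n M) (w : ℝ) :
    Submodule ℝ (conformalClass φ → SmoothFn n M) where
  carrier := {f | ∀ (ψ ψ' : conformalClass φ) (v : SmoothFn n M),
    (ψ' : SmoothFn n M) = (ψ : SmoothFn n M) - v → ∀ x, f ψ' x = Real.exp (w * v x) * f ψ x}
  add_mem' := by
    intro f h hf hh ψ ψ' v hv x
    have e1 := hf ψ ψ' v hv x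
    have e2 := hh ψ ψ' v hv x
    simp only [Pi.add_apply, ContMDiffMap.coe_add, e1, e2]
    ring
  zero_mem' := by
    intro ψ ψ' v _ x
    simp
  smul_mem' := by
    intro c f hf ψ ψ' v hv x
    have e1 := hf ψ ψ' v hv x
    simp only [Pi.smul_apply, ContMDiffMap.coe_smul, smul_eq_mul, e1]
    ring

/-! ### Normal ambient spaces (with parameter `λ = 0`) -/

/-- The model with corners of the ambient manifold `ℝ × M × ℝ` with coordinates `(v, x, u)`. -/
abbrev ambientModel (n : ℕ) :=
  𝓘(ℝ, ℝ).prod ((𝓡 n).prod 𝓘(ℝ, ℝ))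

/-- The metric `2 du dv + g_u` on `ℝ × M × ℝ`. -/
def ambientMetric (gu : ∀ x : M, ℝ → TangentSpace (𝓡 n) x →L[ℝ] TangentSpace (𝓡 n) x →L[ℝ] ℝ)
    (p : ℝ × M × ℝ) :
    TangentSpace (ambientModel n) p →L[ℝ] TangentSpace (ambientModel n) p →L[ℝ] ℝ :=
  let dv : ℝ × EuclideanSpace ℝ (Fin n) × ℝ →L[ℝ] ℝ := ContinuousLinearMap.fst ℝ _ _
  let pr : ℝ × EuclideanSpace ℝ (Fin n) × ℝ →L[ℝ] EuclideanSpace ℝ (Fin n) :=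
    ContinuousLinearMap.fst ℝ _ _ ∘L ContinuousLinearMap.snd ℝ _ _
  let du : ℝ × EuclideanSpace ℝ (Fin n) × ℝ →L[ℝ] ℝ :=
    ContinuousLinearMap.snd ℝ _ _ ∘L ContinuousLinearMap.snd ℝ _ _
  let gx : EuclideanSpace ℝ (Fin n) →L[ℝ] EuclideanSpace ℝ (Fin n) →L[ℝ] ℝ := gu p.2.1 p.2.2
  dv.smulRight du + du.smulRight dv + gx.bilinearComp pr pr

/-- The function `φ_u - v` on `ℝ × M × ℝ`. -/
def ambientPotential (φu : M × ℝ → ℝ) (p : ℝ × M × ℝ) : ℝ := φu p.2 - p.1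

/-- A normal weighted ambient space of `(M, g, [φ], λ = 0)` relative to `(g, φ)`. It lives on
`{(v, x, u) : (x, u) ∈ dom}`, an open neighbourhood of `{u = 0}` that is invariant under the
dilations `v ↦ v - s`, carries the metric `2 du dv + g_u` and the potential `φ_u - v`, and
satisfies `P̃_φ = O(u^∞)` and `F̃_φ = O(u^∞)`. The values outside the domain are irrelevant. -/
structure NormalAmbientSpace [IsManifold (𝓡 n) ∞ M] (g : RMetric n M) (φ : SmoothFn n M) where
  dom : Set (M × ℝ)
  isOpen_dom : IsOpen dom
  zero_mem : ∀ x : M, (x, (0 : ℝ)) ∈ dom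
  interval : ∀ x : M, {u : ℝ | (x, u) ∈ dom}.OrdConnected
  gu : ∀ x : M, ℝ → TangentSpace (𝓡 n) x →L[ℝ] TangentSpace (𝓡 n) x →L[ℝ] ℝ
  φu : M × ℝ → ℝ
  gu_symm : ∀ (x : M) (u : ℝ), (x, u) ∈ dom → ∀ X Y, gu x u X Y = gu x u Y X
  gu_pos : ∀ (x : M) (u : ℝ), (x, u) ∈ dom → ∀ X, X ≠ 0 → 0 < gu x u X X
  smooth_metric : ContMDiffOn (ambientModel n)
    ((ambientModel n).prod 𝓘(ℝ, (ℝ × EuclideanSpace ℝ (Fin n) × ℝ) →L[ℝ]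
      (ℝ × EuclideanSpace ℝ (Fin n) × ℝ) →L[ℝ] ℝ)) ∞
    (fun p : ℝ × M × ℝ => Bundle.TotalSpace.mk'
      ((ℝ × EuclideanSpace ℝ (Fin n) × ℝ) →L[ℝ] (ℝ × EuclideanSpace ℝ (Fin n) × ℝ) →L[ℝ] ℝ)
      (E := fun p : ℝ × M × ℝ => TangentSpace (ambientModel n) p →L[ℝ]
        TangentSpace (ambientModel n) p →L[ℝ] ℝ)
      p (ambientMetric gu p)) {p | p.2 ∈ dom}
  smooth_potential : ContMDiffOn ((𝓡 n).prod 𝓘(ℝ, ℝ)) 𝓘(ℝ, ℝ) ∞ φu dom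
  gu_zero : ∀ x : M, gu x 0 = g.inner x
  φu_zero : ∀ x : M, φu (x, 0) = φ x
  P_vanishes : ∀ (v : ℝ) (x : M) (X Y : ℝ × EuclideanSpace ℝ (Fin n) × ℝ) (N : ℕ),
    (fun u : ℝ => weightedP (ambientModel n) (ambientMetric gu) (ambientPotential φu) (v, x, u) X Y)
      =O[𝓝 0] fun u : ℝ => u ^ N
  F_vanishes : ∀ (v : ℝ) (x : M) (N : ℕ),
    (fun u : ℝ => weightedF (ambientModel n) (ambientMetric gu) (ambientPotential φu) (v, x, u))
      =O[𝓝 0] fun u : ℝ => u ^ N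

/-- The weighted Laplacian `Δ̃_φ` of a normal ambient space. -/
def NormalAmbientSpace.weightedLaplacian [IsManifold (𝓡 n) ∞ M] {g : RMetric n M}
    {φ : SmoothFn n M} (S : NormalAmbientSpace g φ) (F : ℝ × M × ℝ → ℝ) : ℝ × M × ℝ → ℝ :=
  WeightedGJMS.weightedLaplacian (ambientModel n) (ambientMetric S.gu) (ambientPotential S.φu) F

end Manifold

end WeightedGJMS

end

open WeightedGJMS

/-! The operator is taken to be `(Δ_φ - ¼ R_φ)^k` from the outset, and every other property reduces
to the case `k = 1` because each step preserves the relevant structure: densities of weight `-1/2`,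
compact supports, bounds on orders.

Ambient construction. On `F = e^{-v/2} f_u` the derivative `∂_v` acts as `-1/2`. The term `2∂_u∂_v`
of the Laplacian of `2 du dv + g_u` gives `-∂_u f`, and the drift along `φ_u - v` gives `-∂_u f` as
well. In the difference these cancel, so no `u`-derivative of `f_u` survives, and the result is
`e^{-v/2}(Δ_φ f + (½φ' - ¼ tr g')f)`, taken slicewise, with a prime for `∂_u`
(`IsAmbientOn.weightedLaplacian_density`). Since `∂_v` is null and parallel, the tangential part of
the first ambient equation reads `Ric + ∇²φ - ½g' = 0` on a slice; its trace is `R + Δφ - ½ tr g' =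
0`. The second equation reads `Δφ - ½ tr g' - |∇φ|² + 2φ' = 0`. Together they give `½φ' - ¼ tr g' =
-¼ R_φ`. The result is again a density of the same form, and its restriction to `u = 0` depends only
on `f_0`. Hence the step can be repeated `k` times for any extension, and only the values of the two
equations at `u = 0` enter (`NormalAmbientSpace.iterate_weightedLaplacian`).

Conformal invariance. The product rule shows that `Δ_φ - ¼ R_φ` intertwines multiplication by
`e^{-v/2}` when `φ` is replaced by `φ - v` (`IsMetricOn.coordFactor_conformal`). Input and output
have the same weight, so powers inherit this.

Self-adjointness. Jacobi's formula gives the logarithmic derivative of `√det g · e^{-φ}`. This turns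
`hΔ_φ f - fΔ_φ h`, multiplied by that density, into a Euclidean divergence
(`IsMetricOn.coordDiv_green`). A partition of unity reduces to supports in one chart. The measure
there is the chart measure, because the chart measures agree on overlaps
(`RMetric.riemannianVolume_restrict`).

Leading term. `Δ_φ` has order at most two and `¼ R_φ` order zero, so the difference of the `k`-th
powers has order below `2k`.

Every geometric quantity at a point is computed in the preferred chart of that point. Derivatives
and smoothness therefore require comparison with one fixed chart, which is the role of invariance
under local isometries (`IsIsometryOn`). -/

noncomputable section

namespace WeightedGJMS

/-! ### Metrics in coordinates: symmetry and smoothness of the Christoffel symbols -/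

section Coordinates

variable {E : Type*} [NormedAddCommGroup E] [NormedSpace ℝ E]

/-- A field of bilinear forms on an open set that is a smooth pseudo-Riemannian metric. -/
structure IsMetricOn (G : E → E →L[ℝ] E →L[ℝ] ℝ) (U : Set E) : Prop where
  isOpen : IsOpen U
  contDiffOn : ContDiffOn ℝ ∞ G U
  symm : ∀ y ∈ U, ∀ X Y, G y X Y = G y Y X
  isInvertible : ∀ y ∈ U, (G y).IsInvertible

/-- The Laplacian in coordinates. -/
def coordLaplacian [FiniteDimensional ℝ E] (G : E → E →L[ℝ] E →L[ℝ] ℝ) (f : E → ℝ) (y : E) : ℝ :=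
  metricTrace (G y) (hessianForm G f y)

/-- The inner product of gradients in coordinates. -/
def coordGradInner (G : E → E →L[ℝ] E →L[ℝ] ℝ) (f h : E → ℝ) (y : E) : ℝ :=
  fderiv ℝ f y ((G y).inverse (fderiv ℝ h y))

/-- The scalar curvature in coordinates. -/
def coordScalar [FiniteDimensional ℝ E] (G : E → E →L[ℝ] E →L[ℝ] ℝ) (y : E) : ℝ :=
  metricTrace (G y) (ricciForm G y)

theorem contDiffOn_fderiv {F : Type*} [NormedAddCommGroup F] [NormedSpace ℝ F] {f : E → F}
    {U : Set E} (hU : IsOpen U) (hf : ContDiffOn ℝ ∞ f U) : ContDiffOn ℝ ∞ (fderiv ℝ f) U :=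
  hf.fderiv_of_isOpen hU (by simp)

theorem differentiableAt_of_contDiffOn {F : Type*} [NormedAddCommGroup F] [NormedSpace ℝ F]
    {f : E → F} {U : Set E} (hU : IsOpen U) (hf : ContDiffOn ℝ ∞ f U) {y : E} (hy : y ∈ U) :
    DifferentiableAt ℝ f y :=
  ((hf.contDiffAt (hU.mem_nhds hy)).differentiableAt (by simp))

theorem fderiv_fderiv_symm {F : Type*} [NormedAddCommGroup F] [NormedSpace ℝ F] {f : E → F}
    {U : Set E} (hU : IsOpen U) (hf : ContDiffOn ℝ ∞ f U) {y : E} (hy : y ∈ U) (X Y : E) :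
    fderiv ℝ (fderiv ℝ f) y X Y = fderiv ℝ (fderiv ℝ f) y Y X :=
  (hf.contDiffAt (hU.mem_nhds hy)).isSymmSndFDerivAt
    (by rw [minSmoothness_of_isRCLikeNormedField]; exact ENat.LEInfty.out) X Y

/-- The derivative of a field of bilinear forms, evaluated on two constant vectors. -/
theorem fderiv_apply_apply {F : Type*} [NormedAddCommGroup F] [NormedSpace ℝ F]
    {F' : Type*} [NormedAddCommGroup F'] [NormedSpace ℝ F']
    {F'' : Type*} [NormedAddCommGroup F''] [NormedSpace ℝ F'']
    {G : E → F →L[ℝ] F' →L[ℝ] F''} {y : E} (hG : DifferentiableAt ℝ G y) (W : E) (X : F) (Y : F') :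
    fderiv ℝ (fun z => G z X Y) y W = fderiv ℝ G y W X Y := by
  have h1 : HasFDerivAt (fun z => G z X Y)
      ((ContinuousLinearMap.apply ℝ F'' Y) ∘L (ContinuousLinearMap.apply ℝ (F' →L[ℝ] F'') X)
        ∘L fderiv ℝ G y) y :=
    ((ContinuousLinearMap.apply ℝ F'' Y).hasFDerivAt).comp y
      (((ContinuousLinearMap.apply ℝ (F' →L[ℝ] F'') X).hasFDerivAt).comp y hG.hasFDerivAt)
  rw [h1.fderiv]; rfl

namespace IsMetricOn

variable {G : E → E →L[ℝ] E →L[ℝ] ℝ} {U : Set E}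

theorem fderiv_symm (hG : IsMetricOn G U) {y : E} (hy : y ∈ U) (W X Y : E) :
    fderiv ℝ G y W X Y = fderiv ℝ G y W Y X := by
  have hd := differentiableAt_of_contDiffOn hG.isOpen hG.contDiffOn hy
  rw [← fderiv_apply_apply hd, ← fderiv_apply_apply hd]
  congr 1
  apply Filter.EventuallyEq.fderiv_eq
  filter_upwards [hG.isOpen.mem_nhds hy] with z hz using hG.symm z hz X Y

theorem christoffelLower_symm (hG : IsMetricOn G U) {y : E} (hy : y ∈ U) (X Y Z : E) :
    christoffelLower G y X Y Z = christoffelLower G y Y X Z := by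
  rw [christoffelLower_apply, christoffelLower_apply, hG.fderiv_symm hy Z X Y]; ring

theorem christoffel_symm (hG : IsMetricOn G U) {y : E} (hy : y ∈ U) (X Y : E) :
    christoffel G y X Y = christoffel G y Y X := by
  rw [christoffel_apply, christoffel_apply]; congr 1; ext Z; exact hG.christoffelLower_symm hy X Y Z

theorem apply_inverse (hG : IsMetricOn G U) {y : E} (hy : y ∈ U) (α : E →L[ℝ] ℝ) (X : E) :
    G y ((G y).inverse α) X = α X := by
  rw [(hG.isInvertible y hy).self_apply_inverse]

theorem apply_inverse_comm (hG : IsMetricOn G U) {y : E} (hy : y ∈ U) (α β : E →L[ℝ] ℝ) :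
    α ((G y).inverse β) = β ((G y).inverse α) := by
  rw [← hG.apply_inverse hy α, hG.symm y hy, hG.apply_inverse hy]

variable [FiniteDimensional ℝ E]

theorem contDiffOn_inverse (hG : IsMetricOn G U) :
    ContDiffOn ℝ ∞ (fun y => (G y).inverse) U := by
  intro y hy
  have := FiniteDimensional.complete ℝ E
  exact (ContinuousLinearMap.IsInvertible.contDiffAt_map_inverse
    (hG.isInvertible y hy)).comp_contDiffWithinAt y (hG.contDiffOn y hy)

/-- In finite dimension, smoothness of an operator-valued map can be tested on fixed vectors, where
the explicit formula applies. -/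
theorem contDiffOn_christoffelLower (hG : IsMetricOn G U) :
    ContDiffOn ℝ ∞ (christoffelLower G) U := by
  have h := contDiffOn_fderiv hG.isOpen hG.contDiffOn
  have h' : ∀ X Y Z, ContDiffOn ℝ ∞ (fun y => fderiv ℝ G y X Y Z) U := fun X Y Z =>
    contDiffOn_clm_apply.1 (contDiffOn_clm_apply.1 (contDiffOn_clm_apply.1 h X) Y) Z
  refine contDiffOn_clm_apply.2 fun X => contDiffOn_clm_apply.2 fun Y =>
    contDiffOn_clm_apply.2 fun Z => ?_
  simp only [christoffelLower_apply]
  exact contDiffOn_const.mul (((h' X Y Z).add (h' Y X Z)).sub (h' Z X Y))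

theorem contDiffOn_christoffel (hG : IsMetricOn G U) : ContDiffOn ℝ ∞ (christoffel G) U := by
  refine contDiffOn_clm_apply.2 fun X => contDiffOn_clm_apply.2 fun Y => ?_
  simp only [christoffel_apply]
  exact hG.contDiffOn_inverse.clm_apply
    (contDiffOn_clm_apply.1 (contDiffOn_clm_apply.1 hG.contDiffOn_christoffelLower X) Y)

end IsMetricOn

/-! ### Locality -/

theorem hessianForm_congr (G : E → E →L[ℝ] E →L[ℝ] ℝ) {f f' : E → ℝ} {y : E} (hf : f =ᶠ[𝓝 y] f') :
    hessianForm G f y = hessianForm G f' y := by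
  ext X Y
  rw [hessianForm_apply, hessianForm_apply, hf.fderiv_eq, hf.fderiv.fderiv_eq]

theorem coordLaplacian_congr [FiniteDimensional ℝ E] (G : E → E →L[ℝ] E →L[ℝ] ℝ) {f f' : E → ℝ}
    {y : E} (hf : f =ᶠ[𝓝 y] f') : coordLaplacian G f y = coordLaplacian G f' y := by
  rw [coordLaplacian, coordLaplacian, hessianForm_congr G hf]

theorem coordGradInner_congr (G : E → E →L[ℝ] E →L[ℝ] ℝ) {f f' h h' : E → ℝ} {y : E}
    (hf : f =ᶠ[𝓝 y] f') (hh : h =ᶠ[𝓝 y] h') :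
    coordGradInner G f h y = coordGradInner G f' h' y := by
  rw [coordGradInner, coordGradInner, hf.fderiv_eq, hh.fderiv_eq]

/-! ### Traces -/

section Trace

theorem trace_eq_sum {ι : Type*} [Fintype ι] (b : Module.Basis ι ℝ E) (T : E →ₗ[ℝ] E) :
    LinearMap.trace ℝ E T = ∑ i, b.coord i (T (b i)) := by
  classical
  rw [LinearMap.trace_eq_matrix_trace ℝ b, Matrix.trace]
  simp [LinearMap.toMatrix_apply]

variable [FiniteDimensional ℝ E]

theorem toContinuousLinearMap_eq_sum {ι : Type*} [Fintype ι] (b : Module.Basis ι ℝ E)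
    (α : E →ₗ[ℝ] ℝ) : LinearMap.toContinuousLinearMap α =
      ∑ j, α (b j) • LinearMap.toContinuousLinearMap (b.coord j) := by
  ext X
  have h := congrArg α (b.sum_repr X)
  simp only [map_sum, map_smul, smul_eq_mul] at h
  simp [← h, mul_comm]

/-- The index formula `T_{ij} B^{ij}`. Smoothness of traces and their invariance under transposing
`T` are read off from it. -/
theorem metricTrace_eq_sum {ι : Type*} [Fintype ι] (b : Module.Basis ι ℝ E)
    (B : E →L[ℝ] E →L[ℝ] ℝ) (T : LinearMap.BilinForm ℝ E) :
    metricTrace B T = ∑ i, ∑ j, T (b i) (b j) *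
      b.coord i (B.inverse (LinearMap.toContinuousLinearMap (b.coord j))) := by
  rw [metricTrace, trace_eq_sum b]
  refine Finset.sum_congr rfl fun i _ => ?_
  simp only [LinearMap.comp_apply, LinearEquiv.coe_coe]
  rw [toContinuousLinearMap_eq_sum b (T (b i))]
  simp

theorem metricTrace_add (B : E →L[ℝ] E →L[ℝ] ℝ) (T T' : LinearMap.BilinForm ℝ E) :
    metricTrace B (T + T') = metricTrace B T + metricTrace B T' := by
  rw [metricTrace, metricTrace, metricTrace, ← map_add]
  congr 1
  ext X
  simp

theorem metricTrace_smul (B : E →L[ℝ] E →L[ℝ] ℝ) (c : ℝ) (T : LinearMap.BilinForm ℝ E) :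
    metricTrace B (c • T) = c * metricTrace B T := by
  rw [metricTrace, metricTrace, ← smul_eq_mul, ← map_smul]
  congr 1
  ext X
  simp

/-- The trace of a rank one form `α ⊗ β`. -/
theorem metricTrace_mul (B : E →L[ℝ] E →L[ℝ] ℝ) (α β : E →L[ℝ] ℝ) (T : LinearMap.BilinForm ℝ E)
    (hT : ∀ X Y, T X Y = α X * β Y) : metricTrace B T = α (B.inverse β) := by
  let b := Module.finBasis ℝ E
  rw [metricTrace_eq_sum b]
  have h1 : ∀ i, ∑ j, T (b i) (b j) * b.coord i
      (B.inverse (LinearMap.toContinuousLinearMap (b.coord j))) =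
      α (b i) * b.coord i (B.inverse β) := by
    intro i
    have : β = LinearMap.toContinuousLinearMap (β : E →ₗ[ℝ] ℝ) := rfl
    rw [this, toContinuousLinearMap_eq_sum b]
    simp only [hT, map_sum, map_smul, Finset.mul_sum]
    refine Finset.sum_congr rfl fun j _ => ?_
    simp; ring
  simp only [h1]
  have h := congrArg α (b.sum_repr (B.inverse β))
  simp only [map_sum, map_smul, smul_eq_mul] at h
  simp [← h, mul_comm]

theorem contDiffOn_metricTrace {F : Type*} [NormedAddCommGroup F] [NormedSpace ℝ F]
    {B : F → E →L[ℝ] E →L[ℝ] ℝ} {T : F → LinearMap.BilinForm ℝ E} {U : Set F}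
    (hB : ContDiffOn ℝ ∞ (fun y => (B y).inverse) U)
    (hT : ∀ X Y, ContDiffOn ℝ ∞ (fun y => T y X Y) U) :
    ContDiffOn ℝ ∞ (fun y => metricTrace (B y) (T y)) U := by
  simp only [metricTrace_eq_sum (Module.finBasis ℝ E)]
  refine ContDiffOn.sum fun i _ => ContDiffOn.sum fun j _ => (hT _ _).mul ?_
  exact (LinearMap.toContinuousLinearMap ((Module.finBasis ℝ E).coord i)).contDiff.comp_contDiffOn
    (hB.clm_apply contDiffOn_const)

end Trace

/-! ### Smoothness of curvature, Hessian and Laplacian -/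

variable [FiniteDimensional ℝ E]

namespace IsMetricOn

variable {G : E → E →L[ℝ] E →L[ℝ] ℝ} {U : Set E} {f h : E → ℝ}

theorem contDiffOn_curvatureEnd (hG : IsMetricOn G U) (X Y Z : E) :
    ContDiffOn ℝ ∞ (fun y => curvatureEnd G y Y Z X) U := by
  have h1 := hG.contDiffOn_christoffel
  have h2 := contDiffOn_fderiv hG.isOpen h1
  have h2' : ∀ X Y Z, ContDiffOn ℝ ∞ (fun y => fderiv ℝ (christoffel G) y X Y Z) U := fun X Y Z =>
    contDiffOn_clm_apply.1 (contDiffOn_clm_apply.1 (contDiffOn_clm_apply.1 h2 X) Y) Z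
  have h1' : ∀ X Y, ContDiffOn ℝ ∞ (fun y => christoffel G y X Y) U := fun X Y =>
    contDiffOn_clm_apply.1 (contDiffOn_clm_apply.1 h1 X) Y
  simp only [curvatureEnd_apply]
  exact (((h2' X Y Z).sub (h2' Y X Z)).add ((contDiffOn_clm_apply.1 h1 X).clm_apply (h1' Y Z))).sub
    ((contDiffOn_clm_apply.1 h1 Y).clm_apply (h1' X Z))

theorem contDiffOn_ricciForm (hG : IsMetricOn G U) (Y Z : E) :
    ContDiffOn ℝ ∞ (fun y => ricciForm G y Y Z) U := by
  simp only [ricciForm_apply, trace_eq_sum (Module.finBasis ℝ E)]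
  exact ContDiffOn.sum fun i _ =>
    (LinearMap.toContinuousLinearMap ((Module.finBasis ℝ E).coord i)).contDiff.comp_contDiffOn
      (hG.contDiffOn_curvatureEnd _ _ _)

theorem contDiffOn_coordScalar (hG : IsMetricOn G U) : ContDiffOn ℝ ∞ (coordScalar G) U :=
  contDiffOn_metricTrace hG.contDiffOn_inverse hG.contDiffOn_ricciForm

theorem contDiffOn_hessianForm (hG : IsMetricOn G U) (hf : ContDiffOn ℝ ∞ f U) (X Y : E) :
    ContDiffOn ℝ ∞ (fun y => hessianForm G f y X Y) U := by
  have h1 := contDiffOn_fderiv hG.isOpen hf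
  have h2 := contDiffOn_fderiv hG.isOpen h1
  simp only [hessianForm_apply]
  exact (contDiffOn_clm_apply.1 (contDiffOn_clm_apply.1 h2 X) Y).sub
    (h1.clm_apply (contDiffOn_clm_apply.1 (contDiffOn_clm_apply.1 hG.contDiffOn_christoffel X) Y))

theorem contDiffOn_coordLaplacian (hG : IsMetricOn G U) (hf : ContDiffOn ℝ ∞ f U) :
    ContDiffOn ℝ ∞ (coordLaplacian G f) U :=
  contDiffOn_metricTrace hG.contDiffOn_inverse (hG.contDiffOn_hessianForm hf)

theorem contDiffOn_coordGradInner (hG : IsMetricOn G U) (hf : ContDiffOn ℝ ∞ f U)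
    (hh : ContDiffOn ℝ ∞ h U) : ContDiffOn ℝ ∞ (coordGradInner G f h) U :=
  (contDiffOn_fderiv hG.isOpen hf).clm_apply
    (hG.contDiffOn_inverse.clm_apply (contDiffOn_fderiv hG.isOpen hh))

end IsMetricOn

end Coordinates

/-! ### Invariance under local isometries -/

section Naturality

variable {E : Type*} [NormedAddCommGroup E] [NormedSpace ℝ E]

/-- `Φ` is a local isometry from `(U, G')` to `(V, G)`. -/
structure IsIsometryOn (G' G : E → E →L[ℝ] E →L[ℝ] ℝ) (Φ : E → E) (U V : Set E) : Prop where
  source : IsMetricOn G' U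
  target : IsMetricOn G V
  contDiffOn : ContDiffOn ℝ ∞ Φ U
  mapsTo : Set.MapsTo Φ U V
  isInvertible : ∀ y ∈ U, (fderiv ℝ Φ y).IsInvertible
  pullback : ∀ y ∈ U, ∀ X Y, G' y X Y = G (Φ y) (fderiv ℝ Φ y X) (fderiv ℝ Φ y Y)

theorem hasFDerivAt_clm_apply_const {F F' : Type*} [NormedAddCommGroup F] [NormedSpace ℝ F]
    [NormedAddCommGroup F'] [NormedSpace ℝ F'] {A : E → F →L[ℝ] F'} {y : E}
    (hA : DifferentiableAt ℝ A y) (X : F) :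
    HasFDerivAt (fun z => A z X) ((fderiv ℝ A y).flip X) y :=
  ((ContinuousLinearMap.apply ℝ F' X).hasFDerivAt).comp y hA.hasFDerivAt

namespace IsIsometryOn

variable {G' G : E → E →L[ℝ] E →L[ℝ] ℝ} {Φ : E → E} {U V : Set E}

theorem hasFDerivAt (h : IsIsometryOn G' G Φ U V) {y : E} (hy : y ∈ U) :
    HasFDerivAt Φ (fderiv ℝ Φ y) y :=
  (differentiableAt_of_contDiffOn h.source.isOpen h.contDiffOn hy).hasFDerivAt

theorem hasFDerivAt_fderiv_apply (h : IsIsometryOn G' G Φ U V) {y : E} (hy : y ∈ U) (X : E) :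
    HasFDerivAt (fun z => fderiv ℝ Φ z X) ((fderiv ℝ (fderiv ℝ Φ) y).flip X) y :=
  hasFDerivAt_clm_apply_const (differentiableAt_of_contDiffOn h.source.isOpen
    (contDiffOn_fderiv h.source.isOpen h.contDiffOn) hy) X

/-- The product rule applied to the pullback identity, which holds near `y`; the last two terms
record that `DΦ` varies. -/
theorem fderiv_metric (h : IsIsometryOn G' G Φ U V) {y : E} (hy : y ∈ U) (W X Y : E) :
    fderiv ℝ G' y W X Y =
      fderiv ℝ G (Φ y) (fderiv ℝ Φ y W) (fderiv ℝ Φ y X) (fderiv ℝ Φ y Y)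
      + G (Φ y) (fderiv ℝ (fderiv ℝ Φ) y W X) (fderiv ℝ Φ y Y)
      + G (Φ y) (fderiv ℝ Φ y X) (fderiv ℝ (fderiv ℝ Φ) y W Y) := by
  have hc : HasFDerivAt (fun z => G (Φ z)) (fderiv ℝ G (Φ y) ∘L fderiv ℝ Φ y) y :=
    ((differentiableAt_of_contDiffOn h.target.isOpen h.target.contDiffOn
      (h.mapsTo hy)).hasFDerivAt).comp y (h.hasFDerivAt hy)
  have h1 := ((hc.clm_apply (h.hasFDerivAt_fderiv_apply hy X)).clm_apply
    (h.hasFDerivAt_fderiv_apply hy Y))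
  rw [← fderiv_apply_apply
    (differentiableAt_of_contDiffOn h.source.isOpen h.source.contDiffOn hy)]
  have h2 : (fun z => G' z X Y) =ᶠ[𝓝 y]
      fun z => G (Φ z) (fderiv ℝ Φ z X) (fderiv ℝ Φ z Y) := by
    filter_upwards [h.source.isOpen.mem_nhds hy] with z hz using h.pullback z hz X Y
  rw [h2.fderiv_eq, h1.fderiv]
  simp
  ring

/-- In the Koszul combination the second derivatives of `Φ` cancel by the symmetry of `D²Φ` and of
`G`, except for `D²Φ(X, Y)`. -/
theorem christoffelLower (h : IsIsometryOn G' G Φ U V) {y : E} (hy : y ∈ U) (X Y Z : E) :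
    christoffelLower G' y X Y Z =
      christoffelLower G (Φ y) (fderiv ℝ Φ y X) (fderiv ℝ Φ y Y) (fderiv ℝ Φ y Z)
      + G (Φ y) (fderiv ℝ (fderiv ℝ Φ) y X Y) (fderiv ℝ Φ y Z) := by
  simp only [christoffelLower_apply, h.fderiv_metric hy]
  have hs := fderiv_fderiv_symm h.source.isOpen h.contDiffOn hy
  rw [hs Y X, hs Z X, hs Z Y,
    h.target.symm _ (h.mapsTo hy) (fderiv ℝ Φ y Y) (fderiv ℝ (fderiv ℝ Φ) y X Z)]
  ring

/-- The inhomogeneous transformation law. It is checked by pairing with vectors `DΦ Z`, which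
exhaust the space because `DΦ` is invertible. -/
theorem christoffel (h : IsIsometryOn G' G Φ U V) {y : E} (hy : y ∈ U) (X Y : E) :
    fderiv ℝ Φ y (christoffel G' y X Y) =
      christoffel G (Φ y) (fderiv ℝ Φ y X) (fderiv ℝ Φ y Y)
        + fderiv ℝ (fderiv ℝ Φ) y X Y := by
  rw [christoffel_apply G]
  rw [← sub_eq_iff_eq_add, eq_comm,
    (h.target.isInvertible _ (h.mapsTo hy)).inverse_apply_eq]
  ext Z
  obtain ⟨Z, rfl⟩ := (h.isInvertible y hy).surjective Z
  have h1 := h.christoffelLower hy X Y Z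
  rw [map_sub, _root_.sub_apply, ← h.pullback y hy, christoffel_apply,
    h.source.apply_inverse hy, h1]
  ring

/-- The chain rule produces `df(D²Φ(X, Y))`, which is exactly the inhomogeneous term in the law for
the Christoffel symbols. -/
theorem hessianForm (h : IsIsometryOn G' G Φ U V) {f : E → ℝ} (hf : ContDiffOn ℝ ∞ f V) {y : E}
    (hy : y ∈ U) (X Y : E) :
    hessianForm G' (f ∘ Φ) y X Y = hessianForm G f (Φ y) (fderiv ℝ Φ y X) (fderiv ℝ Φ y Y) := by
  have hd : ∀ z ∈ U, HasFDerivAt (f ∘ Φ) (fderiv ℝ f (Φ z) ∘L fderiv ℝ Φ z) z := fun z hz =>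
    ((differentiableAt_of_contDiffOn h.target.isOpen hf (h.mapsTo hz)).hasFDerivAt).comp z
      (h.hasFDerivAt hz)
  have hcomp : ContDiffOn ℝ ∞ (f ∘ Φ) U := hf.comp h.contDiffOn h.mapsTo
  have hd2 : fderiv ℝ (fderiv ℝ (f ∘ Φ)) y X Y =
      fderiv ℝ (fderiv ℝ f) (Φ y) (fderiv ℝ Φ y X) (fderiv ℝ Φ y Y)
        + fderiv ℝ f (Φ y) (fderiv ℝ (fderiv ℝ Φ) y X Y) := by
    have e1 := (hasFDerivAt_clm_apply_const (differentiableAt_of_contDiffOn h.source.isOpen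
      (contDiffOn_fderiv h.source.isOpen hcomp) hy) Y).fderiv
    have e2 : (fun z => fderiv ℝ (f ∘ Φ) z Y) =ᶠ[𝓝 y]
        fun z => fderiv ℝ f (Φ z) (fderiv ℝ Φ z Y) := by
      filter_upwards [h.source.isOpen.mem_nhds hy] with z hz
      rw [(hd z hz).fderiv]; rfl
    have e3 : HasFDerivAt (fun z => fderiv ℝ f (Φ z))
        (fderiv ℝ (fderiv ℝ f) (Φ y) ∘L fderiv ℝ Φ y) y :=
      ((differentiableAt_of_contDiffOn h.target.isOpen (contDiffOn_fderiv h.target.isOpen hf)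
        (h.mapsTo hy)).hasFDerivAt).comp y (h.hasFDerivAt hy)
    have e4 := (e3.clm_apply (h.hasFDerivAt_fderiv_apply hy Y)).fderiv
    rw [e2.fderiv_eq, e4] at e1
    have e5 := congrArg (fun T => T X) e1
    simp only [ContinuousLinearMap.flip_apply] at e5
    rw [← e5]
    simp [add_comm]
  rw [hessianForm_apply, hessianForm_apply, hd2, (hd y hy).fderiv, ContinuousLinearMap.comp_apply,
    h.christoffel hy, map_add]
  ring

theorem coordGradInner (h : IsIsometryOn G' G Φ U V) {f k : E → ℝ} (hf : ContDiffOn ℝ ∞ f V)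
    (hk : ContDiffOn ℝ ∞ k V) {y : E} (hy : y ∈ U) :
    coordGradInner G' (f ∘ Φ) (k ∘ Φ) y = coordGradInner G f k (Φ y) := by
  have hd : ∀ {f : E → ℝ}, ContDiffOn ℝ ∞ f V → fderiv ℝ (f ∘ Φ) y =
      fderiv ℝ f (Φ y) ∘L fderiv ℝ Φ y := fun hf =>
    (((differentiableAt_of_contDiffOn h.target.isOpen hf (h.mapsTo hy)).hasFDerivAt).comp y
      (h.hasFDerivAt hy)).fderiv
  rw [WeightedGJMS.coordGradInner, WeightedGJMS.coordGradInner, hd hf, hd hk]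
  obtain ⟨N, hN⟩ := (h.isInvertible y hy).surjective ((G (Φ y)).inverse (fderiv ℝ k (Φ y)))
  have : (G' y).inverse (fderiv ℝ k (Φ y) ∘L fderiv ℝ Φ y) = N := by
    rw [(h.source.isInvertible y hy).inverse_apply_eq]
    ext Z
    rw [h.pullback y hy, hN, h.target.apply_inverse (h.mapsTo hy)]; rfl
  rw [this, ContinuousLinearMap.comp_apply, hN]

variable [FiniteDimensional ℝ E]

/-- The transformation law holds on an open set, so both of its sides may be differentiated; this
isolates the derivative of the symbols. -/
theorem fderiv_christoffel (h : IsIsometryOn G' G Φ U V) {y : E} (hy : y ∈ U) (W X Y : E) :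
    fderiv ℝ Φ y (fderiv ℝ (WeightedGJMS.christoffel G') y W X Y) =
      fderiv ℝ (WeightedGJMS.christoffel G) (Φ y) (fderiv ℝ Φ y W) (fderiv ℝ Φ y X)
        (fderiv ℝ Φ y Y)
      + WeightedGJMS.christoffel G (Φ y) (fderiv ℝ (fderiv ℝ Φ) y W X) (fderiv ℝ Φ y Y)
      + WeightedGJMS.christoffel G (Φ y) (fderiv ℝ Φ y X) (fderiv ℝ (fderiv ℝ Φ) y W Y)
      + fderiv ℝ (fderiv ℝ (fderiv ℝ Φ)) y W X Y
      - fderiv ℝ (fderiv ℝ Φ) y W (WeightedGJMS.christoffel G' y X Y) := by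
  have hU := h.source.isOpen
  have hΦ' := contDiffOn_fderiv hU h.contDiffOn
  have hΓ' := differentiableAt_of_contDiffOn hU h.source.contDiffOn_christoffel hy
  have hΓ'' : HasFDerivAt (fun z => WeightedGJMS.christoffel G' z X Y)
      (((fderiv ℝ (WeightedGJMS.christoffel G') y).flip X).flip Y) y := by
    have := hasFDerivAt_clm_apply_const
      (hasFDerivAt_clm_apply_const hΓ' X).differentiableAt Y
    rwa [(hasFDerivAt_clm_apply_const hΓ' X).fderiv] at this
  have l := ((differentiableAt_of_contDiffOn hU hΦ' hy).hasFDerivAt).clm_apply hΓ''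
  have hc : HasFDerivAt (fun z => WeightedGJMS.christoffel G (Φ z))
      (fderiv ℝ (WeightedGJMS.christoffel G) (Φ y) ∘L fderiv ℝ Φ y) y :=
    ((differentiableAt_of_contDiffOn h.target.isOpen h.target.contDiffOn_christoffel
      (h.mapsTo hy)).hasFDerivAt).comp y (h.hasFDerivAt hy)
  have r1 := (hc.clm_apply (h.hasFDerivAt_fderiv_apply hy X)).clm_apply
    (h.hasFDerivAt_fderiv_apply hy Y)
  have hB := differentiableAt_of_contDiffOn hU (contDiffOn_fderiv hU hΦ') hy
  have r2 : HasFDerivAt (fun z => fderiv ℝ (fderiv ℝ Φ) z X Y)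
      (((fderiv ℝ (fderiv ℝ (fderiv ℝ Φ)) y).flip X).flip Y) y := by
    have := hasFDerivAt_clm_apply_const
      (hasFDerivAt_clm_apply_const hB X).differentiableAt Y
    rwa [(hasFDerivAt_clm_apply_const hB X).fderiv] at this
  have e : (fun z => fderiv ℝ Φ z (WeightedGJMS.christoffel G' z X Y)) =ᶠ[𝓝 y]
      fun z => WeightedGJMS.christoffel G (Φ z) (fderiv ℝ Φ z X) (fderiv ℝ Φ z Y)
        + fderiv ℝ (fderiv ℝ Φ) z X Y := by
    filter_upwards [hU.mem_nhds hy] with z hz using h.christoffel hz X Y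
  have key := (l.congr_of_eventuallyEq e.symm).unique (r1.add r2)
  have key' := congrArg (fun T => T W) key
  simp at key'
  rw [eq_sub_iff_add_eq, key']
  abel

/-- Antisymmetrising in `X` and `Y` removes the third derivatives of `Φ`. The remaining terms in
`D²Φ` cancel against those which the quadratic terms in the symbols produce. -/
theorem curvatureEnd (h : IsIsometryOn G' G Φ U V) {y : E} (hy : y ∈ U) (X Y Z : E) :
    fderiv ℝ Φ y (curvatureEnd G' y Y Z X) =
      curvatureEnd G (Φ y) (fderiv ℝ Φ y Y) (fderiv ℝ Φ y Z) (fderiv ℝ Φ y X) := by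
  simp only [curvatureEnd_apply, map_add, map_sub, h.fderiv_christoffel hy, h.christoffel hy]
  rw [fderiv_fderiv_symm h.source.isOpen (contDiffOn_fderiv h.source.isOpen h.contDiffOn) hy Y X,
    fderiv_fderiv_symm h.source.isOpen h.contDiffOn hy Y X]
  abel

/-- The curvature endomorphisms on the two sides are conjugate by `DΦ`, and traces are invariant
under conjugation. -/
theorem ricciForm (h : IsIsometryOn G' G Φ U V) {y : E} (hy : y ∈ U) (Y Z : E) :
    ricciForm G' y Y Z = ricciForm G (Φ y) (fderiv ℝ Φ y Y) (fderiv ℝ Φ y Z) := by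
  obtain ⟨e, he⟩ := h.isInvertible y hy
  rw [ricciForm_apply, ricciForm_apply, ← LinearMap.trace_conj' _ e.toLinearEquiv]
  congr 1
  ext X
  have := h.curvatureEnd hy (e.symm X) Y Z
  rw [← he] at this ⊢
  simpa [LinearEquiv.conj_apply] using this

theorem metricTrace (h : IsIsometryOn G' G Φ U V) {y : E} (hy : y ∈ U)
    {T' T : LinearMap.BilinForm ℝ E}
    (hT : ∀ X Y, T' X Y = T (fderiv ℝ Φ y X) (fderiv ℝ Φ y Y)) :
    metricTrace (G' y) T' = metricTrace (G (Φ y)) T := by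
  obtain ⟨e, he⟩ := h.isInvertible y hy
  rw [WeightedGJMS.metricTrace, WeightedGJMS.metricTrace,
    ← LinearMap.trace_conj' _ e.toLinearEquiv]
  congr 1
  ext X
  have hp := h.pullback y hy
  simp only [← he] at hT hp
  -- The endomorphisms obtained by raising an index of `T'` and of `T` are conjugate by `DΦ`.
  have key : (G' y).inverse (LinearMap.toContinuousLinearMap (T' (e.symm X))) =
      e.symm ((G (Φ y)).inverse (LinearMap.toContinuousLinearMap (T X))) := by
    rw [(h.source.isInvertible y hy).inverse_apply_eq]
    ext Z
    rw [hp]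
    simp [hT, h.target.apply_inverse (h.mapsTo hy)]
  have key' := congrArg e key
  rw [e.apply_symm_apply] at key'
  simpa [LinearEquiv.conj_apply] using key'

theorem coordLaplacian (h : IsIsometryOn G' G Φ U V) {f : E → ℝ} (hf : ContDiffOn ℝ ∞ f V)
    {y : E} (hy : y ∈ U) : coordLaplacian G' (f ∘ Φ) y = coordLaplacian G f (Φ y) :=
  h.metricTrace hy (h.hessianForm hf hy)

theorem coordScalar (h : IsIsometryOn G' G Φ U V) {y : E} (hy : y ∈ U) :
    coordScalar G' y = coordScalar G (Φ y) :=
  h.metricTrace hy (h.ricciForm hy)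

end IsIsometryOn

end Naturality

/-! ### Product and exponential rules, and conformal covariance in coordinates -/

section Leibniz

variable {E : Type*} [NormedAddCommGroup E] [NormedSpace ℝ E]

namespace IsMetricOn

variable {G : E → E →L[ℝ] E →L[ℝ] ℝ} {U : Set E} {f f' h : E → ℝ} {y : E}

theorem coordGradInner_comm (hG : IsMetricOn G U) (f h : E → ℝ) (hy : y ∈ U) :
    coordGradInner G f h y = coordGradInner G h f y :=
  hG.apply_inverse_comm hy _ _

theorem coordGradInner_add_left (hG : IsMetricOn G U) (hf : ContDiffOn ℝ ∞ f U)
    (hf' : ContDiffOn ℝ ∞ f' U) (hy : y ∈ U) :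
    coordGradInner G (f + f') h y = coordGradInner G f h y + coordGradInner G f' h y := by
  simp only [coordGradInner]
  rw [fderiv_add (differentiableAt_of_contDiffOn hG.isOpen hf hy)
    (differentiableAt_of_contDiffOn hG.isOpen hf' hy)]
  rfl

theorem coordGradInner_add_right (hG : IsMetricOn G U) (hf : ContDiffOn ℝ ∞ f U)
    (hf' : ContDiffOn ℝ ∞ f' U) (hy : y ∈ U) :
    coordGradInner G h (f + f') y = coordGradInner G h f y + coordGradInner G h f' y := by
  rw [hG.coordGradInner_comm h _ hy, hG.coordGradInner_comm h f hy, hG.coordGradInner_comm h f' hy,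
    hG.coordGradInner_add_left hf hf' hy]

theorem coordGradInner_const_mul_right (hG : IsMetricOn G U) (hf : ContDiffOn ℝ ∞ f U)
    (c : ℝ) (hy : y ∈ U) :
    coordGradInner G h (fun z => c * f z) y = c * coordGradInner G h f y := by
  simp only [coordGradInner]
  rw [fderiv_const_mul (differentiableAt_of_contDiffOn hG.isOpen hf hy)]
  simp

theorem coordGradInner_mul_right (hG : IsMetricOn G U) (hf : ContDiffOn ℝ ∞ f U)
    (hf' : ContDiffOn ℝ ∞ f' U) (hy : y ∈ U) :
    coordGradInner G h (f * f') y =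
      f y * coordGradInner G h f' y + f' y * coordGradInner G h f y := by
  simp only [coordGradInner]
  rw [fderiv_mul (differentiableAt_of_contDiffOn hG.isOpen hf hy)
    (differentiableAt_of_contDiffOn hG.isOpen hf' hy)]
  simp

theorem coordGradInner_exp_right (hG : IsMetricOn G U) (hf : ContDiffOn ℝ ∞ f U)
    (c : ℝ) (hy : y ∈ U) :
    coordGradInner G h (fun z => Real.exp (c * f z)) y =
      c * Real.exp (c * f y) * coordGradInner G h f y := by
  simp only [coordGradInner]
  have hd := differentiableAt_of_contDiffOn hG.isOpen hf hy
  rw [fderiv_exp (hd.const_mul c), fderiv_const_mul hd]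
  simp; ring

theorem hessianForm_add (hG : IsMetricOn G U) (hf : ContDiffOn ℝ ∞ f U)
    (hf' : ContDiffOn ℝ ∞ f' U) (hy : y ∈ U) :
    hessianForm G (f + f') y = hessianForm G f y + hessianForm G f' y := by
  have hd : ∀ {f : E → ℝ}, ContDiffOn ℝ ∞ f U → ∀ z ∈ U, DifferentiableAt ℝ f z := fun hf z hz =>
    differentiableAt_of_contDiffOn hG.isOpen hf hz
  have h1 : fderiv ℝ (f + f') =ᶠ[𝓝 y] fderiv ℝ f + fderiv ℝ f' := by
    filter_upwards [hG.isOpen.mem_nhds hy] with z hz using fderiv_add (hd hf z hz) (hd hf' z hz)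
  have h2 : fderiv ℝ (fderiv ℝ f + fderiv ℝ f') y = _ := fderiv_add
    (differentiableAt_of_contDiffOn hG.isOpen (contDiffOn_fderiv hG.isOpen hf) hy)
    (differentiableAt_of_contDiffOn hG.isOpen (contDiffOn_fderiv hG.isOpen hf') hy)
  ext X Y
  rw [LinearMap.add_apply, LinearMap.add_apply, hessianForm_apply, hessianForm_apply,
    hessianForm_apply, h1.fderiv_eq, h2, h1.eq_of_nhds]
  simp; ring

theorem hessianForm_mul (hG : IsMetricOn G U) (hf : ContDiffOn ℝ ∞ f U)
    (hf' : ContDiffOn ℝ ∞ f' U) (hy : y ∈ U) (X Y : E) :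
    hessianForm G (f * f') y X Y = f y * hessianForm G f' y X Y + f' y * hessianForm G f y X Y
      + fderiv ℝ f y X * fderiv ℝ f' y Y + fderiv ℝ f' y X * fderiv ℝ f y Y := by
  have hd : ∀ {f : E → ℝ}, ContDiffOn ℝ ∞ f U → ∀ z ∈ U, DifferentiableAt ℝ f z := fun hf z hz =>
    differentiableAt_of_contDiffOn hG.isOpen hf hz
  have hd' : ∀ {f : E → ℝ}, ContDiffOn ℝ ∞ f U → DifferentiableAt ℝ (fderiv ℝ f) y := fun hf =>
    differentiableAt_of_contDiffOn hG.isOpen (contDiffOn_fderiv hG.isOpen hf) hy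
  have h1 : fderiv ℝ (f * f') =ᶠ[𝓝 y] fun z => f z • fderiv ℝ f' z + f' z • fderiv ℝ f z := by
    filter_upwards [hG.isOpen.mem_nhds hy] with z hz using fderiv_mul (hd hf z hz) (hd hf' z hz)
  have h2 := (((hd hf y hy).hasFDerivAt.smul (hd' hf').hasFDerivAt).add
    ((hd hf' y hy).hasFDerivAt.smul (hd' hf).hasFDerivAt)).fderiv
  have h3 : fderiv ℝ (fun z => f z • fderiv ℝ f' z + f' z • fderiv ℝ f z) y = _ := h2
  rw [hessianForm_apply, hessianForm_apply, hessianForm_apply, h1.fderiv_eq, h3, h1.eq_of_nhds]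
  simp; ring

theorem hessianForm_const_mul (hG : IsMetricOn G U) (hf : ContDiffOn ℝ ∞ f U)
    (c : ℝ) (hy : y ∈ U) : hessianForm G (fun z => c * f z) y = c • hessianForm G f y := by
  ext X Y
  have h := hG.hessianForm_mul (contDiffOn_const (c := c)) hf hy X Y
  have h0 : hessianForm G (fun _ => c) y X Y = 0 := by
    have : fderiv ℝ (fun _ : E => c) = 0 := by ext; simp
    rw [hessianForm_apply, this]; simp
  have h1 : (fun z => c * f z) = (fun _ => c) * f := rfl
  rw [h1, h, h0]
  simp

theorem hessianForm_exp (hG : IsMetricOn G U) (hf : ContDiffOn ℝ ∞ f U)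
    (c : ℝ) (hy : y ∈ U) (X Y : E) :
    hessianForm G (fun z => Real.exp (c * f z)) y X Y = Real.exp (c * f y) *
      (c * hessianForm G f y X Y + c ^ 2 * (fderiv ℝ f y X * fderiv ℝ f y Y)) := by
  have hd : ∀ z ∈ U, HasFDerivAt (fun z => Real.exp (c * f z))
      (Real.exp (c * f z) • c • fderiv ℝ f z) z := fun z hz =>
    ((differentiableAt_of_contDiffOn hG.isOpen hf hz).hasFDerivAt.const_mul c).exp
  have hd' := differentiableAt_of_contDiffOn hG.isOpen (contDiffOn_fderiv hG.isOpen hf) hy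
  have h1 : fderiv ℝ (fun z => Real.exp (c * f z)) =ᶠ[𝓝 y]
      fun z => Real.exp (c * f z) • c • fderiv ℝ f z := by
    filter_upwards [hG.isOpen.mem_nhds hy] with z hz using (hd z hz).fderiv
  have h2 := ((hd y hy).smul (hd'.hasFDerivAt.const_smul c)).fderiv
  have h3 : fderiv ℝ (fun z => Real.exp (c * f z) • c • fderiv ℝ f z) y = _ := h2
  rw [hessianForm_apply, hessianForm_apply, h1.fderiv_eq, h3, h1.eq_of_nhds]
  simp; ring

variable [FiniteDimensional ℝ E]

theorem coordLaplacian_add (hG : IsMetricOn G U) (hf : ContDiffOn ℝ ∞ f U)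
    (hf' : ContDiffOn ℝ ∞ f' U) (hy : y ∈ U) :
    coordLaplacian G (f + f') y = coordLaplacian G f y + coordLaplacian G f' y := by
  rw [coordLaplacian, hG.hessianForm_add hf hf' hy, metricTrace_add]; rfl

theorem coordLaplacian_const_mul (hG : IsMetricOn G U) (hf : ContDiffOn ℝ ∞ f U)
    (c : ℝ) (hy : y ∈ U) : coordLaplacian G (fun z => c * f z) y = c * coordLaplacian G f y := by
  rw [coordLaplacian, hG.hessianForm_const_mul hf c hy, metricTrace_smul]; rfl

/-- The form `α ⊗ β`. -/
theorem metricTrace_outer (B : E →L[ℝ] E →L[ℝ] ℝ) (α β : E →L[ℝ] ℝ) :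
    metricTrace B (((LinearMap.toSpanSingleton ℝ _ (β : E →ₗ[ℝ] ℝ)) ∘ₗ (α : E →ₗ[ℝ] ℝ)) :
      LinearMap.BilinForm ℝ E) = α (B.inverse β) :=
  metricTrace_mul B α β _ fun X Y => by simp

theorem coordLaplacian_mul (hG : IsMetricOn G U) (hf : ContDiffOn ℝ ∞ f U)
    (hf' : ContDiffOn ℝ ∞ f' U) (hy : y ∈ U) :
    coordLaplacian G (f * f') y = f y * coordLaplacian G f' y + f' y * coordLaplacian G f y
      + 2 * coordGradInner G f f' y := by
  have h1 : hessianForm G (f * f') y = f y • hessianForm G f' y + f' y • hessianForm G f y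
      + ((LinearMap.toSpanSingleton ℝ _ (fderiv ℝ f' y : E →ₗ[ℝ] ℝ)) ∘ₗ
        (fderiv ℝ f y : E →ₗ[ℝ] ℝ))
      + ((LinearMap.toSpanSingleton ℝ _ (fderiv ℝ f y : E →ₗ[ℝ] ℝ)) ∘ₗ
        (fderiv ℝ f' y : E →ₗ[ℝ] ℝ)) := by
    ext X Y
    rw [hG.hessianForm_mul hf hf' hy]
    simp
  have h2 := hG.coordGradInner_comm f f' hy
  rw [coordLaplacian, h1, metricTrace_add, metricTrace_add, metricTrace_add, metricTrace_smul,
    metricTrace_smul, metricTrace_outer, metricTrace_outer]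
  simp only [coordLaplacian, coordGradInner] at h2 ⊢
  linarith

theorem coordLaplacian_exp (hG : IsMetricOn G U) (hf : ContDiffOn ℝ ∞ f U)
    (c : ℝ) (hy : y ∈ U) :
    coordLaplacian G (fun z => Real.exp (c * f z)) y = Real.exp (c * f y) *
      (c * coordLaplacian G f y + c ^ 2 * coordGradInner G f f y) := by
  have h1 : hessianForm G (fun z => Real.exp (c * f z)) y = Real.exp (c * f y) •
      (c • hessianForm G f y + c ^ 2 • ((LinearMap.toSpanSingleton ℝ _
        (fderiv ℝ f y : E →ₗ[ℝ] ℝ)) ∘ₗ (fderiv ℝ f y : E →ₗ[ℝ] ℝ))) := by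
    ext X Y
    rw [hG.hessianForm_exp hf c hy]
    simp [mul_add]
  rw [coordLaplacian, h1, metricTrace_smul, metricTrace_add, metricTrace_smul,
    metricTrace_smul, metricTrace_outer]
  rfl

end IsMetricOn

/-- The operator `Δ_φ - ¼ R_φ` in coordinates. -/
def coordFactor [FiniteDimensional ℝ E] (G : E → E →L[ℝ] E →L[ℝ] ℝ) (φ f : E → ℝ) (y : E) : ℝ :=
  coordLaplacian G f y - coordGradInner G φ f y - 1 / 4 *
    (coordScalar G y + 2 * coordLaplacian G φ y - coordGradInner G φ φ y) * f y

/-- The term `-g(∇v, ∇f)` from differentiating `e^{-v/2}` cancels the drift change `+g(∇v, ∇f)`. The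
zeroth order terms `-½Δv + ½g(∇φ, ∇v) - ¼|∇v|²` cancel the change of `-¼ R_φ`. Weight `-1/2` is what
makes the first cancellation occur. -/
theorem IsMetricOn.coordFactor_conformal [FiniteDimensional ℝ E] {G : E → E →L[ℝ] E →L[ℝ] ℝ}
    {U : Set E} (hG : IsMetricOn G U) {φ v f : E → ℝ} (hφ : ContDiffOn ℝ ∞ φ U)
    (hv : ContDiffOn ℝ ∞ v U) (hf : ContDiffOn ℝ ∞ f U) {y : E} (hy : y ∈ U) :
    coordFactor G (φ + fun z => -1 * v z) ((fun z => Real.exp (-1 / 2 * v z)) * f) y =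
      Real.exp (-1 / 2 * v y) * coordFactor G φ f y := by
  have he : ContDiffOn ℝ ∞ (fun z => Real.exp (-1 / 2 * v z)) U :=
    (contDiffOn_const.mul hv).exp
  have hv' : ContDiffOn ℝ ∞ (fun z => -1 * v z) U := contDiffOn_const.mul hv
  have c1 := fun f h => hG.coordGradInner_comm f h hy
  simp only [coordFactor]
  rw [hG.coordLaplacian_mul he hf hy, hG.coordLaplacian_exp hv _ hy,
    hG.coordGradInner_mul_right he hf hy, hG.coordGradInner_exp_right hv _ hy,
    hG.coordLaplacian_add hφ hv' hy, hG.coordLaplacian_const_mul hv _ hy,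
    hG.coordGradInner_add_left hφ hv' hy, hG.coordGradInner_add_left hφ hv' hy,
    hG.coordGradInner_add_left hφ hv' hy,
    hG.coordGradInner_add_right hφ hv' hy, hG.coordGradInner_add_right hφ hv' hy,
    hG.coordGradInner_const_mul_right hv _ hy, hG.coordGradInner_const_mul_right hv _ hy,
    c1 (fun z => -1 * v z) f, hG.coordGradInner_const_mul_right hv _ hy,
    c1 (fun z => -1 * v z) v, hG.coordGradInner_const_mul_right hv _ hy,
    c1 (fun z => -1 * v z) φ, hG.coordGradInner_const_mul_right hv _ hy,
    c1 (fun z => Real.exp (-1 / 2 * v z)) f, hG.coordGradInner_exp_right hv _ hy,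
    Pi.mul_apply]
  ring

end Leibniz

theorem isInvertible_of_nondegenerate {E : Type*} [NormedAddCommGroup E] [NormedSpace ℝ E]
    [FiniteDimensional ℝ E] {B : E →L[ℝ] E →L[ℝ] ℝ} (hB : ∀ X, (∀ Y, B X Y = 0) → X = 0) :
    B.IsInvertible := by
  have hinj : Function.Injective (B : E →ₗ[ℝ] (E →L[ℝ] ℝ)) := by
    rw [← LinearMap.ker_eq_bot, LinearMap.ker_eq_bot']
    exact fun X hX => hB X fun Y => by
      have := congrArg (fun T : E →L[ℝ] ℝ => T Y) hX
      simpa using this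
  have hdim : Module.finrank ℝ E = Module.finrank ℝ (E →L[ℝ] ℝ) := by
    rw [← (LinearMap.toContinuousLinearMap : (E →ₗ[ℝ] ℝ) ≃ₗ[ℝ] (E →L[ℝ] ℝ)).finrank_eq]
    exact (Subspace.dual_finrank_eq (K := ℝ) (V := E)).symm
  refine ⟨(LinearEquiv.ofInjectiveOfFinrankEq _ hinj hdim).toContinuousLinearEquiv, ?_⟩
  ext X Y
  rfl

theorem IsMetricOn.mono {E : Type*} [NormedAddCommGroup E] [NormedSpace ℝ E]
    {G : E → E →L[ℝ] E →L[ℝ] ℝ} {U V : Set E} (hG : IsMetricOn G U) (hV : IsOpen V) (h : V ⊆ U) :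
    IsMetricOn G V :=
  ⟨hV, hG.contDiffOn.mono h, fun y hy => hG.symm y (h hy), fun y hy => hG.isInvertible y (h hy)⟩

/-! ### From the preferred charts to a fixed chart -/

section Manifold

variable {E : Type*} [NormedAddCommGroup E] [NormedSpace ℝ E]
  {H : Type*} [TopologicalSpace H] (I : ModelWithCorners ℝ E H)
  {M : Type*} [TopologicalSpace M] [ChartedSpace H M]

/-- A field of bilinear forms on an open subset of a manifold that is a smooth pseudo-Riemannian
metric. -/
structure IsSmoothMetricOn [IsManifold I ∞ M]
    (g : ∀ x : M, TangentSpace I x →L[ℝ] TangentSpace I x →L[ℝ] ℝ)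
    (S : Set M) : Prop where
  isOpen : IsOpen S
  contMDiffOn : ContMDiffOn I (I.prod 𝓘(ℝ, E →L[ℝ] E →L[ℝ] ℝ)) ∞
    (fun x : M => Bundle.TotalSpace.mk' (E →L[ℝ] E →L[ℝ] ℝ)
      (E := fun x : M => TangentSpace I x →L[ℝ] TangentSpace I x →L[ℝ] ℝ) x (g x)) S
  symm : ∀ x ∈ S, ∀ X Y, g x X Y = g x Y X
  nondegenerate : ∀ x ∈ S, ∀ X, (∀ Y, g x X Y = 0) → X = 0

/-- The part of the range of the chart at `x` that corresponds to `S`. -/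
def chartSet (x : M) (S : Set M) : Set E :=
  (extChartAt I x).target ∩ (extChartAt I x).symm ⁻¹' S

variable {I}

theorem mem_chartSet {x z : M} {S : Set M} (hz : z ∈ S) (hx : z ∈ (extChartAt I x).source) :
    extChartAt I x z ∈ chartSet I x S :=
  ⟨(extChartAt I x).map_source hx, by
    rw [Set.mem_preimage, (extChartAt I x).left_inv hx]; exact hz⟩

/-- The differential of the inverse chart, as a map of the model space. -/
def chartDeriv (I : ModelWithCorners ℝ E H) (x : M) (y : E) : E →L[ℝ] E :=
  mfderiv 𝓘(ℝ, E) I (extChartAt I x).symm y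

theorem chartMetric_apply (g : ∀ x : M, TangentSpace I x →L[ℝ] TangentSpace I x →L[ℝ] ℝ) (x : M)
    (y X Y : E) : chartMetric I g x y X Y =
      (show E →L[ℝ] E →L[ℝ] ℝ from g ((extChartAt I x).symm y)) (chartDeriv I x y X)
        (chartDeriv I x y Y) := rfl

/-- Locality. Iterates of the ambient Laplacian are identified only on the open domain of the
metric, and this permits another application there. -/
theorem weightedLaplacian_congr [FiniteDimensional ℝ E]
    {g : ∀ x : M, TangentSpace I x →L[ℝ] TangentSpace I x →L[ℝ] ℝ}
    {φ f f' : M → ℝ} {x : M} (h : f =ᶠ[𝓝 x] f') :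
    weightedLaplacian I g φ f x = weightedLaplacian I g φ f' x := by
  have h1 : f ∘ (extChartAt I x).symm =ᶠ[𝓝 (extChartAt I x x)] f' ∘ (extChartAt I x).symm := by
    have h2 := continuousAt_extChartAt_symm (I := I) x
    rw [ContinuousAt, extChartAt_to_inv] at h2
    exact h2.eventually h
  have h2 := coordLaplacian_congr (chartMetric I g x) h1
  have h3 := coordGradInner_congr (chartMetric I g x)
    (Filter.EventuallyEq.refl (𝓝 (extChartAt I x x)) (φ ∘ (extChartAt I x).symm)) h1
  exact congrArg₂ (· - ·) h2 h3

section

variable [IsManifold I ∞ M]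

theorem contDiffOn_comp_symm {f : M → ℝ} {S : Set M} (hf : ContMDiffOn I 𝓘(ℝ, ℝ) ∞ f S) (x : M) :
    ContDiffOn ℝ ∞ (f ∘ (extChartAt I x).symm) (chartSet I x S) :=
  contMDiffOn_iff_contDiffOn.1
    (hf.comp ((contMDiffOn_extChartAt_symm x).mono Set.inter_subset_left) Set.inter_subset_right)

/-- A function that is smooth in every chart is smooth. -/
theorem contMDiffOn_of_chart {S : Set M} (hS : IsOpen S) {F : M → ℝ} {F' : M → E → ℝ}
    (h : ∀ x, ContDiffOn ℝ ∞ (F' x) (chartSet I x S))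
    (hF : ∀ x z, z ∈ S → z ∈ (extChartAt I x).source → F z = F' x (extChartAt I x z)) :
    ContMDiffOn I 𝓘(ℝ, ℝ) ∞ F S := by
  intro x hx
  have h1 : ContMDiffOn I 𝓘(ℝ, ℝ) ∞ (F' x ∘ extChartAt I x) (S ∩ (extChartAt I x).source) := by
    refine (contMDiffOn_iff_contDiffOn.2 (h x)).comp
      ((contMDiffOn_extChartAt (n := ∞)).mono fun z hz => ?_) fun z hz => mem_chartSet hz.1 hz.2
    rw [← extChartAt_source I]
    exact hz.2
  have h2 : ContMDiffOn I 𝓘(ℝ, ℝ) ∞ F (S ∩ (extChartAt I x).source) :=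
    h1.congr fun z hz => hF x z hz.1 hz.2
  exact (h2.contMDiffAt ((hS.inter (isOpen_extChartAt_source x)).mem_nhds
    ⟨hx, mem_extChartAt_source x⟩)).contMDiffWithinAt

end

variable [I.Boundaryless]

theorem isOpen_chartSet (x : M) {S : Set M} (hS : IsOpen S) : IsOpen (chartSet I x S) :=
  (continuousOn_extChartAt_symm x).isOpen_inter_preimage (isOpen_extChartAt_target x) hS

variable [IsManifold I ∞ M]

theorem mdifferentiableAt_symm {x : M} {y : E} (hy : y ∈ (extChartAt I x).target) :
    MDifferentiableAt 𝓘(ℝ, E) I (extChartAt I x).symm y :=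
  ((contMDiffOn_extChartAt_symm (n := ∞) x).contMDiffAt
    ((isOpen_extChartAt_target x).mem_nhds hy)).mdifferentiableAt (by simp)

theorem isInvertible_chartDeriv {x : M} {y : E} (hy : y ∈ (extChartAt I x).target) :
    (chartDeriv I x y).IsInvertible := by
  have : IsManifold I 1 M := IsManifold.of_le (n := ∞) (by simp)
  have h := isInvertible_mfderivWithin_extChartAt_symm hy
  rwa [I.range_eq_univ, mfderivWithin_univ] at h

/-- The coordinate fields are images of constant sections under the tangent map of the inverse
chart, which is smooth as a map of tangent bundles. -/
theorem contMDiffOn_chartDeriv (x : M) (X : E) :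
    ContMDiffOn 𝓘(ℝ, E) I.tangent ∞ (fun y => Bundle.TotalSpace.mk' E
      (E := TangentSpace I) ((extChartAt I x).symm y) (chartDeriv I x y X))
      (extChartAt I x).target := by
  have h1 := (contMDiffOn_extChartAt_symm (I := I) (n := ∞) x).contMDiffOn_tangentMapWithin
    (m := ∞) (by simp) (isOpen_extChartAt_target x).uniqueMDiffOn
  have h2 : ContMDiffOn 𝓘(ℝ, E) 𝓘(ℝ, E).tangent ∞ (fun y => Bundle.TotalSpace.mk' E
      (E := TangentSpace 𝓘(ℝ, E)) y X) (extChartAt I x).target :=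
    contMDiffOn_vectorSpace_iff_contDiffOn.2 contDiffOn_const
  refine (h1.comp h2 fun y hy => hy).congr fun y hy => ?_
  simp only [Function.comp_apply, tangentMapWithin]
  rw [mfderivWithin_of_isOpen (isOpen_extChartAt_target x) hy]
  rfl

variable [FiniteDimensional ℝ E] {g : ∀ x : M, TangentSpace I x →L[ℝ] TangentSpace I x →L[ℝ] ℝ}
  {S : Set M}

namespace IsSmoothMetricOn

theorem isMetricOn_chartMetric (hg : IsSmoothMetricOn I g S) (x : M) :
    IsMetricOn (chartMetric I g x) (chartSet I x S) where
  isOpen := isOpen_chartSet x hg.isOpen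
  contDiffOn := by
    refine contDiffOn_clm_apply.2 fun X => contDiffOn_clm_apply.2 fun Y => ?_
    rw [← contMDiffOn_iff_contDiffOn]
    have h0 := hg.contMDiffOn.comp
      ((contMDiffOn_extChartAt_symm x).mono Set.inter_subset_left)
      (Set.inter_subset_right : chartSet I x S ⊆ _)
    have : ContMDiffOn 𝓘(ℝ, E) (I.prod 𝓘(ℝ)) ∞
      (fun y ↦ Bundle.TotalSpace.mk' ℝ (E := Bundle.Trivial M ℝ) ((extChartAt I x).symm y)
        (chartMetric I g x y X Y)) (chartSet I x S) := by
      apply ContMDiffOn.clm_bundle_apply₂ (F₁ := E) (F₂ := E)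
      · exact h0
      · exact (contMDiffOn_chartDeriv x X).mono Set.inter_subset_left
      · exact (contMDiffOn_chartDeriv x Y).mono Set.inter_subset_left
    intro y hy
    have h1 := this y hy
    simp only [Bundle.contMDiffWithinAt_totalSpace] at h1
    exact h1.2
  symm y hy X Y := hg.symm _ hy.2 _ _
  isInvertible y hy := by
    refine isInvertible_of_nondegenerate fun X hX => ?_
    have hi := isInvertible_chartDeriv hy.1
    have h1 : chartDeriv I x y X = 0 := by
      refine hg.nondegenerate _ hy.2 _ fun Z => ?_
      obtain ⟨Y, hY⟩ := hi.surjective Z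
      rw [← hY]
      exact hX Y
    exact hi.injective (h1.trans (map_zero _).symm)

/-- Both chart metrics are pullbacks of the same `g`. The chain rule for one inverse chart, factored
through the other and the transition map, gives the isometry. -/
theorem isIsometryOn_chartChange (hg : IsSmoothMetricOn I g S) (x x' : M) :
    IsIsometryOn (chartMetric I g x) (chartMetric I g x')
      (extChartAt I x' ∘ (extChartAt I x).symm)
      (chartSet I x (S ∩ (extChartAt I x').source)) (chartSet I x' S) := by
  have hopen : IsOpen (S ∩ (extChartAt I x').source) :=
    hg.isOpen.inter (isOpen_extChartAt_source x')
  have hmaps : Set.MapsTo (extChartAt I x' ∘ (extChartAt I x).symm)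
      (chartSet I x (S ∩ (extChartAt I x').source)) (chartSet I x' S) := fun y hy =>
    mem_chartSet hy.2.1 hy.2.2
  have hsmooth : ContDiffOn ℝ ∞ (extChartAt I x' ∘ (extChartAt I x).symm)
      (chartSet I x (S ∩ (extChartAt I x').source)) := by
    rw [← contMDiffOn_iff_contDiffOn]
    refine (contMDiffOn_extChartAt (n := ∞)).comp
      ((contMDiffOn_extChartAt_symm x).mono Set.inter_subset_left) fun y hy => ?_
    rw [Set.mem_preimage, ← extChartAt_source I]
    exact hy.2.2
  have hderiv : ∀ y ∈ chartSet I x (S ∩ (extChartAt I x').source), chartDeriv I x y =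
      chartDeriv I x' ((extChartAt I x' ∘ (extChartAt I x).symm) y) ∘L
        fderiv ℝ (extChartAt I x' ∘ (extChartAt I x).symm) y := by
    intro y hy
    have e : (extChartAt I x).symm =ᶠ[𝓝 y]
        (extChartAt I x').symm ∘ (extChartAt I x' ∘ (extChartAt I x).symm) := by
      filter_upwards [(isOpen_chartSet x hopen).mem_nhds hy] with z hz
      exact ((extChartAt I x').left_inv hz.2.2).symm
    have hd := (differentiableAt_of_contDiffOn (isOpen_chartSet x hopen) hsmooth hy).hasFDerivAt
    have h1 := HasMFDerivAt.comp y (mdifferentiableAt_symm (hmaps hy).1).hasMFDerivAt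
      hd.hasMFDerivAt
    exact (h1.congr_of_eventuallyEq e).mfderiv
  refine ⟨(hg.isMetricOn_chartMetric x).mono (isOpen_chartSet x hopen) fun y hy =>
    ⟨hy.1, hy.2.1⟩, hg.isMetricOn_chartMetric x', hsmooth, hmaps, fun y hy => ?_,
    fun y hy X Y => ?_⟩
  · have h1 := isInvertible_chartDeriv hy.1
    have h2 := isInvertible_chartDeriv (hmaps hy).1
    -- The chain rule is solved for the derivative of the transition map, which is thereby a
    -- composite of invertible maps.
    have h3 : fderiv ℝ (extChartAt I x' ∘ (extChartAt I x).symm) y =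
        (chartDeriv I x' ((extChartAt I x' ∘ (extChartAt I x).symm) y)).inverse ∘L
          chartDeriv I x y := by
      rw [hderiv y hy, ← ContinuousLinearMap.comp_assoc, h2.inverse_comp_self,
        ContinuousLinearMap.id_comp]
    rw [h3]
    exact h2.inverse.comp h1
  · rw [chartMetric_apply, chartMetric_apply, hderiv y hy]
    have h1 : (extChartAt I x').symm ((extChartAt I x' ∘ (extChartAt I x).symm) y) =
        (extChartAt I x).symm y := (extChartAt I x').left_inv hy.2.2
    rw [h1]
    rfl

variable {f h : M → ℝ} {x z : M}

theorem comp_symm_eventuallyEq (hg : IsSmoothMetricOn I g S) (f : M → ℝ) (hz : z ∈ S)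
    (hx : z ∈ (extChartAt I x).source) :
    (f ∘ (extChartAt I x).symm) ∘ (extChartAt I x ∘ (extChartAt I z).symm)
      =ᶠ[𝓝 (extChartAt I z z)] f ∘ (extChartAt I z).symm := by
  filter_upwards [(hg.isIsometryOn_chartChange z x).source.isOpen.mem_nhds
    (mem_chartSet ⟨hz, hx⟩ (mem_extChartAt_source z))] with y hy
  simp only [Function.comp_apply]
  rw [(extChartAt I x).left_inv hy.2.2]

/-- The left side uses the chart at `z`, which changes with `z`; the right side uses the fixed chart
at `x`, so it can be differentiated and integrated in `z`. -/
theorem laplacian_eq (hg : IsSmoothMetricOn I g S) (hf : ContMDiffOn I 𝓘(ℝ, ℝ) ∞ f S) (hz : z ∈ S)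
    (hx : z ∈ (extChartAt I x).source) : laplacian I g f z =
      coordLaplacian (chartMetric I g x) (f ∘ (extChartAt I x).symm) (extChartAt I x z) := by
  have h1 := (hg.isIsometryOn_chartChange z x).coordLaplacian (contDiffOn_comp_symm hf x)
    (mem_chartSet ⟨hz, hx⟩ (mem_extChartAt_source z))
  rw [coordLaplacian_congr _ (hg.comp_symm_eventuallyEq f hz hx), Function.comp_apply,
    extChartAt_to_inv] at h1
  exact h1

theorem gradInner_eq (hg : IsSmoothMetricOn I g S) (hf : ContMDiffOn I 𝓘(ℝ, ℝ) ∞ f S)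
    (hh : ContMDiffOn I 𝓘(ℝ, ℝ) ∞ h S) (hz : z ∈ S)
    (hx : z ∈ (extChartAt I x).source) : gradInner I g f h z =
      coordGradInner (chartMetric I g x) (f ∘ (extChartAt I x).symm)
        (h ∘ (extChartAt I x).symm) (extChartAt I x z) := by
  have h1 := (hg.isIsometryOn_chartChange z x).coordGradInner (contDiffOn_comp_symm hf x)
    (contDiffOn_comp_symm hh x) (mem_chartSet ⟨hz, hx⟩ (mem_extChartAt_source z))
  rw [coordGradInner_congr _ (hg.comp_symm_eventuallyEq f hz hx)
    (hg.comp_symm_eventuallyEq h hz hx), Function.comp_apply, extChartAt_to_inv] at h1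
  exact h1

theorem scalarCurvature_eq (hg : IsSmoothMetricOn I g S) (hz : z ∈ S)
    (hx : z ∈ (extChartAt I x).source) : scalarCurvature I g z =
      coordScalar (chartMetric I g x) (extChartAt I x z) := by
  have h1 := (hg.isIsometryOn_chartChange z x).coordScalar
    (mem_chartSet ⟨hz, hx⟩ (mem_extChartAt_source z))
  rw [Function.comp_apply, extChartAt_to_inv] at h1
  exact h1

theorem contMDiffOn_laplacian (hg : IsSmoothMetricOn I g S) (hf : ContMDiffOn I 𝓘(ℝ, ℝ) ∞ f S) :
    ContMDiffOn I 𝓘(ℝ, ℝ) ∞ (laplacian I g f) S :=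
  contMDiffOn_of_chart hg.isOpen
    (fun x => (hg.isMetricOn_chartMetric x).contDiffOn_coordLaplacian (contDiffOn_comp_symm hf x))
    fun _ _ hz hx => hg.laplacian_eq hf hz hx

theorem contMDiffOn_gradInner (hg : IsSmoothMetricOn I g S) (hf : ContMDiffOn I 𝓘(ℝ, ℝ) ∞ f S)
    (hh : ContMDiffOn I 𝓘(ℝ, ℝ) ∞ h S) : ContMDiffOn I 𝓘(ℝ, ℝ) ∞ (gradInner I g f h) S :=
  contMDiffOn_of_chart hg.isOpen
    (fun x => (hg.isMetricOn_chartMetric x).contDiffOn_coordGradInner (contDiffOn_comp_symm hf x)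
      (contDiffOn_comp_symm hh x))
    fun _ _ hz hx => hg.gradInner_eq hf hh hz hx

theorem contMDiffOn_scalarCurvature (hg : IsSmoothMetricOn I g S) :
    ContMDiffOn I 𝓘(ℝ, ℝ) ∞ (scalarCurvature I g) S :=
  contMDiffOn_of_chart hg.isOpen (fun x => (hg.isMetricOn_chartMetric x).contDiffOn_coordScalar)
    fun _ _ hz hx => hg.scalarCurvature_eq hz hx

theorem contMDiffOn_weightedLaplacian (hg : IsSmoothMetricOn I g S)
    (hh : ContMDiffOn I 𝓘(ℝ, ℝ) ∞ h S) (hf : ContMDiffOn I 𝓘(ℝ, ℝ) ∞ f S) :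
    ContMDiffOn I 𝓘(ℝ, ℝ) ∞ (weightedLaplacian I g h f) S :=
  (hg.contMDiffOn_laplacian hf).sub (hg.contMDiffOn_gradInner hh hf)

theorem contMDiffOn_weightedScalarCurvature (hg : IsSmoothMetricOn I g S)
    (hh : ContMDiffOn I 𝓘(ℝ, ℝ) ∞ h S) :
    ContMDiffOn I 𝓘(ℝ, ℝ) ∞ (weightedScalarCurvature I g h) S :=
  (hg.contMDiffOn_scalarCurvature.add (contMDiffOn_const.mul (hg.contMDiffOn_laplacian hh))).sub
    (hg.contMDiffOn_gradInner hh hh)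

end IsSmoothMetricOn

end Manifold

/-! ### The metric `2 du dv + γ_u` in coordinates: connection and Ricci tensor -/

section AmbientCoordinates

variable {E : Type*} [NormedAddCommGroup E] [NormedSpace ℝ E]

/-- The inclusion of the middle factor. -/
def midIncl (E : Type*) [NormedAddCommGroup E] [NormedSpace ℝ E] : E →L[ℝ] ℝ × E × ℝ :=
  ContinuousLinearMap.prod 0 (ContinuousLinearMap.prod (ContinuousLinearMap.id ℝ E) 0)

@[simp]
theorem midIncl_apply (X : E) : midIncl E X = (0, X, 0) := rfl

/-- A continuous bilinear form as a bilinear form. -/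
def toBilin (B : E →L[ℝ] E →L[ℝ] ℝ) : LinearMap.BilinForm ℝ E :=
  ContinuousLinearMap.coeLM ℝ ∘ₗ (B : E →ₗ[ℝ] E →L[ℝ] ℝ)

@[simp]
theorem toBilin_apply (B : E →L[ℝ] E →L[ℝ] ℝ) (X Y : E) : toBilin B X Y = B X Y := rfl

/-- `T` is split according to the three coordinate projections, and cyclicity of the trace moves
each piece to its own factor. -/
theorem trace_prod_prod [FiniteDimensional ℝ E] (T : ℝ × E × ℝ →ₗ[ℝ] ℝ × E × ℝ) :
    LinearMap.trace ℝ (ℝ × E × ℝ) T = (T (1, 0, 0)).1 + (T (0, 0, 1)).2.2 +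
      LinearMap.trace ℝ E
        (LinearMap.fst ℝ E ℝ ∘ₗ LinearMap.snd ℝ ℝ (E × ℝ) ∘ₗ T ∘ₗ (midIncl E : E →ₗ[ℝ] ℝ × E × ℝ)) := by
  have hT : T = (T ∘ₗ LinearMap.inl ℝ ℝ (E × ℝ)) ∘ₗ LinearMap.fst ℝ ℝ (E × ℝ)
      + (T ∘ₗ LinearMap.inr ℝ ℝ (E × ℝ) ∘ₗ LinearMap.inr ℝ E ℝ) ∘ₗ
        (LinearMap.snd ℝ E ℝ ∘ₗ LinearMap.snd ℝ ℝ (E × ℝ))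
      + (T ∘ₗ (midIncl E : E →ₗ[ℝ] ℝ × E × ℝ)) ∘ₗ
        (LinearMap.fst ℝ E ℝ ∘ₗ LinearMap.snd ℝ ℝ (E × ℝ)) := by
    refine LinearMap.ext fun X => ?_
    simp only [LinearMap.add_apply, LinearMap.comp_apply, ← map_add]
    congr 1
    ext <;> simp
  have hℝ : ∀ S : ℝ →ₗ[ℝ] ℝ, LinearMap.trace ℝ ℝ S = S 1 := fun S => by
    rw [trace_eq_sum (Module.Basis.singleton Unit ℝ)]; simp
  conv_lhs => rw [hT]
  rw [map_add, map_add, LinearMap.trace_comp_comm' _ (T ∘ₗ LinearMap.inl ℝ ℝ (E × ℝ)),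
    LinearMap.trace_comp_comm' _ (T ∘ₗ LinearMap.inr ℝ ℝ (E × ℝ) ∘ₗ LinearMap.inr ℝ E ℝ),
    LinearMap.trace_comp_comm' _ (T ∘ₗ (midIncl E : E →ₗ[ℝ] ℝ × E × ℝ)), hℝ, hℝ]
  rfl

/-- `G` is the metric `2 du dv + γ_u` on `ℝ × W`. -/
structure IsAmbientOn (G : ℝ × E × ℝ → (ℝ × E × ℝ) →L[ℝ] (ℝ × E × ℝ) →L[ℝ] ℝ)
    (γ : E × ℝ → E →L[ℝ] E →L[ℝ] ℝ) (W : Set (E × ℝ)) : Prop where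
  isOpen : IsOpen W
  isMetricOn : IsMetricOn G {q | q.2 ∈ W}
  apply_eq : ∀ q : ℝ × E × ℝ, q.2 ∈ W → ∀ X Y : ℝ × E × ℝ,
    G q X Y = X.1 * Y.2.2 + X.2.2 * Y.1 + γ q.2 X.2.1 Y.2.1

/-- The derivative along the middle factor. -/
theorem fderiv_midIncl {F : Type*} [NormedAddCommGroup F] [NormedSpace ℝ F] {f : ℝ × E × ℝ → F}
    {v u : ℝ} {y : E} (hf : DifferentiableAt ℝ f (v, y, u)) (X : E) :
    fderiv ℝ f (v, y, u) (midIncl E X) = fderiv ℝ (fun y => f (v, y, u)) y X := by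
  have h1 : HasFDerivAt (fun y : E => ((v, y, u) : ℝ × E × ℝ)) (ContinuousLinearMap.prod 0
      (ContinuousLinearMap.prod (ContinuousLinearMap.id ℝ E) 0)) y :=
    (hasFDerivAt_const v y).prodMk ((hasFDerivAt_id y).prodMk (hasFDerivAt_const u y))
  have h2 : HasFDerivAt (fun y => f (v, y, u)) (fderiv ℝ f (v, y, u) ∘L midIncl E) y :=
    HasFDerivAt.comp y (f := fun y : E => ((v, y, u) : ℝ × E × ℝ)) hf.hasFDerivAt h1
  rw [h2.fderiv]; rfl

/-- A function that is locally independent of the first variable has no derivative along it. -/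
theorem fderiv_fst_of_eventually {F : Type*} [NormedAddCommGroup F] [NormedSpace ℝ F]
    {f : ℝ × E × ℝ → F} {q : ℝ × E × ℝ} {k : E × ℝ → F} (hf : DifferentiableAt ℝ f q)
    (hk : ∀ᶠ v in 𝓝 q.1, f (v, q.2) = k q.2) : fderiv ℝ f q (1, 0, 0) = 0 := by
  have h1 : HasFDerivAt (fun v : ℝ => ((v, q.2) : ℝ × E × ℝ))
      (ContinuousLinearMap.inl ℝ ℝ (E × ℝ)) q.1 :=
    (hasFDerivAt_id q.1).prodMk (hasFDerivAt_const q.2 q.1)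
  have h2 : HasFDerivAt (fun v => f (v, q.2)) (fderiv ℝ f q ∘L ContinuousLinearMap.inl ℝ ℝ (E × ℝ))
      q.1 := HasFDerivAt.comp q.1 (f := fun v : ℝ => ((v, q.2) : ℝ × E × ℝ)) hf.hasFDerivAt h1
  have h3 : HasFDerivAt (fun v => f (v, q.2)) (0 : ℝ →L[ℝ] F) q.1 :=
    (hasFDerivAt_const (k q.2) q.1).congr_of_eventuallyEq hk
  have h4 := congrArg (fun T : ℝ →L[ℝ] F => T 1) (h2.unique h3)
  exact h4

variable [FiniteDimensional ℝ E]

namespace IsAmbientOn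

variable {G : ℝ × E × ℝ → (ℝ × E × ℝ) →L[ℝ] (ℝ × E × ℝ) →L[ℝ] ℝ}
  {γ : E × ℝ → E →L[ℝ] E →L[ℝ] ℝ} {W : Set (E × ℝ)} {v u : ℝ} {y : E}

theorem contDiffOn (h : IsAmbientOn G γ W) : ContDiffOn ℝ ∞ γ W := by
  refine contDiffOn_clm_apply.2 fun X => contDiffOn_clm_apply.2 fun Y => ?_
  have h1 : ContDiffOn ℝ ∞ (fun w : E × ℝ => G (0, w)) W :=
    h.isMetricOn.contDiffOn.comp (by fun_prop) fun w hw => hw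
  refine (contDiffOn_clm_apply.1 (contDiffOn_clm_apply.1 h1 (midIncl E X)) (midIncl E Y)).congr
    fun w hw => ?_
  rw [h.apply_eq _ hw]; simp

/-- A tangential vector is orthogonal to `∂_u` and `∂_v`, so a degenerate direction of `γ_u` would
be one of `G`. -/
theorem isMetricOn_slice (h : IsAmbientOn G γ W) (u : ℝ) :
    IsMetricOn (fun y => γ (y, u)) {y | (y, u) ∈ W} where
  isOpen := h.isOpen.preimage (by fun_prop)
  contDiffOn := h.contDiffOn.comp (by fun_prop) fun _ hy => hy
  symm y hy X Y := by
    have hq : ((0, y, u) : ℝ × E × ℝ).2 ∈ W := hy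
    have h1 := h.isMetricOn.symm (0, y, u) hy (midIncl E X) (midIncl E Y)
    rw [h.apply_eq _ hq, h.apply_eq _ hq] at h1
    simpa using h1
  isInvertible y hy := by
    refine isInvertible_of_nondegenerate fun X hX => ?_
    have hq : ((0, y, u) : ℝ × E × ℝ).2 ∈ W := hy
    have h1 : G (0, y, u) (midIncl E X) = 0 := by
      ext Y
      · rw [ContinuousLinearMap.comp_apply, h.apply_eq _ hq]; simp
      · rw [ContinuousLinearMap.comp_apply, ContinuousLinearMap.comp_apply, h.apply_eq _ hq]
        simpa using hX Y
      · rw [ContinuousLinearMap.comp_apply, ContinuousLinearMap.comp_apply, h.apply_eq _ hq]; simp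
    have h2 := (h.isMetricOn.isInvertible (0, y, u) hy).injective (h1.trans (map_zero _).symm)
    simpa using h2

/-- The part `2 du dv` has constant coefficients, so only `γ` contributes, and it does not depend on
`v`. -/
theorem fderiv_apply (h : IsAmbientOn G γ W) {q : ℝ × E × ℝ} (hq : q.2 ∈ W) (D X Y : ℝ × E × ℝ) :
    fderiv ℝ G q D X Y = fderiv ℝ γ q.2 D.2 X.2.1 Y.2.1 := by
  have hG := differentiableAt_of_contDiffOn h.isMetricOn.isOpen h.isMetricOn.contDiffOn hq
  have hγ := differentiableAt_of_contDiffOn h.isOpen h.contDiffOn hq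
  rw [← fderiv_apply_apply hG]
  have h1 : (fun q => G q X Y) =ᶠ[𝓝 q]
      fun q => X.1 * Y.2.2 + X.2.2 * Y.1 + γ q.2 X.2.1 Y.2.1 := by
    filter_upwards [h.isMetricOn.isOpen.mem_nhds hq] with z hz using h.apply_eq z hz X Y
  have h2 : DifferentiableAt ℝ (fun w => γ w X.2.1 Y.2.1) q.2 :=
    differentiableAt_of_contDiffOn h.isOpen
      (contDiffOn_clm_apply.1 (contDiffOn_clm_apply.1 h.contDiffOn _) _) hq
  have h3 : HasFDerivAt (fun q : ℝ × E × ℝ => γ q.2 X.2.1 Y.2.1)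
      (fderiv ℝ (fun w => γ w X.2.1 Y.2.1) q.2 ∘L ContinuousLinearMap.snd ℝ ℝ (E × ℝ)) q :=
    h2.hasFDerivAt.comp q hasFDerivAt_snd
  rw [h1.fderiv_eq, (h3.const_add _).fderiv, ← fderiv_apply_apply hγ]
  rfl

theorem fderiv_slice (h : IsAmbientOn G γ W) (hy : (y, u) ∈ W) (D X Y : E) :
    fderiv ℝ (fun y => γ (y, u)) y D X Y = fderiv ℝ γ (y, u) (D, 0) X Y := by
  have hγ := differentiableAt_of_contDiffOn h.isOpen h.contDiffOn hy
  have h1 : HasFDerivAt (fun y : E => ((y, u) : E × ℝ)) (ContinuousLinearMap.inl ℝ E ℝ) y :=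
    (hasFDerivAt_id y).prodMk (hasFDerivAt_const u y)
  have h2 : HasFDerivAt (fun y => γ (y, u))
      (fderiv ℝ γ (y, u) ∘L ContinuousLinearMap.inl ℝ E ℝ) y :=
    HasFDerivAt.comp y (f := fun y : E => ((y, u) : E × ℝ)) hγ.hasFDerivAt h1
  rw [h2.fderiv]; rfl

theorem christoffelLower_apply (h : IsAmbientOn G γ W) {q : ℝ × E × ℝ} (hq : q.2 ∈ W)
    (X Y Z : ℝ × E × ℝ) : christoffelLower G q X Y Z =
      2⁻¹ * (fderiv ℝ γ q.2 X.2 Y.2.1 Z.2.1 + fderiv ℝ γ q.2 Y.2 X.2.1 Z.2.1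
        - fderiv ℝ γ q.2 Z.2 X.2.1 Y.2.1) := by
  rw [WeightedGJMS.christoffelLower_apply, h.fderiv_apply hq, h.fderiv_apply hq,
    h.fderiv_apply hq]

/-- `∂_u` and `∂_v` are null and dual to each other, so raising an index swaps these two components.
-/
theorem inverse_apply (h : IsAmbientOn G γ W) {q : ℝ × E × ℝ} (hq : q.2 ∈ W)
    (α : (ℝ × E × ℝ) →L[ℝ] ℝ) :
    (G q).inverse α = (α (0, 0, 1), (γ q.2).inverse (α ∘L midIncl E), α (1, 0, 0)) := by
  rw [(h.isMetricOn.isInvertible q hq).inverse_apply_eq]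
  have hs := (h.isMetricOn_slice q.2.2).apply_inverse (y := q.2.1) hq (α ∘L midIncl E)
  ext X
  · simp [h.apply_eq q hq]
    rfl
  · simp only [ContinuousLinearMap.comp_apply, h.apply_eq q hq]
    simpa using (hs X).symm
  · simp [h.apply_eq q hq]

/-- The `u`-component of a vector is its pairing with `∂_v`. The lower symbol with last entry `∂_v`
vanishes because `γ` neither depends on `v` nor sees `∂_v`. -/
theorem christoffel_snd_snd (h : IsAmbientOn G γ W) {q : ℝ × E × ℝ} (hq : q.2 ∈ W)
    (X Y : ℝ × E × ℝ) : (christoffel G q X Y).2.2 = 0 := by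
  have h0 : ((0 : E), (0 : ℝ)) = 0 := rfl
  rw [christoffel_apply, h.inverse_apply hq]
  refine (h.christoffelLower_apply hq X Y (1, 0, 0)).trans ?_
  simp [h0]

/-- `∂_v` is parallel. -/
theorem christoffel_fst (h : IsAmbientOn G γ W) {q : ℝ × E × ℝ} (hq : q.2 ∈ W)
    (Y : ℝ × E × ℝ) : christoffel G q (1, 0, 0) Y = 0 := by
  have h0 : ((0 : E), (0 : ℝ)) = 0 := rfl
  have h1 : christoffelLower G q (1, 0, 0) Y = 0 := by
    refine ContinuousLinearMap.ext fun Z => ?_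
    rw [h.christoffelLower_apply hq]
    simp [h0]
  rw [christoffel_apply, h1, map_zero]

/-- The `v`-component is the pairing with `∂_u`, in which only the derivative of `γ` along `u`
survives. -/
theorem christoffel_mid (h : IsAmbientOn G γ W) (hy : (y, u) ∈ W) (a b : ℝ) (X Y : E) :
    christoffel G (v, y, u) (a, X, 0) (b, Y, 0) =
      (-(2⁻¹ * fderiv ℝ γ (y, u) (0, 1) X Y), christoffel (fun y => γ (y, u)) y X Y, 0) := by
  have hq : ((v, y, u) : ℝ × E × ℝ).2 ∈ W := hy
  have h1 := h.christoffel_snd_snd hq (a, X, 0) (b, Y, 0)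
  rw [christoffel_apply, h.inverse_apply hq] at h1 ⊢
  simp only at h1
  rw [h1, h.christoffelLower_apply hq, christoffel_apply]
  have h2 : christoffelLower G (v, y, u) (a, X, 0) (b, Y, 0) ∘L midIncl E =
      christoffelLower (fun y => γ (y, u)) y X Y := by
    ext Z
    rw [ContinuousLinearMap.comp_apply, h.christoffelLower_apply hq,
      WeightedGJMS.christoffelLower_apply, h.fderiv_slice hy, h.fderiv_slice hy,
      h.fderiv_slice hy]
    rfl
  rw [h2]
  simp

theorem metricTrace_eq (h : IsAmbientOn G γ W) {q : ℝ × E × ℝ} (hq : q.2 ∈ W)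
    {T : LinearMap.BilinForm ℝ (ℝ × E × ℝ)} {T' : LinearMap.BilinForm ℝ E}
    (hT : ∀ X Y, T (midIncl E X) (midIncl E Y) = T' X Y) :
    metricTrace (G q) T = T (1, 0, 0) (0, 0, 1) + T (0, 0, 1) (1, 0, 0)
      + metricTrace (γ q.2) T' := by
  rw [metricTrace, trace_prod_prod, metricTrace]
  simp only [LinearMap.comp_apply, ContinuousLinearMap.coe_coe, LinearEquiv.coe_coe,
    h.inverse_apply hq]
  congr 2
  ext X
  simp only [LinearMap.comp_apply, ContinuousLinearMap.coe_coe, LinearEquiv.coe_coe,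
    h.inverse_apply hq, LinearMap.snd_apply, LinearMap.fst_apply]
  congr 1
  ext Y
  simpa using hT X Y

theorem fderiv_christoffel_apply (h : IsAmbientOn G γ W) {q : ℝ × E × ℝ} (hq : q.2 ∈ W)
    (D X Y : ℝ × E × ℝ) : fderiv ℝ (christoffel G) q D X Y =
      fderiv ℝ (fun q => christoffel G q X Y) q D :=
  (fderiv_apply_apply (differentiableAt_of_contDiffOn h.isMetricOn.isOpen
    h.isMetricOn.contDiffOn_christoffel hq) D X Y).symm

theorem differentiableAt_christoffel (h : IsAmbientOn G γ W) {q : ℝ × E × ℝ} (hq : q.2 ∈ W)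
    (X Y : ℝ × E × ℝ) : DifferentiableAt ℝ (fun q => christoffel G q X Y) q :=
  differentiableAt_of_contDiffOn h.isMetricOn.isOpen (contDiffOn_clm_apply.1
    (contDiffOn_clm_apply.1 h.isMetricOn.contDiffOn_christoffel X) Y) hq

theorem fderiv_christoffel_snd_snd (h : IsAmbientOn G γ W) {q : ℝ × E × ℝ} (hq : q.2 ∈ W)
    (D X Y : ℝ × E × ℝ) : (fderiv ℝ (christoffel G) q D X Y).2.2 = 0 := by
  rw [h.fderiv_christoffel_apply hq]
  have h1 : HasFDerivAt (fun q => (christoffel G q X Y).2.2)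
      ((ContinuousLinearMap.snd ℝ E ℝ ∘L ContinuousLinearMap.snd ℝ ℝ (E × ℝ)) ∘L
        fderiv ℝ (fun q => christoffel G q X Y) q) q :=
    (ContinuousLinearMap.hasFDerivAt
      (ContinuousLinearMap.snd ℝ E ℝ ∘L ContinuousLinearMap.snd ℝ ℝ (E × ℝ))).comp q
      (h.differentiableAt_christoffel hq X Y).hasFDerivAt
  have h2 : (fun q => (christoffel G q X Y).2.2) =ᶠ[𝓝 q] fun _ => 0 := by
    filter_upwards [h.isMetricOn.isOpen.mem_nhds hq] with z hz using
      h.christoffel_snd_snd hz X Y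
  exact congrArg (fun T : (ℝ × E × ℝ) →L[ℝ] ℝ => T D)
    (h1.unique ((hasFDerivAt_const (0 : ℝ) q).congr_of_eventuallyEq h2))

/-- Of the three parts of the trace, the one along `∂_v` vanishes since `∂_v` is parallel and
nothing depends on `v`; the one along `∂_u` vanishes since the symbols have no `u`-component. The
tangential part is that of the slice, so `γ'` does not enter. -/
theorem ricciForm_mid (h : IsAmbientOn G γ W) (hy : (y, u) ∈ W) (Y Z : E) :
    ricciForm G (v, y, u) (midIncl E Y) (midIncl E Z) =
      ricciForm (fun y => γ (y, u)) y Y Z := by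
  have hq : ((v, y, u) : ℝ × E × ℝ).2 ∈ W := hy
  have hs := h.isMetricOn_slice u
  have hmid : ∀ (X Y : E), christoffel G (v, y, u) (midIncl E X) (midIncl E Y) =
      (-(2⁻¹ * fderiv ℝ γ (y, u) (0, 1) X Y), christoffel (fun y => γ (y, u)) y X Y, 0) :=
    fun X Y => h.christoffel_mid hy 0 0 X Y
  -- A tangential symbol acquires a `v`-component; when it is inserted into another symbol, that
  -- component has no effect.
  have hmid' : ∀ (a : ℝ) (X Y : E), christoffel G (v, y, u) (midIncl E X) (a, Y, 0) =
      (-(2⁻¹ * fderiv ℝ γ (y, u) (0, 1) X Y), christoffel (fun y => γ (y, u)) y X Y, 0) :=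
    fun a X Y => h.christoffel_mid hy 0 a X Y
  have hderiv : ∀ X Y Z : E, (fderiv ℝ (christoffel G) (v, y, u) (midIncl E X) (midIncl E Y)
      (midIncl E Z)).2.1 = fderiv ℝ (christoffel fun y => γ (y, u)) y X Y Z := by
    intro X Y Z
    have h1 : HasFDerivAt (fun q => (christoffel G q (midIncl E Y) (midIncl E Z)).2.1)
        ((ContinuousLinearMap.fst ℝ E ℝ ∘L ContinuousLinearMap.snd ℝ ℝ (E × ℝ)) ∘L
          fderiv ℝ (fun q => christoffel G q (midIncl E Y) (midIncl E Z)) (v, y, u)) (v, y, u) :=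
      (ContinuousLinearMap.hasFDerivAt
        (ContinuousLinearMap.fst ℝ E ℝ ∘L ContinuousLinearMap.snd ℝ ℝ (E × ℝ))).comp (v, y, u)
        (h.differentiableAt_christoffel hq _ _).hasFDerivAt
    have h2 := fderiv_midIncl h1.differentiableAt X
    rw [h1.fderiv] at h2
    rw [h.fderiv_christoffel_apply hq]
    refine h2.trans ?_
    rw [← fderiv_apply_apply (differentiableAt_of_contDiffOn hs.isOpen
      hs.contDiffOn_christoffel hy)]
    congr 1
    apply Filter.EventuallyEq.fderiv_eq
    filter_upwards [hs.isOpen.mem_nhds hy] with z hz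
    exact congrArg (fun p : ℝ × E × ℝ => p.2.1) (h.christoffel_mid (v := v) hz 0 0 Y Z)
  rw [ricciForm_apply, trace_prod_prod, ricciForm_apply]
  -- The contribution of `∂_v` to the trace.
  have e1 : (curvatureEnd G (v, y, u) (midIncl E Y) (midIncl E Z) (1, 0, 0)).1 = 0 := by
    have t1 : fderiv ℝ (christoffel G) (v, y, u) (1, 0, 0) (midIncl E Y) (midIncl E Z) = 0 := by
      rw [h.fderiv_christoffel_apply hq]
      refine fderiv_fst_of_eventually (k := fun w =>
        (-(2⁻¹ * fderiv ℝ γ w (0, 1) Y Z), christoffel (fun y => γ (y, w.2)) w.1 Y Z, 0))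
        (h.differentiableAt_christoffel hq _ _) (Filter.Eventually.of_forall fun v' => ?_)
      exact h.christoffel_mid hy 0 0 Y Z
    have t2 : fderiv ℝ (christoffel G) (v, y, u) (midIncl E Y) (1, 0, 0) (midIncl E Z) = 0 := by
      rw [h.fderiv_christoffel_apply hq]
      have : (fun q => christoffel G q (1, 0, 0) (midIncl E Z)) =ᶠ[𝓝 (v, y, u)] fun _ => 0 := by
        filter_upwards [h.isMetricOn.isOpen.mem_nhds hq] with z hz using h.christoffel_fst hz _
      rw [this.fderiv_eq]; simp
    rw [curvatureEnd_apply, t1, t2, h.christoffel_fst hq, h.christoffel_fst hq]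
    simp
  -- The contribution of `∂_u` to the trace.
  have e2 : (curvatureEnd G (v, y, u) (midIncl E Y) (midIncl E Z) (0, 0, 1)).2.2 = 0 := by
    rw [curvatureEnd_apply]
    simp only [Prod.snd_add, Prod.snd_sub, h.fderiv_christoffel_snd_snd hq,
      h.christoffel_snd_snd hq]
    simp
  rw [ContinuousLinearMap.coe_coe, e1, e2, zero_add, zero_add]
  congr 1
  ext X
  simp only [LinearMap.comp_apply, ContinuousLinearMap.coe_coe, LinearMap.snd_apply,
    LinearMap.fst_apply, curvatureEnd_apply, hmid, hmid', Prod.snd_add, Prod.snd_sub, Prod.fst_add,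
    Prod.fst_sub, hderiv]

end IsAmbientOn

end AmbientCoordinates

/-! ### The ambient Laplacian on densities of weight `-1/2` -/

namespace IsAmbientOn

variable {E : Type*} [NormedAddCommGroup E] [NormedSpace ℝ E]
  {G : ℝ × E × ℝ → (ℝ × E × ℝ) →L[ℝ] (ℝ × E × ℝ) →L[ℝ] ℝ}
  {γ : E × ℝ → E →L[ℝ] E →L[ℝ] ℝ} {W : Set (E × ℝ)} {v u : ℝ} {y : E}
  {F K : ℝ × E × ℝ → ℝ} {f φ : E × ℝ → ℝ}

theorem hasFDerivAt_potential (h : IsAmbientOn G γ W) (hφ : ContDiffOn ℝ ∞ φ W)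
    {q : ℝ × E × ℝ} (hq : q.2 ∈ W) : HasFDerivAt (fun q : ℝ × E × ℝ => φ q.2 - q.1)
      (fderiv ℝ φ q.2 ∘L ContinuousLinearMap.snd ℝ ℝ (E × ℝ)
        - ContinuousLinearMap.fst ℝ ℝ (E × ℝ)) q :=
  ((differentiableAt_of_contDiffOn h.isOpen hφ hq).hasFDerivAt.comp q hasFDerivAt_snd).sub
    hasFDerivAt_fst

theorem contDiffOn_potential (hφ : ContDiffOn ℝ ∞ φ W) :
    ContDiffOn ℝ ∞ (fun q : ℝ × E × ℝ => φ q.2 - q.1) {q | q.2 ∈ W} :=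
  (hφ.comp contDiff_snd.contDiffOn fun _ hq => hq).sub contDiff_fst.contDiffOn

theorem contDiffOn_density (hf : ContDiffOn ℝ ∞ f W) :
    ContDiffOn ℝ ∞ (fun q : ℝ × E × ℝ => Real.exp (-q.1 / 2) * f q.2) {q | q.2 ∈ W} := by
  have h1 : ContDiff ℝ ∞ fun q : ℝ × E × ℝ => Real.exp (-q.1 / 2) := by fun_prop
  exact h1.contDiffOn.mul (hf.comp contDiff_snd.contDiffOn fun _ hq => hq)

theorem hasFDerivAt_density (h : IsAmbientOn G γ W) (hf : ContDiffOn ℝ ∞ f W)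
    {q : ℝ × E × ℝ} (hq : q.2 ∈ W) :
    HasFDerivAt (fun q : ℝ × E × ℝ => Real.exp (-q.1 / 2) * f q.2)
      (Real.exp (-q.1 / 2) • (fderiv ℝ f q.2 ∘L ContinuousLinearMap.snd ℝ ℝ (E × ℝ)
        - (2⁻¹ * f q.2) • ContinuousLinearMap.fst ℝ ℝ (E × ℝ))) q := by
  have h1 := (differentiableAt_of_contDiffOn h.isOpen hf hq).hasFDerivAt.comp q hasFDerivAt_snd
  have h2 : HasFDerivAt (fun q : ℝ × E × ℝ => -q.1 / 2)
      (-((2 : ℝ)⁻¹ • ContinuousLinearMap.fst ℝ ℝ (E × ℝ))) q := by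
    have h3 := (hasFDerivAt_fst (𝕜 := ℝ) (p := q)).const_mul (2⁻¹ : ℝ) |>.neg
    refine h3.congr_of_eventuallyEq (Filter.Eventually.of_forall fun z => ?_)
    simp; ring
  refine (h2.exp.mul h1).congr_fderiv ?_
  ext <;> simp; ring

variable [FiniteDimensional ℝ E]

/-- The correction to the slice Hessian is the `v`-component `-½γ'` of the ambient symbol, paired
with `∂_v F`. -/
theorem hessianForm_mid (h : IsAmbientOn G γ W) (hF : ContDiffOn ℝ ∞ F {q | q.2 ∈ W})
    (hy : (y, u) ∈ W) (X Y : E) :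
    hessianForm G F (v, y, u) (midIncl E X) (midIncl E Y) =
      hessianForm (fun y => γ (y, u)) (fun y => F (v, y, u)) y X Y
        + 2⁻¹ * fderiv ℝ γ (y, u) (0, 1) X Y * fderiv ℝ F (v, y, u) (1, 0, 0) := by
  have hq : ((v, y, u) : ℝ × E × ℝ).2 ∈ W := hy
  have hU := h.isMetricOn.isOpen
  have hd : ∀ z, (z, u) ∈ W → DifferentiableAt ℝ F (v, z, u) := fun z hz =>
    differentiableAt_of_contDiffOn hU hF hz
  have hd' := differentiableAt_of_contDiffOn hU (contDiffOn_fderiv hU hF) hq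
  have hslice : ContDiffOn ℝ ∞ (fun y => F (v, y, u)) {y | (y, u) ∈ W} :=
    hF.comp (by fun_prop) fun _ hz => hz
  have hs := h.isMetricOn_slice u
  have h2 : fderiv ℝ (fderiv ℝ F) (v, y, u) (midIncl E X) (midIncl E Y) =
      fderiv ℝ (fderiv ℝ fun y => F (v, y, u)) y X Y := by
    have e1 := hasFDerivAt_clm_apply_const hd' (midIncl E Y)
    have e2 := fderiv_midIncl e1.differentiableAt X
    rw [e1.fderiv] at e2
    refine e2.trans ?_
    have e3 := hasFDerivAt_clm_apply_const (differentiableAt_of_contDiffOn hs.isOpen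
      (contDiffOn_fderiv hs.isOpen hslice) hy) Y
    have e4 : (fun z => fderiv ℝ F (v, z, u) (midIncl E Y)) =ᶠ[𝓝 y]
        fun z => fderiv ℝ (fun y => F (v, y, u)) z Y := by
      filter_upwards [hs.isOpen.mem_nhds hy] with z hz using fderiv_midIncl (hd z hz) Y
    rw [e4.fderiv_eq, e3.fderiv]
    rfl
  have h3 : christoffel G (v, y, u) (midIncl E X) (midIncl E Y) =
      (-(2⁻¹ * fderiv ℝ γ (y, u) (0, 1) X Y)) • ((1, 0, 0) : ℝ × E × ℝ)
        + midIncl E (christoffel (fun y => γ (y, u)) y X Y) := by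
    refine (h.christoffel_mid hy 0 0 X Y).trans ?_
    simp
  rw [hessianForm_apply, hessianForm_apply, h2, h3, map_add, map_smul,
    fderiv_midIncl (hd y hy)]
  simp
  ring

/-- The mixed Hessian in `u` and `v` has no correction because `∂_v` is parallel, and it is counted
twice in the trace. -/
theorem coordLaplacian_eq (h : IsAmbientOn G γ W) (hF : ContDiffOn ℝ ∞ F {q | q.2 ∈ W})
    (hy : (y, u) ∈ W) :
    coordLaplacian G F (v, y, u) =
      2 * fderiv ℝ (fderiv ℝ F) (v, y, u) (0, 0, 1) (1, 0, 0)
      + coordLaplacian (fun y => γ (y, u)) (fun y => F (v, y, u)) y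
      + 2⁻¹ * fderiv ℝ F (v, y, u) (1, 0, 0) *
        metricTrace (γ (y, u)) (toBilin (fderiv ℝ γ (y, u) (0, 1))) := by
  have hq : ((v, y, u) : ℝ × E × ℝ).2 ∈ W := hy
  have h1 : ∀ X Y, hessianForm G F (v, y, u) (midIncl E X) (midIncl E Y) =
      (hessianForm (fun y => γ (y, u)) (fun y => F (v, y, u)) y
        + (2⁻¹ * fderiv ℝ F (v, y, u) (1, 0, 0)) • toBilin (fderiv ℝ γ (y, u) (0, 1))) X Y := by
    intro X Y
    rw [h.hessianForm_mid hF hy]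
    simp; ring
  have h2 := fderiv_fderiv_symm h.isMetricOn.isOpen hF hq (1, 0, 0) (0, 0, 1)
  rw [coordLaplacian, h.metricTrace_eq hq h1, metricTrace_add, metricTrace_smul,
    hessianForm_apply, hessianForm_apply, h.isMetricOn.christoffel_symm hq (0, 0, 1),
    h.christoffel_fst hq, h2, coordLaplacian]
  simp
  ring

theorem coordGradInner_eq (h : IsAmbientOn G γ W) (hF : ContDiffOn ℝ ∞ F {q | q.2 ∈ W})
    (hK : ContDiffOn ℝ ∞ K {q | q.2 ∈ W}) (hy : (y, u) ∈ W) :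
    coordGradInner G F K (v, y, u) =
      coordGradInner (fun y => γ (y, u)) (fun y => F (v, y, u)) (fun y => K (v, y, u)) y
      + fderiv ℝ F (v, y, u) (1, 0, 0) * fderiv ℝ K (v, y, u) (0, 0, 1)
      + fderiv ℝ F (v, y, u) (0, 0, 1) * fderiv ℝ K (v, y, u) (1, 0, 0) := by
  have hq : ((v, y, u) : ℝ × E × ℝ).2 ∈ W := hy
  have hd : ∀ {F : ℝ × E × ℝ → ℝ}, ContDiffOn ℝ ∞ F {q | q.2 ∈ W} →
      DifferentiableAt ℝ F (v, y, u) := fun hF =>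
    differentiableAt_of_contDiffOn h.isMetricOn.isOpen hF hq
  have h1 : fderiv ℝ K (v, y, u) ∘L midIncl E = fderiv ℝ (fun y => K (v, y, u)) y := by
    ext X; exact fderiv_midIncl (hd hK) X
  have h2 : (G (v, y, u)).inverse (fderiv ℝ K (v, y, u)) =
      fderiv ℝ K (v, y, u) (0, 0, 1) • (1, 0, 0)
        + midIncl E ((γ (y, u)).inverse (fderiv ℝ K (v, y, u) ∘L midIncl E))
        + fderiv ℝ K (v, y, u) (1, 0, 0) • (0, 0, 1) := by
    rw [h.inverse_apply hq]; simp
  rw [coordGradInner, h2, map_add, map_add, map_smul, map_smul,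
    fderiv_midIncl (hd hF), h1, coordGradInner]
  simp only [smul_eq_mul]
  ring

/-- The general formula with `∂_v` replaced by `-1/2`; the mixed derivative `2∂_u∂_v` becomes
`-∂_u`. -/
theorem coordLaplacian_density (h : IsAmbientOn G γ W) (hf : ContDiffOn ℝ ∞ f W)
    (hy : (y, u) ∈ W) :
    coordLaplacian G (fun q => Real.exp (-q.1 / 2) * f q.2) (v, y, u) = Real.exp (-v / 2) *
      (coordLaplacian (fun y => γ (y, u)) (fun y => f (y, u)) y - fderiv ℝ f (y, u) (0, 1)
        - 4⁻¹ * f (y, u) * metricTrace (γ (y, u)) (toBilin (fderiv ℝ γ (y, u) (0, 1)))) := by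
  have hq : ((v, y, u) : ℝ × E × ℝ).2 ∈ W := hy
  have hF := contDiffOn_density hf
  have hU := h.isMetricOn.isOpen
  have hd' := differentiableAt_of_contDiffOn hU (contDiffOn_fderiv hU hF) hq
  have hfst : ∀ q : ℝ × E × ℝ, q.2 ∈ W →
      fderiv ℝ (fun q : ℝ × E × ℝ => Real.exp (-q.1 / 2) * f q.2) q (1, 0, 0) =
        -2⁻¹ * (Real.exp (-q.1 / 2) * f q.2) := by
    intro q hq
    have h0 : ((0 : E), (0 : ℝ)) = 0 := rfl
    rw [(h.hasFDerivAt_density hf hq).fderiv]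
    simp [h0]; ring
  have hsnd : fderiv ℝ (fderiv ℝ fun q : ℝ × E × ℝ => Real.exp (-q.1 / 2) * f q.2) (v, y, u)
      (0, 0, 1) (1, 0, 0) = -2⁻¹ * (Real.exp (-v / 2) * fderiv ℝ f (y, u) (0, 1)) := by
    have e1 := (hasFDerivAt_clm_apply_const hd' (1, 0, 0)).fderiv
    have e2 : (fun q => fderiv ℝ (fun q : ℝ × E × ℝ => Real.exp (-q.1 / 2) * f q.2) q (1, 0, 0))
        =ᶠ[𝓝 (v, y, u)] fun q => -2⁻¹ * (Real.exp (-q.1 / 2) * f q.2) := by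
      filter_upwards [hU.mem_nhds hq] with z hz using hfst z hz
    rw [e2.fderiv_eq, ((h.hasFDerivAt_density hf hq).const_mul _).fderiv] at e1
    have e3 := congrArg (fun T : (ℝ × E × ℝ) →L[ℝ] ℝ => T (0, 0, 1)) e1
    simp only [ContinuousLinearMap.flip_apply] at e3
    rw [← e3]
    simp
  have hs := h.isMetricOn_slice u
  have hfu : ContDiffOn ℝ ∞ (fun y => f (y, u)) {y | (y, u) ∈ W} :=
    hf.comp (by fun_prop) fun _ hz => hz
  have hmul := hs.coordLaplacian_const_mul hfu (Real.exp (-v / 2)) hy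
  rw [h.coordLaplacian_eq hF hy, hfst _ hq, hsnd]
  simp only [hmul]
  ring

/-- The potential has `v`-derivative `-1`, which again yields `-∂_u f`; this is the term that
cancels the one in the Laplacian. -/
theorem coordGradInner_density (h : IsAmbientOn G γ W) (hφ : ContDiffOn ℝ ∞ φ W)
    (hf : ContDiffOn ℝ ∞ f W) (hy : (y, u) ∈ W) :
    coordGradInner G (fun q => φ q.2 - q.1) (fun q => Real.exp (-q.1 / 2) * f q.2) (v, y, u) =
      Real.exp (-v / 2) * (coordGradInner (fun y => γ (y, u)) (fun y => φ (y, u))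
        (fun y => f (y, u)) y - fderiv ℝ f (y, u) (0, 1)
        - 2⁻¹ * f (y, u) * fderiv ℝ φ (y, u) (0, 1)) := by
  have hq : ((v, y, u) : ℝ × E × ℝ).2 ∈ W := hy
  have h0 : ((0 : E), (0 : ℝ)) = 0 := rfl
  have hs := h.isMetricOn_slice u
  rw [h.coordGradInner_eq (contDiffOn_potential hφ) (contDiffOn_density hf) hy,
    (h.hasFDerivAt_potential hφ hq).fderiv, (h.hasFDerivAt_density hf hq).fderiv]
  have hfu : ContDiffOn ℝ ∞ (fun y => f (y, u)) {y | (y, u) ∈ W} :=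
    hf.comp (by fun_prop) fun _ hz => hz
  have h3 : coordGradInner (fun y => γ (y, u)) (fun y => φ (y, u) - v)
      (fun y => Real.exp (-v / 2) * f (y, u)) y = Real.exp (-v / 2) *
      coordGradInner (fun y => γ (y, u)) (fun y => φ (y, u)) (fun y => f (y, u)) y := by
    rw [hs.coordGradInner_const_mul_right hfu _ hy, coordGradInner, fderiv_sub_const]; rfl
  simp only [h3]
  simp [h0]; ring

/-- The `v`-derivative of the potential is constant, so the mixed derivative drops out and only the
trace of `γ'` is added. -/
theorem coordLaplacian_potential (h : IsAmbientOn G γ W) (hφ : ContDiffOn ℝ ∞ φ W)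
    (hy : (y, u) ∈ W) :
    coordLaplacian G (fun q => φ q.2 - q.1) (v, y, u) =
      coordLaplacian (fun y => γ (y, u)) (fun y => φ (y, u)) y
        - 2⁻¹ * metricTrace (γ (y, u)) (toBilin (fderiv ℝ γ (y, u) (0, 1))) := by
  have hq : ((v, y, u) : ℝ × E × ℝ).2 ∈ W := hy
  have h0 : ((0 : E), (0 : ℝ)) = 0 := rfl
  have hF := contDiffOn_potential hφ
  have hU := h.isMetricOn.isOpen
  have hd' := differentiableAt_of_contDiffOn hU (contDiffOn_fderiv hU hF) hq
  have hfst : ∀ q : ℝ × E × ℝ, q.2 ∈ W →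
      fderiv ℝ (fun q : ℝ × E × ℝ => φ q.2 - q.1) q (1, 0, 0) = -1 := by
    intro q hq
    rw [(h.hasFDerivAt_potential hφ hq).fderiv]
    simp [h0]
  have hsnd : fderiv ℝ (fderiv ℝ fun q : ℝ × E × ℝ => φ q.2 - q.1) (v, y, u)
      (0, 0, 1) (1, 0, 0) = 0 := by
    have e1 := (hasFDerivAt_clm_apply_const hd' (1, 0, 0)).fderiv
    have e2 : (fun q => fderiv ℝ (fun q : ℝ × E × ℝ => φ q.2 - q.1) q (1, 0, 0))
        =ᶠ[𝓝 (v, y, u)] fun q => -1 := by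
      filter_upwards [hU.mem_nhds hq] with z hz using hfst z hz
    rw [e2.fderiv_eq] at e1
    have e3 := congrArg (fun T : (ℝ × E × ℝ) →L[ℝ] ℝ => T (0, 0, 1)) e1
    simp only [ContinuousLinearMap.flip_apply] at e3
    rw [← e3]
    simp
  have h3 : coordLaplacian (fun y => γ (y, u)) (fun y => φ (y, u) - v) y =
      coordLaplacian (fun y => γ (y, u)) (fun y => φ (y, u)) y := by
    have h4 : fderiv ℝ (fun y => φ (y, u) - v) = fderiv ℝ fun y => φ (y, u) := by
      ext z : 1; rw [fderiv_sub_const]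
    have h5 : hessianForm (fun y => γ (y, u)) (fun y => φ (y, u) - v) y =
        hessianForm (fun y => γ (y, u)) (fun y => φ (y, u)) y := by
      ext X Y; rw [hessianForm_apply, hessianForm_apply, h4]
    rw [coordLaplacian, h5]; rfl
  rw [h.coordLaplacian_eq hF hy, hfst _ hq, hsnd]
  simp only [h3]
  ring

theorem coordGradInner_potential (h : IsAmbientOn G γ W) (hφ : ContDiffOn ℝ ∞ φ W)
    (hy : (y, u) ∈ W) :
    coordGradInner G (fun q => φ q.2 - q.1) (fun q => φ q.2 - q.1) (v, y, u) =
      coordGradInner (fun y => γ (y, u)) (fun y => φ (y, u)) (fun y => φ (y, u)) y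
        - 2 * fderiv ℝ φ (y, u) (0, 1) := by
  have hq : ((v, y, u) : ℝ × E × ℝ).2 ∈ W := hy
  have h0 : ((0 : E), (0 : ℝ)) = 0 := rfl
  rw [h.coordGradInner_eq (contDiffOn_potential hφ) (contDiffOn_potential hφ) hy,
    (h.hasFDerivAt_potential hφ hq).fderiv]
  have h3 : coordGradInner (fun y => γ (y, u)) (fun y => φ (y, u) - v) (fun y => φ (y, u) - v) y =
      coordGradInner (fun y => γ (y, u)) (fun y => φ (y, u)) (fun y => φ (y, u)) y := by
    rw [coordGradInner, fderiv_sub_const]; rfl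
  simp only [h3]
  simp [h0]; ring

/-- The ambient weighted Laplacian of a density of weight `-1/2` has no derivatives in `u`. -/
theorem weightedLaplacian_density (h : IsAmbientOn G γ W) (hφ : ContDiffOn ℝ ∞ φ W)
    (hf : ContDiffOn ℝ ∞ f W) (hy : (y, u) ∈ W) :
    coordLaplacian G (fun q => Real.exp (-q.1 / 2) * f q.2) (v, y, u)
      - coordGradInner G (fun q => φ q.2 - q.1) (fun q => Real.exp (-q.1 / 2) * f q.2) (v, y, u) =
    Real.exp (-v / 2) * (coordLaplacian (fun y => γ (y, u)) (fun y => f (y, u)) y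
      - coordGradInner (fun y => γ (y, u)) (fun y => φ (y, u)) (fun y => f (y, u)) y
      + (2⁻¹ * fderiv ℝ φ (y, u) (0, 1) - 4⁻¹ * metricTrace (γ (y, u))
        (toBilin (fderiv ℝ γ (y, u) (0, 1)))) * f (y, u)) := by
  rw [h.coordLaplacian_density hf hy, h.coordGradInner_density hφ hf hy]
  ring

/-- At a point where the ambient equations hold, the ambient weighted Laplacian of a density of
weight `-1/2` is given by the operator `Δ_φ - ¼ R_φ`. -/
theorem weightedLaplacian_density_of_normal (h : IsAmbientOn G γ W) (hφ : ContDiffOn ℝ ∞ φ W)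
    (hf : ContDiffOn ℝ ∞ f W) (hy : (y, u) ∈ W)
    (hP : ∀ X Y, (ricciForm G (v, y, u) + hessianForm G (fun q => φ q.2 - q.1) (v, y, u)) X Y = 0)
    (hN : coordLaplacian G (fun q => φ q.2 - q.1) (v, y, u)
      - coordGradInner G (fun q => φ q.2 - q.1) (fun q => φ q.2 - q.1) (v, y, u) = 0) :
    coordLaplacian G (fun q => Real.exp (-q.1 / 2) * f q.2) (v, y, u)
      - coordGradInner G (fun q => φ q.2 - q.1) (fun q => Real.exp (-q.1 / 2) * f q.2) (v, y, u) =
    Real.exp (-v / 2) *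
      coordFactor (fun y => γ (y, u)) (fun y => φ (y, u)) (fun y => f (y, u)) y := by
  have hq : ((v, y, u) : ℝ × E × ℝ).2 ∈ W := hy
  have hT : ∀ X Y, ricciForm G (v, y, u) (midIncl E X) (midIncl E Y) =
      ((-1 : ℝ) • hessianForm G (fun q => φ q.2 - q.1) (v, y, u)) (midIncl E X)
        (midIncl E Y) := fun X Y => by
    have := hP (midIncl E X) (midIncl E Y)
    simp only [LinearMap.add_apply, LinearMap.smul_apply, smul_eq_mul] at this ⊢
    linarith
  -- The trace of the tangential part `Ric + ∇²φ - ½γ' = 0` of the first ambient equation.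
  have h1 : coordScalar (fun y => γ (y, u)) y =
      -(coordLaplacian (fun y => γ (y, u)) (fun y => φ (y, u)) y)
        + 2⁻¹ * metricTrace (γ (y, u)) (toBilin (fderiv ℝ γ (y, u) (0, 1))) := by
    have hform : ricciForm (fun y => γ (y, u)) y =
        (-1 : ℝ) • hessianForm (fun y => γ (y, u)) (fun y => φ (y, u)) y
          + (2⁻¹ : ℝ) • toBilin (fderiv ℝ γ (y, u) (0, 1)) := by
      ext X Y
      have e1 := hT X Y
      have h4 : fderiv ℝ (fun y => φ (y, u) - v) = fderiv ℝ fun y => φ (y, u) := by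
        ext z : 1; rw [fderiv_sub_const]
      have h0 : ((0 : E), (0 : ℝ)) = 0 := rfl
      rw [h.ricciForm_mid hy, LinearMap.smul_apply, LinearMap.smul_apply,
        h.hessianForm_mid (contDiffOn_potential hφ) hy,
        (h.hasFDerivAt_potential hφ hq).fderiv, hessianForm_apply] at e1
      simp only [h4] at e1
      rw [e1]
      simp [h0, hessianForm_apply]
      ring
    rw [coordScalar, hform, metricTrace_add, metricTrace_smul, metricTrace_smul, coordLaplacian]
    ring
  rw [h.coordLaplacian_potential hφ hy, h.coordGradInner_potential hφ hy] at hN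
  rw [h.weightedLaplacian_density hφ hf hy, coordFactor, h1]
  congr 1
  -- The second equation contains `2φ'` and the operator `½φ'`, hence the factor `1/4`.
  linear_combination (f (y, u) / 4) * hN

end IsAmbientOn

theorem gjmsFactor_eq_coordFactor {E : Type*} [NormedAddCommGroup E] [NormedSpace ℝ E]
    [FiniteDimensional ℝ E] {H : Type*} [TopologicalSpace H] (I : ModelWithCorners ℝ E H)
    {M : Type*} [TopologicalSpace M] [ChartedSpace H M]
    (g : ∀ x : M, TangentSpace I x →L[ℝ] TangentSpace I x →L[ℝ] ℝ) (φ f : M → ℝ) (x : M) :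
    gjmsFactor I g φ f x = coordFactor (chartMetric I g x) (φ ∘ (extChartAt I x).symm)
      (f ∘ (extChartAt I x).symm) (extChartAt I x x) := by
  rw [coordFactor, Function.comp_apply, extChartAt_to_inv]
  rfl

/-! ### Normal ambient spaces over the manifold -/

namespace NormalAmbientSpace

variable {n : ℕ} {M : Type*} [TopologicalSpace M] [ChartedSpace (EuclideanSpace ℝ (Fin n)) M]

theorem ambientMetric_apply
    (gu : ∀ x : M, ℝ → TangentSpace (𝓡 n) x →L[ℝ] TangentSpace (𝓡 n) x →L[ℝ] ℝ) (p : ℝ × M × ℝ)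
    (X Y : ℝ × EuclideanSpace ℝ (Fin n) × ℝ) :
    (show (ℝ × EuclideanSpace ℝ (Fin n) × ℝ) →L[ℝ] (ℝ × EuclideanSpace ℝ (Fin n) × ℝ) →L[ℝ] ℝ from
      ambientMetric gu p) X Y = X.1 * Y.2.2 + X.2.2 * Y.1 +
        (show EuclideanSpace ℝ (Fin n) →L[ℝ] EuclideanSpace ℝ (Fin n) →L[ℝ] ℝ from
          gu p.2.1 p.2.2) X.2.1 Y.2.1 := rfl

theorem extChartAt_ambient (v : ℝ) (x : M) (u : ℝ) : extChartAt (ambientModel n) (v, x, u) =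
    (PartialEquiv.refl ℝ).prod ((extChartAt (𝓡 n) x).prod (PartialEquiv.refl ℝ)) := by
  rw [extChartAt_prod, extChartAt_prod, extChartAt_model_space_eq_id, extChartAt_model_space_eq_id]

theorem extChartAt_symm_apply (v : ℝ) (x : M) (u : ℝ)
    (q : ℝ × EuclideanSpace ℝ (Fin n) × ℝ) :
    (extChartAt (ambientModel n) (v, x, u)).symm q =
      (q.1, (extChartAt (𝓡 n) x).symm q.2.1, q.2.2) := by
  rw [extChartAt_ambient]
  rfl

theorem mem_extChartAt_target (v : ℝ) (x : M) (u : ℝ)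
    (q : ℝ × EuclideanSpace ℝ (Fin n) × ℝ) :
    q ∈ (extChartAt (ambientModel n) (v, x, u)).target ↔
      q.2.1 ∈ (extChartAt (𝓡 n) x).target := by
  rw [extChartAt_ambient, PartialEquiv.prod_target, PartialEquiv.prod_target]
  exact ⟨fun h => h.2.1, fun h => ⟨trivial, h, trivial⟩⟩

theorem extChartAt_apply_self (v : ℝ) (x : M) (u : ℝ) :
    extChartAt (ambientModel n) (v, x, u) (v, x, u) = (v, extChartAt (𝓡 n) x x, u) := by
  rw [extChartAt_ambient]
  rfl

theorem comp_symm_eq (F : ℝ → M × ℝ → ℝ) (v : ℝ) (x : M) (u : ℝ) :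
    (fun p : ℝ × M × ℝ => F p.1 p.2) ∘ (extChartAt (ambientModel n) (v, x, u)).symm =
      fun q => F q.1 ((extChartAt (𝓡 n) x).symm q.2.1, q.2.2) := by
  ext1 q
  rw [Function.comp_apply, extChartAt_symm_apply]

variable [IsManifold (𝓡 n) ∞ M] {g : RMetric n M} {φ : SmoothFn n M}

/-- The domain of the ambient metric. -/
def carrier (S : NormalAmbientSpace g φ) : Set (ℝ × M × ℝ) := {p | p.2 ∈ S.dom}

/-- The part of the chart at `x` times `ℝ` that corresponds to the domain. -/
def chartDom (S : NormalAmbientSpace g φ) (x : M) : Set (EuclideanSpace ℝ (Fin n) × ℝ) :=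
  {w | w.1 ∈ (extChartAt (𝓡 n) x).target ∧ ((extChartAt (𝓡 n) x).symm w.1, w.2) ∈ S.dom}

/-- The family of metrics `g_u` in the chart at `x`. -/
def chartFamily (S : NormalAmbientSpace g φ) (x : M) (w : EuclideanSpace ℝ (Fin n) × ℝ) :
    EuclideanSpace ℝ (Fin n) →L[ℝ] EuclideanSpace ℝ (Fin n) →L[ℝ] ℝ :=
  chartMetric (𝓡 n) (fun z => S.gu z w.2) x w.1

theorem isOpen_carrier (S : NormalAmbientSpace g φ) : IsOpen S.carrier :=
  S.isOpen_dom.preimage continuous_snd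

theorem isSmoothMetricOn (S : NormalAmbientSpace g φ) :
    IsSmoothMetricOn (ambientModel n) (ambientMetric S.gu) S.carrier where
  isOpen := S.isOpen_carrier
  contMDiffOn := S.smooth_metric
  symm p hp X Y := by
    have h1 := S.gu_symm p.2.1 p.2.2 hp X.2.1 Y.2.1
    have e1 := ambientMetric_apply S.gu p X Y
    have e2 := ambientMetric_apply S.gu p Y X
    refine e1.trans (Eq.trans ?_ e2.symm)
    refine congrArg₂ (· + ·) ?_ h1
    ring
  nondegenerate p hp X hX := by
    obtain ⟨a, X, b⟩ := X
    have h1 := (ambientMetric_apply S.gu p (a, X, b) (0, 0, 1)).symm.trans (hX (0, 0, 1))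
    have h2 := (ambientMetric_apply S.gu p (a, X, b) (1, 0, 0)).symm.trans (hX (1, 0, 0))
    have h3 := (ambientMetric_apply S.gu p (a, X, b) (0, X, 0)).symm.trans (hX (0, X, 0))
    simp only [mul_one, mul_zero, add_zero, map_zero, zero_add] at h1 h2 h3
    have h4 : X = 0 := by
      by_contra h
      exact (S.gu_pos p.2.1 p.2.2 hp X h).ne' h3
    rw [h1, h2, h4]
    rfl

theorem chartSet_carrier (S : NormalAmbientSpace g φ) (v : ℝ) (x : M) (u : ℝ) :
    chartSet (ambientModel n) (v, x, u) S.carrier = {q | q.2 ∈ S.chartDom x} := by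
  ext q
  rw [chartSet, Set.mem_inter_iff, mem_extChartAt_target, Set.mem_preimage, extChartAt_symm_apply]
  rfl

theorem chartDeriv_ambient (v : ℝ) (x : M) (u : ℝ) {q : ℝ × EuclideanSpace ℝ (Fin n) × ℝ}
    (hq : q.2.1 ∈ (extChartAt (𝓡 n) x).target) (X : ℝ × EuclideanSpace ℝ (Fin n) × ℝ) :
    chartDeriv (ambientModel n) (v, x, u) q X = (X.1, chartDeriv (𝓡 n) x q.2.1 X.2.1, X.2.2) := by
  have h1 : HasMFDerivAt 𝓘(ℝ, ℝ × EuclideanSpace ℝ (Fin n) × ℝ) 𝓘(ℝ, ℝ)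
      (fun q : ℝ × EuclideanSpace ℝ (Fin n) × ℝ => q.1) q
      (ContinuousLinearMap.fst ℝ ℝ (EuclideanSpace ℝ (Fin n) × ℝ)) := hasFDerivAt_fst.hasMFDerivAt
  have h2 : HasMFDerivAt 𝓘(ℝ, ℝ × EuclideanSpace ℝ (Fin n) × ℝ) 𝓘(ℝ, EuclideanSpace ℝ (Fin n))
      (fun q : ℝ × EuclideanSpace ℝ (Fin n) × ℝ => q.2.1) q
      (ContinuousLinearMap.fst ℝ (EuclideanSpace ℝ (Fin n)) ℝ ∘L
        ContinuousLinearMap.snd ℝ ℝ (EuclideanSpace ℝ (Fin n) × ℝ)) :=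
    (hasFDerivAt_fst.comp q hasFDerivAt_snd).hasMFDerivAt
  have h3 : HasMFDerivAt 𝓘(ℝ, ℝ × EuclideanSpace ℝ (Fin n) × ℝ) 𝓘(ℝ, ℝ)
      (fun q : ℝ × EuclideanSpace ℝ (Fin n) × ℝ => q.2.2) q
      (ContinuousLinearMap.snd ℝ (EuclideanSpace ℝ (Fin n)) ℝ ∘L
        ContinuousLinearMap.snd ℝ ℝ (EuclideanSpace ℝ (Fin n) × ℝ)) :=
    (hasFDerivAt_snd.comp q hasFDerivAt_snd).hasMFDerivAt
  have h4 := HasMFDerivAt.comp q (mdifferentiableAt_symm hq).hasMFDerivAt h2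
  have h5 := h1.prodMk (h4.prodMk h3)
  have h6 : (extChartAt (ambientModel n) (v, x, u)).symm =
      fun q : ℝ × EuclideanSpace ℝ (Fin n) × ℝ =>
        (q.1, (extChartAt (𝓡 n) x).symm q.2.1, q.2.2) := by
    ext1 q; exact extChartAt_symm_apply v x u q
  have h7 := h5.mfderiv
  rw [chartDeriv, h6]
  exact congrArg (fun T : (ℝ × EuclideanSpace ℝ (Fin n) × ℝ) →L[ℝ]
    (ℝ × EuclideanSpace ℝ (Fin n) × ℝ) => T X) h7

/-- The charts of `ℝ × M × ℝ` are products with the identity in `v` and `u`, so they preserve the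
form `2 du dv + g_u`. -/
theorem isAmbientOn (S : NormalAmbientSpace g φ) (v : ℝ) (x : M) (u : ℝ) :
    IsAmbientOn (chartMetric (ambientModel n) (ambientMetric S.gu) (v, x, u)) (S.chartFamily x)
      (S.chartDom x) where
  isOpen := by
    have h1 := isOpen_chartSet (I := ambientModel n) (v, x, u) S.isOpen_carrier
    rw [S.chartSet_carrier] at h1
    exact h1.preimage (f := fun w : EuclideanSpace ℝ (Fin n) × ℝ => ((0 : ℝ), w)) (by fun_prop)
  isMetricOn := by
    rw [← S.chartSet_carrier v x u]
    exact S.isSmoothMetricOn.isMetricOn_chartMetric (v, x, u)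
  apply_eq q hq X Y := by
    rw [chartMetric_apply, chartDeriv_ambient v x u hq.1, chartDeriv_ambient v x u hq.1,
      extChartAt_symm_apply]
    rfl

theorem contDiffOn_chart (S : NormalAmbientSpace g φ) {f : M × ℝ → ℝ}
    (hf : ContMDiffOn ((𝓡 n).prod 𝓘(ℝ, ℝ)) 𝓘(ℝ, ℝ) ∞ f S.dom) (x : M) :
    ContDiffOn ℝ ∞ (fun w : EuclideanSpace ℝ (Fin n) × ℝ =>
      f ((extChartAt (𝓡 n) x).symm w.1, w.2)) (S.chartDom x) := by
  rw [← contMDiffOn_iff_contDiffOn]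
  have h1 : ContMDiffOn 𝓘(ℝ, EuclideanSpace ℝ (Fin n) × ℝ) (𝓡 n) ∞
      (fun w : EuclideanSpace ℝ (Fin n) × ℝ => (extChartAt (𝓡 n) x).symm w.1) (S.chartDom x) :=
    (contMDiffOn_extChartAt_symm x).comp
      (contMDiffOn_iff_contDiffOn.2 contDiff_fst.contDiffOn) fun w hw => hw.1
  have h2 : ContMDiffOn 𝓘(ℝ, EuclideanSpace ℝ (Fin n) × ℝ) 𝓘(ℝ, ℝ) ∞
      (fun w : EuclideanSpace ℝ (Fin n) × ℝ => w.2) (S.chartDom x) :=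
    contMDiffOn_iff_contDiffOn.2 contDiff_snd.contDiffOn
  exact hf.comp (h1.prodMk h2) fun w hw => hw.2

variable (S : NormalAmbientSpace g φ) {f : M × ℝ → ℝ}

theorem contMDiffOn_potential :
    ContMDiffOn (ambientModel n) 𝓘(ℝ, ℝ) ∞ (ambientPotential S.φu) S.carrier :=
  (S.smooth_potential.comp contMDiffOn_snd fun _ hp => hp).sub contMDiffOn_fst

theorem contMDiffOn_density (hf : ContMDiffOn ((𝓡 n).prod 𝓘(ℝ, ℝ)) 𝓘(ℝ, ℝ) ∞ f S.dom) :
    ContMDiffOn (ambientModel n) 𝓘(ℝ, ℝ) ∞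
      (fun p : ℝ × M × ℝ => Real.exp (-p.1 / 2) * f p.2) S.carrier := by
  have h1 : ContDiff ℝ ∞ fun v : ℝ => Real.exp (-v / 2) := by fun_prop
  exact (h1.contMDiff.comp_contMDiffOn contMDiffOn_fst).mul
    (hf.comp contMDiffOn_snd fun _ hp => hp)

theorem mem_chartDom {x : M} {u : ℝ} (h : (x, u) ∈ S.dom) :
    (extChartAt (𝓡 n) x x, u) ∈ S.chartDom x :=
  ⟨_root_.mem_extChartAt_target x, by
    show ((extChartAt (𝓡 n) x).symm (extChartAt (𝓡 n) x x), u) ∈ S.dom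
    rwa [extChartAt_to_inv]⟩

theorem weightedLaplacian_eq_chart (f : M × ℝ → ℝ) (v : ℝ) (x : M) (u : ℝ) :
    S.weightedLaplacian (fun p => Real.exp (-p.1 / 2) * f p.2) (v, x, u) =
      coordLaplacian (chartMetric (ambientModel n) (ambientMetric S.gu) (v, x, u))
        (fun q => Real.exp (-q.1 / 2) * f ((extChartAt (𝓡 n) x).symm q.2.1, q.2.2))
        (v, extChartAt (𝓡 n) x x, u)
      - coordGradInner (chartMetric (ambientModel n) (ambientMetric S.gu) (v, x, u))
        (fun q => S.φu ((extChartAt (𝓡 n) x).symm q.2.1, q.2.2) - q.1)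
        (fun q => Real.exp (-q.1 / 2) * f ((extChartAt (𝓡 n) x).symm q.2.1, q.2.2))
        (v, extChartAt (𝓡 n) x x, u) := by
  rw [← extChartAt_apply_self, ← comp_symm_eq (fun v w => Real.exp (-v / 2) * f w) v x u,
    ← comp_symm_eq (fun v w => S.φu w - v) v x u]
  rfl

/-- The coordinate formula is `e^{-v/2}` times an expression free of `v`. This holds on the whole
domain and does not need the ambient equations. -/
theorem weightedLaplacian_density (hf : ContMDiffOn ((𝓡 n).prod 𝓘(ℝ, ℝ)) 𝓘(ℝ, ℝ) ∞ f S.dom)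
    {v : ℝ} {x : M} {u : ℝ} (h : (x, u) ∈ S.dom) :
    S.weightedLaplacian (fun p => Real.exp (-p.1 / 2) * f p.2) (v, x, u) = Real.exp (-v / 2) *
      S.weightedLaplacian (fun p => Real.exp (-p.1 / 2) * f p.2) (0, x, u) := by
  have key := fun v => (S.isAmbientOn v x u).weightedLaplacian_density (v := v)
    (S.contDiffOn_chart S.smooth_potential x) (S.contDiffOn_chart hf x) (S.mem_chartDom h)
  rw [weightedLaplacian_eq_chart, weightedLaplacian_eq_chart, key, key]
  simp

theorem weightedLaplacian_density_zero
    (hf : ContMDiffOn ((𝓡 n).prod 𝓘(ℝ, ℝ)) 𝓘(ℝ, ℝ) ∞ f S.dom) (x : M) :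
    S.weightedLaplacian (fun p => Real.exp (-p.1 / 2) * f p.2) (0, x, 0) =
      gjmsFactor (𝓡 n) g.inner φ (fun z => f (z, 0)) x := by
  -- Being `O(u)` forces the value at `u = 0` to vanish, so the exponent `1` suffices below.
  have hval : ∀ {F : ℝ → ℝ}, F =O[𝓝 0] (fun u : ℝ => u ^ 1) → F 0 = 0 := fun hF => by
    obtain ⟨c, hc⟩ := hF.bound
    simpa using hc.self_of_nhds
  have hP := fun X Y => hval (S.P_vanishes 0 x X Y 1)
  have hN := hval (S.F_vanishes 0 x 1)
  have hpot : ambientPotential S.φu ∘ (extChartAt (ambientModel n) (0, x, 0)).symm =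
      fun q => S.φu ((extChartAt (𝓡 n) x).symm q.2.1, q.2.2) - q.1 :=
    comp_symm_eq (fun v w => S.φu w - v) 0 x 0
  simp only [weightedP, ricci, hessian, hpot, extChartAt_apply_self] at hP
  simp only [weightedF, laplacian, gradInner, hessian, hpot, extChartAt_apply_self] at hN
  have key := (S.isAmbientOn 0 x 0).weightedLaplacian_density_of_normal
    (S.contDiffOn_chart S.smooth_potential x) (S.contDiffOn_chart hf x)
    (S.mem_chartDom (S.zero_mem x)) hP hN
  rw [weightedLaplacian_eq_chart, key, gjmsFactor_eq_coordFactor]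
  have e1 : (fun y => S.chartFamily x (y, 0)) = chartMetric (𝓡 n) g.inner x := by
    ext1 y
    simp only [chartFamily, S.gu_zero]
  simp only [e1, S.φu_zero]
  rw [neg_zero, zero_div, Real.exp_zero, one_mul]
  rfl

/-- The invariant of the iteration: each iterate is `e^{-v/2}` times a smooth function of `(x, u)`,
which serves as the extension for the next step. The ambient equations are used only at `u = 0`, so
uncontrolled values off `u = 0` do no harm. -/
theorem iterate_weightedLaplacian (hf : ContMDiffOn ((𝓡 n).prod 𝓘(ℝ, ℝ)) 𝓘(ℝ, ℝ) ∞ f S.dom)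
    (k : ℕ) : ∃ h : M × ℝ → ℝ, ContMDiffOn ((𝓡 n).prod 𝓘(ℝ, ℝ)) 𝓘(ℝ, ℝ) ∞ h S.dom ∧
      (∀ p ∈ S.carrier, (S.weightedLaplacian^[k] fun p => Real.exp (-p.1 / 2) * f p.2) p =
        Real.exp (-p.1 / 2) * h p.2) ∧
      (fun x => h (x, 0)) = (gjmsFactor (𝓡 n) g.inner φ)^[k] fun x => f (x, 0) := by
  induction k with
  | zero => exact ⟨f, hf, fun _ _ => rfl, rfl⟩
  | succ k ih =>
    obtain ⟨h, hh, heq, hzero⟩ := ih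
    -- The new coefficient function is the value at `v = 0`, where the exponential is `1`.
    refine ⟨fun w => S.weightedLaplacian (fun p => Real.exp (-p.1 / 2) * h p.2) (0, w), ?_, ?_, ?_⟩
    · have h1 := S.isSmoothMetricOn.contMDiffOn_weightedLaplacian S.contMDiffOn_potential
        (S.contMDiffOn_density hh)
      exact h1.comp (contMDiffOn_const.prodMk contMDiffOn_id) fun w hw => hw
    · rintro ⟨v, x, u⟩ hp
      rw [Function.iterate_succ_apply']
      have h2 : S.weightedLaplacian (S.weightedLaplacian^[k]
          fun p => Real.exp (-p.1 / 2) * f p.2) (v, x, u) =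
          S.weightedLaplacian (fun p => Real.exp (-p.1 / 2) * h p.2) (v, x, u) := by
        refine weightedLaplacian_congr ?_
        filter_upwards [S.isOpen_carrier.mem_nhds hp] with p hp using heq p hp
      rw [h2, S.weightedLaplacian_density hh hp]
    · rw [Function.iterate_succ_apply', ← hzero]
      ext1 x
      exact S.weightedLaplacian_density_zero hh x

end NormalAmbientSpace

/-! ### Orders of differential operators -/

section Order

variable {A : Type*} [CommRing A] [Algebra ℝ A]

namespace IsDiffOpOfOrderLT

theorem zero (m : ℕ) : IsDiffOpOfOrderLT m (0 : Module.End ℝ A) := by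
  induction m with
  | zero => rfl
  | succ m ih => intro a; simpa using ih

theorem add {m : ℕ} {D D' : Module.End ℝ A} (h : IsDiffOpOfOrderLT m D)
    (h' : IsDiffOpOfOrderLT m D') : IsDiffOpOfOrderLT m (D + D') := by
  induction m generalizing D D' with
  | zero =>
    have e : D = 0 := h
    have e' : D' = 0 := h'
    show D + D' = 0
    rw [e, e', add_zero]
  | succ m ih =>
    intro a
    have := ih (h a) (h' a)
    convert! this using 1
    rw [add_mul, mul_add]; abel

theorem succ {m : ℕ} {D : Module.End ℝ A} (h : IsDiffOpOfOrderLT m D) :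
    IsDiffOpOfOrderLT (m + 1) D := by
  induction m generalizing D with
  | zero =>
    have e : D = 0 := h
    rw [e]; exact zero 1
  | succ m ih => exact fun a => ih (h a)

theorem mono {m m' : ℕ} {D : Module.End ℝ A} (h : IsDiffOpOfOrderLT m D) (hm : m ≤ m') :
    IsDiffOpOfOrderLT m' D := by
  induction hm with
  | refl => exact h
  | step _ ih => exact ih.succ

/-- The order of a composition is at most the sum of the orders. -/
theorem mul {p q : ℕ} {D D' : Module.End ℝ A} (h : IsDiffOpOfOrderLT p D)
    (h' : IsDiffOpOfOrderLT q D') : IsDiffOpOfOrderLT (p + q - 1) (D * D') := by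
  induction p generalizing D D' q with
  | zero =>
    have e : D = 0 := h
    rw [e, zero_mul]; exact zero _
  | succ p ihp =>
    induction q generalizing D' with
    | zero =>
      have e : D' = 0 := h'
      rw [e, mul_zero]; exact zero _
    | succ q ihq =>
      -- Orders are strict bounds: orders at most `p` and at most `q` add up to at most `p + q`.
      -- Truncated subtraction matters only in the cases above, where an operator is zero.
      have e : p + 1 + (q + 1) - 1 = (p + q) + 1 := by omega
      rw [e]
      intro a
      have h1 := ihq (h' a)
      have h2 := ihp (h a) h'
      rw [show p + 1 + q - 1 = p + q by omega] at h1
      rw [show p + (q + 1) - 1 = p + q by omega] at h2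
      -- The commutator is a derivation: `[DD', a] = D[D', a] + [D, a]D'`.
      convert! h1.add h2 using 1
      noncomm_ring

theorem mulLeft (a : A) : IsDiffOpOfOrderLT 1 (LinearMap.mulLeft ℝ a) := by
  intro b
  show _ = _
  ext f
  simp; ring

theorem one : IsDiffOpOfOrderLT 1 (1 : Module.End ℝ A) := by
  intro b
  show _ = _
  simp

theorem pow {D : Module.End ℝ A} (h : IsDiffOpOfOrderLT 3 D) (k : ℕ) :
    IsDiffOpOfOrderLT (2 * k + 1) (D ^ k) := by
  induction k with
  | zero => exact one
  | succ k ih =>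
    rw [pow_succ']
    exact (h.mul ih).mono (by omega)

/-- A perturbation of order zero does not change the leading term of a power. -/
theorem pow_add_sub_pow {D B : Module.End ℝ A} (hD : IsDiffOpOfOrderLT 3 D)
    (hB : IsDiffOpOfOrderLT 1 B) (k : ℕ) : IsDiffOpOfOrderLT (2 * k) ((D + B) ^ k - D ^ k) := by
  induction k with
  | zero => simpa using zero 0
  | succ k ih =>
    -- The first summand gains order two from the induction hypothesis, and the second has order at
    -- most `2k`.
    have e : (D + B) ^ (k + 1) - D ^ (k + 1) =
        (D + B) * ((D + B) ^ k - D ^ k) + B * D ^ k := by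
      rw [pow_succ', pow_succ']; noncomm_ring
    rw [e]
    exact (((hD.add (hB.mono (by omega))).mul ih).mono (by omega)).add
      ((hB.mul (hD.pow k)).mono (by omega))

end IsDiffOpOfOrderLT

end Order

/-! ### The operators on smooth functions -/

section Operators

section

variable {E : Type*} [NormedAddCommGroup E] [NormedSpace ℝ E]
  {H : Type*} [TopologicalSpace H] (I : ModelWithCorners ℝ E H)
  {M : Type*} [TopologicalSpace M] [ChartedSpace H M]
  (g : ∀ x : M, TangentSpace I x →L[ℝ] TangentSpace I x →L[ℝ] ℝ) (φ f : M → ℝ) (x : M)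

theorem weightedLaplacian_eq_coord [FiniteDimensional ℝ E] : weightedLaplacian I g φ f x =
    coordLaplacian (chartMetric I g x) (f ∘ (extChartAt I x).symm) (extChartAt I x x)
      - coordGradInner (chartMetric I g x) (φ ∘ (extChartAt I x).symm)
        (f ∘ (extChartAt I x).symm) (extChartAt I x x) := rfl

theorem gradInner_eq_coord : gradInner I g φ f x =
    coordGradInner (chartMetric I g x) (φ ∘ (extChartAt I x).symm)
      (f ∘ (extChartAt I x).symm) (extChartAt I x x) := rfl

end

variable {n : ℕ} {M : Type*} [TopologicalSpace M] [ChartedSpace (EuclideanSpace ℝ (Fin n)) M]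

theorem extChartAt_mem_chartSet_univ (x : M) :
    extChartAt (𝓡 n) x x ∈ chartSet (𝓡 n) x Set.univ :=
  mem_chartSet (Set.mem_univ x) (mem_extChartAt_source x)

variable [IsManifold (𝓡 n) ∞ M] (g : RMetric n M)

theorem RMetric.isSmoothMetricOn : IsSmoothMetricOn (𝓡 n) g.inner (Set.univ : Set M) where
  isOpen := isOpen_univ
  contMDiffOn := g.contMDiff.contMDiffOn
  symm x _ X Y := g.symm x X Y
  nondegenerate x _ X hX := by
    by_contra h
    exact (g.pos x X h).ne' (hX X)

theorem RMetric.isMetricOn (x : M) : IsMetricOn (chartMetric (𝓡 n) g.inner x)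
    (chartSet (𝓡 n) x Set.univ) :=
  (RMetric.isSmoothMetricOn g).isMetricOn_chartMetric x

theorem SmoothFn.contDiffOn_chart (f : SmoothFn n M) (x : M) :
    ContDiffOn ℝ ∞ (f ∘ (extChartAt (𝓡 n) x).symm) (chartSet (𝓡 n) x Set.univ) :=
  contDiffOn_comp_symm f.contMDiff.contMDiffOn x

/-- The inner product of the gradients of two smooth functions. -/
def gradInnerFn (f h : SmoothFn n M) : SmoothFn n M :=
  ⟨gradInner (𝓡 n) g.inner f h, contMDiffOn_univ.1 ((RMetric.isSmoothMetricOn g).contMDiffOn_gradInner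
    f.contMDiff.contMDiffOn h.contMDiff.contMDiffOn)⟩

/-- The zeroth order term `¼ R_φ`. -/
def quarterCurvature (φ : SmoothFn n M) : SmoothFn n M :=
  ⟨fun x => 1 / 4 * weightedScalarCurvature (𝓡 n) g.inner φ x, contMDiff_const.mul
    (contMDiffOn_univ.1 ((RMetric.isSmoothMetricOn g).contMDiffOn_weightedScalarCurvature
      φ.contMDiff.contMDiffOn))⟩

/-- The weighted Laplacian as an endomorphism of the space of smooth functions. -/
def weightedLaplacianEnd (φ : SmoothFn n M) : Module.End ℝ (SmoothFn n M) where
  toFun f := ⟨weightedLaplacian (𝓡 n) g.inner φ f,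
    contMDiffOn_univ.1 ((RMetric.isSmoothMetricOn g).contMDiffOn_weightedLaplacian
      φ.contMDiff.contMDiffOn f.contMDiff.contMDiffOn)⟩
  map_add' f h := by
    ext x
    have hx := extChartAt_mem_chartSet_univ (n := n) x
    have hg := RMetric.isMetricOn g x
    have h1 := hg.coordLaplacian_add (f.contDiffOn_chart x) (h.contDiffOn_chart x) hx
    have h2 := hg.coordGradInner_add_right (h := φ ∘ (extChartAt (𝓡 n) x).symm)
      (f.contDiffOn_chart x) (h.contDiffOn_chart x) hx
    refine (congrArg₂ (· - ·) h1 h2).trans ?_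
    exact add_sub_add_comm _ _ _ _
  map_smul' c f := by
    ext x
    have hx := extChartAt_mem_chartSet_univ (n := n) x
    have hg := RMetric.isMetricOn g x
    have h1 := hg.coordLaplacian_const_mul (f.contDiffOn_chart x) c hx
    have h2 := hg.coordGradInner_const_mul_right (h := φ ∘ (extChartAt (𝓡 n) x).symm)
      (f.contDiffOn_chart x) c hx
    refine (congrArg₂ (· - ·) h1 h2).trans ?_
    exact (mul_sub _ _ _).symm

/-- The operator `Δ_φ - ¼ R_φ` on smooth functions. -/
def gjmsEnd (φ : SmoothFn n M) : Module.End ℝ (SmoothFn n M) :=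
  weightedLaplacianEnd g φ + LinearMap.mulLeft ℝ (-quarterCurvature g φ)

theorem gjmsEnd_apply (φ f : SmoothFn n M) :
    ⇑(gjmsEnd g φ f) = gjmsFactor (𝓡 n) g.inner φ f := by
  ext1 x
  show weightedLaplacian (𝓡 n) g.inner φ f x +
    -(1 / 4 * weightedScalarCurvature (𝓡 n) g.inner φ x) * f x = _
  rw [gjmsFactor]
  ring

theorem gjmsEnd_pow_apply (φ f : SmoothFn n M) (k : ℕ) :
    ⇑((gjmsEnd g φ ^ k) f) = (gjmsFactor (𝓡 n) g.inner φ)^[k] f := by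
  induction k with
  | zero => rfl
  | succ k ih => rw [pow_succ', Module.End.mul_apply, gjmsEnd_apply, ih, Function.iterate_succ_apply']

theorem weightedLaplacianEnd_pow_apply (φ f : SmoothFn n M) (k : ℕ) :
    ⇑((weightedLaplacianEnd g φ ^ k) f) = (weightedLaplacian (𝓡 n) g.inner φ)^[k] f := by
  induction k with
  | zero => rfl
  | succ k ih =>
    rw [pow_succ', Module.End.mul_apply, Function.iterate_succ_apply', ← ih]
    rfl

theorem gradInnerFn_mul_right (a b f : SmoothFn n M) :
    gradInnerFn g a (b * f) = b * gradInnerFn g a f + f * gradInnerFn g a b := by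
  ext x
  have h1 := (RMetric.isMetricOn g x).coordGradInner_mul_right
    (h := a ∘ (extChartAt (𝓡 n) x).symm) (b.contDiffOn_chart x) (f.contDiffOn_chart x)
    (extChartAt_mem_chartSet_univ x)
  simp only [Function.comp_apply, extChartAt_to_inv] at h1
  exact h1

theorem weightedLaplacianEnd_mul (φ a f : SmoothFn n M) :
    weightedLaplacianEnd g φ (a * f) = a * weightedLaplacianEnd g φ f
      + f * weightedLaplacianEnd g φ a + (gradInnerFn g a f + gradInnerFn g a f) := by
  ext x
  have hx := extChartAt_mem_chartSet_univ (n := n) x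
  have hg := RMetric.isMetricOn g x
  have h1 := hg.coordLaplacian_mul (a.contDiffOn_chart x) (f.contDiffOn_chart x) hx
  have h2 := hg.coordGradInner_mul_right (h := φ ∘ (extChartAt (𝓡 n) x).symm)
    (a.contDiffOn_chart x) (f.contDiffOn_chart x) hx
  simp only [Function.comp_apply, extChartAt_to_inv] at h1 h2
  refine (congrArg₂ (· - ·) h1 h2).trans ?_
  show _ = a x * weightedLaplacian (𝓡 n) g.inner φ f x
    + f x * weightedLaplacian (𝓡 n) g.inner φ a x
    + (gradInner (𝓡 n) g.inner a f x + gradInner (𝓡 n) g.inner a f x)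
  rw [weightedLaplacian_eq_coord, weightedLaplacian_eq_coord, gradInner_eq_coord]
  ring

/-- By the product rule the double commutator with `a` and `b` is multiplication by `2g(∇a, ∇b)`,
which has order zero. The drift term is a derivation and contributes nothing. -/
theorem isDiffOpOfOrderLT_weightedLaplacianEnd (φ : SmoothFn n M) :
    IsDiffOpOfOrderLT 3 (weightedLaplacianEnd g φ) := by
  intro a b
  have key : (weightedLaplacianEnd g φ * LinearMap.mulLeft ℝ a -
      LinearMap.mulLeft ℝ a * weightedLaplacianEnd g φ) * LinearMap.mulLeft ℝ b -
      LinearMap.mulLeft ℝ b * (weightedLaplacianEnd g φ * LinearMap.mulLeft ℝ a -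
      LinearMap.mulLeft ℝ a * weightedLaplacianEnd g φ) =
      LinearMap.mulLeft ℝ (gradInnerFn g a b + gradInnerFn g a b) := by
    refine LinearMap.ext fun f => ?_
    simp only [LinearMap.sub_apply, Module.End.mul_apply, LinearMap.mulLeft_apply,
      weightedLaplacianEnd_mul, gradInnerFn_mul_right]
    ring
  rw [key]
  exact IsDiffOpOfOrderLT.mulLeft _

/-! ### Conformal covariance -/

/-- The conformal factor `e^{-v/2}`. -/
def expNegHalf (v : SmoothFn n M) : SmoothFn n M :=
  ⟨fun x => Real.exp (-1 / 2 * v x), by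
    have h1 : ContDiff ℝ ∞ fun t : ℝ => Real.exp (-1 / 2 * t) := by fun_prop
    exact h1.contMDiff.comp v.contMDiff⟩

theorem gjmsEnd_conformal (φ v f : SmoothFn n M) :
    gjmsEnd g (φ - v) (expNegHalf v * f) = expNegHalf v * gjmsEnd g φ f := by
  ext x
  rw [gjmsEnd_apply]
  show _ = expNegHalf v x * gjmsEnd g φ f x
  rw [gjmsEnd_apply, gjmsFactor_eq_coordFactor, gjmsFactor_eq_coordFactor]
  have h1 := (RMetric.isMetricOn g x).coordFactor_conformal (φ.contDiffOn_chart x)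
    (v.contDiffOn_chart x) (f.contDiffOn_chart x) (extChartAt_mem_chartSet_univ x)
  simp only [Function.comp_apply, extChartAt_to_inv] at h1
  rw [show ⇑(φ - v) ∘ (extChartAt (𝓡 n) x).symm = φ ∘ (extChartAt (𝓡 n) x).symm +
    fun y => -1 * v ((extChartAt (𝓡 n) x).symm y) by ext y; simp [sub_eq_add_neg]]
  exact h1

theorem gjmsEnd_pow_conformal (φ v f : SmoothFn n M) (k : ℕ) :
    (gjmsEnd g (φ - v) ^ k) (expNegHalf v * f) = expNegHalf v * (gjmsEnd g φ ^ k) f := by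
  induction k with
  | zero => rfl
  | succ k ih =>
    rw [pow_succ', Module.End.mul_apply, ih, gjmsEnd_conformal, pow_succ', Module.End.mul_apply]

/-- The map induced by the `k`-th power of `Δ_φ - ¼ R_φ` on densities of weight `-1/2`. -/
def gjmsDensityMap (φ : SmoothFn n M) (k : ℕ) :
    ConformalDensity φ (-1 / 2) →ₗ[ℝ] ConformalDensity φ (-1 / 2) where
  toFun f := ⟨fun ψ => (gjmsEnd g (ψ : SmoothFn n M) ^ k) (f.1 ψ), fun ψ ψ' v h x => by
    have h1 : f.1 ψ' = expNegHalf v * f.1 ψ := by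
      ext x; exact f.2 ψ ψ' v h x
    have h2 := gjmsEnd_pow_conformal g ψ v (f.1 ψ) k
    rw [← h1, ← h] at h2
    exact congrArg (fun F : SmoothFn n M => F x) h2⟩
  map_add' f f' := by
    ext ψ : 2
    exact map_add (gjmsEnd g (ψ : SmoothFn n M) ^ k) _ _
  map_smul' c f := by
    ext ψ : 2
    exact map_smul (gjmsEnd g (ψ : SmoothFn n M) ^ k) _ _

end Operators

/-! ### Divergence theorem and Green's identity in coordinates -/

section Divergence

variable {E : Type*} [NormedAddCommGroup E] [NormedSpace ℝ E]

/-- The divergence of a vector field with respect to Lebesgue measure. -/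
def coordDiv (V : E → E) (y : E) : ℝ := LinearMap.trace ℝ E (fderiv ℝ V y : E →ₗ[ℝ] E)

/-- The gradient of a function in coordinates. -/
def coordGrad (G : E → E →L[ℝ] E →L[ℝ] ℝ) (f : E → ℝ) (y : E) : E :=
  (G y).inverse (fderiv ℝ f y)

theorem coordDiv_sub {V V' : E → E} {y : E} (hV : DifferentiableAt ℝ V y)
    (hV' : DifferentiableAt ℝ V' y) : coordDiv (V - V') y = coordDiv V y - coordDiv V' y := by
  rw [coordDiv, fderiv_sub hV hV', coordDiv, coordDiv, ← map_sub]
  rfl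

variable [FiniteDimensional ℝ E]

theorem coordDiv_smul {c : E → ℝ} {V : E → E} {y : E} (hc : DifferentiableAt ℝ c y)
    (hV : DifferentiableAt ℝ V y) :
    coordDiv (c • V) y = fderiv ℝ c y (V y) + c y * coordDiv V y := by
  have h1 : (fderiv ℝ (c • V) y : E →ₗ[ℝ] E) =
      c y • (fderiv ℝ V y : E →ₗ[ℝ] E) +
        LinearMap.toSpanSingleton ℝ E (V y) ∘ₗ (fderiv ℝ c y : E →ₗ[ℝ] ℝ) := by
    rw [(hc.hasFDerivAt.smul hV.hasFDerivAt).fderiv]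
    ext W; simp
  have hℝ : ∀ S : ℝ →ₗ[ℝ] ℝ, LinearMap.trace ℝ ℝ S = S 1 := fun S => by
    rw [trace_eq_sum (Module.Basis.singleton Unit ℝ)]; simp
  rw [coordDiv, h1, map_add, map_smul, LinearMap.trace_comp_comm', hℝ, add_comm, coordDiv]
  simp

/-- Integration by parts against the constant `1`. -/
theorem integral_fderiv_eq_zero [MeasurableSpace E] [BorelSpace E] (μ : Measure E)
    [μ.IsAddHaarMeasure] {f : E → ℝ} (hf : ContDiff ℝ ∞ f) (hc : HasCompactSupport f) (w : E) :
    ∫ y, fderiv ℝ f y w ∂μ = 0 := by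
  have h1 : Integrable f μ := hf.continuous.integrable_of_hasCompactSupport hc
  have h2 : Integrable (fun y => fderiv ℝ f y w) μ :=
    ((hf.continuous_fderiv (by simp)).clm_apply continuous_const).integrable_of_hasCompactSupport
      (hc.fderiv_apply ℝ w)
  have := integral_mul_fderiv_eq_neg_fderiv_mul_of_integrable (μ := μ) (f := fun _ : E => (1 : ℝ))
    (g := f) (v := w) (by simp) (by simpa using h2) (by simpa using h1)
    (fun _ _ => differentiableAt_const _) (fun y _ => hf.differentiable (by simp) y)
  simpa using this

theorem integral_coordDiv_eq_zero [MeasurableSpace E] [BorelSpace E] (μ : Measure E)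
    [μ.IsAddHaarMeasure] {V : E → E} (hV : ContDiff ℝ ∞ V) (hc : HasCompactSupport V) :
    ∫ y, coordDiv V y ∂μ = 0 := by
  let b := Module.finBasis ℝ E
  let c : Fin (Module.finrank ℝ E) → E →L[ℝ] ℝ := fun i =>
    LinearMap.toContinuousLinearMap (b.coord i)
  have h1 : ∀ y, coordDiv V y = ∑ i, fderiv ℝ (fun z => c i (V z)) y (b i) := by
    intro y
    rw [coordDiv, trace_eq_sum b]
    refine Finset.sum_congr rfl fun i _ => ?_
    have h2 : HasFDerivAt (fun z => c i (V z)) ((c i) ∘L fderiv ℝ V y) y :=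
      (c i).hasFDerivAt.comp y (hV.differentiable (by simp) y).hasFDerivAt
    rw [h2.fderiv]
    rfl
  have hs : ∀ i, ContDiff ℝ ∞ fun z => c i (V z) := fun i => (c i).contDiff.comp hV
  have hcs : ∀ i, HasCompactSupport fun z => c i (V z) := fun i =>
    hc.comp_left (g := c i) (map_zero _)
  simp only [h1]
  rw [integral_finsetSum]
  · exact Finset.sum_eq_zero fun i _ => integral_fderiv_eq_zero μ (hs i) (hcs i) (b i)
  · exact fun i _ => (((hs i).continuous_fderiv (by simp)).clm_apply
      continuous_const).integrable_of_hasCompactSupport ((hcs i).fderiv_apply ℝ _)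

namespace IsMetricOn

variable {G : E → E →L[ℝ] E →L[ℝ] ℝ} {U : Set E} {f h : E → ℝ} {y : E}

/-- The inverse of a symmetric form is symmetric. -/
theorem metricTrace_flip (hG : IsMetricOn G U) (hy : y ∈ U) (T : LinearMap.BilinForm ℝ E) :
    metricTrace (G y) T.flip = metricTrace (G y) T := by
  rw [metricTrace_eq_sum (Module.finBasis ℝ E), metricTrace_eq_sum (Module.finBasis ℝ E),
    Finset.sum_comm]
  refine Finset.sum_congr rfl fun i _ => Finset.sum_congr rfl fun j _ => ?_
  rw [show T.flip (Module.finBasis ℝ E j) (Module.finBasis ℝ E i) =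
    T (Module.finBasis ℝ E i) (Module.finBasis ℝ E j) from rfl]
  congr 1
  exact hG.apply_inverse_comm hy
    (LinearMap.toContinuousLinearMap ((Module.finBasis ℝ E).coord j)) _

theorem contDiffOn_coordGrad (hG : IsMetricOn G U) (hf : ContDiffOn ℝ ∞ f U) :
    ContDiffOn ℝ ∞ (coordGrad G f) U :=
  hG.contDiffOn_inverse.clm_apply (contDiffOn_fderiv hG.isOpen hf)

/-- The divergence of the gradient with respect to Lebesgue measure. -/
theorem coordDiv_coordGrad (hG : IsMetricOn G U) (hf : ContDiffOn ℝ ∞ f U) (hy : y ∈ U) :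
    coordDiv (coordGrad G f) y = coordLaplacian G f y
      - 2⁻¹ * metricTrace (G y) (toBilin (fderiv ℝ G y (coordGrad G f y))) := by
  have hN := (differentiableAt_of_contDiffOn hG.isOpen (hG.contDiffOn_coordGrad hf) hy).hasFDerivAt
  have hGd := (differentiableAt_of_contDiffOn hG.isOpen hG.contDiffOn hy).hasFDerivAt
  have hf' := differentiableAt_of_contDiffOn hG.isOpen (contDiffOn_fderiv hG.isOpen hf) hy
  set N := coordGrad G f y with hNdef
  -- the form `D²f(W, Z) - D_W G(N, Z)`
  let T : E →L[ℝ] E →L[ℝ] ℝ := fderiv ℝ (fderiv ℝ f) y - (fderiv ℝ G y).flip N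
  have hT : ∀ W, fderiv ℝ (coordGrad G f) y W = (G y).inverse (T W) := by
    intro W
    rw [eq_comm, (hG.isInvertible y hy).inverse_apply_eq]
    have h1 := hGd.clm_apply hN
    have h2 : (fun z => G z (coordGrad G f z)) =ᶠ[𝓝 y] fderiv ℝ f := by
      filter_upwards [hG.isOpen.mem_nhds hy] with z hz
      rw [coordGrad, (hG.isInvertible z hz).self_apply_inverse]
    have h3 := congrArg (fun S => S W) ((h1.congr_of_eventuallyEq h2.symm).unique hf'.hasFDerivAt)
    simp only [add_apply, ContinuousLinearMap.comp_apply,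
      ContinuousLinearMap.flip_apply] at h3
    show fderiv ℝ (fderiv ℝ f) y W - fderiv ℝ G y W N = _
    rw [← h3]
    abel
  have hdiv : coordDiv (coordGrad G f) y = metricTrace (G y) (toBilin T) := by
    rw [coordDiv, metricTrace]
    congr 1
    ext W
    exact hT W
  let A : LinearMap.BilinForm ℝ E := toBilin ((fderiv ℝ G y).flip N)
  have hΓ : ∀ W Z, fderiv ℝ f y (christoffel G y W Z) = christoffelLower G y W Z N := by
    intro W Z
    rw [christoffel_apply, hG.apply_inverse_comm hy]
    rfl
  -- `Γ` lowered against `N` is half of `A` plus its transpose minus `D_N G`. The terms are arranged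
  -- so that `A` and its transpose, which have equal traces, stand on opposite sides.
  have hform : hessianForm G f y + (2⁻¹ : ℝ) • A.flip = toBilin T + (2⁻¹ : ℝ) • A
      + (2⁻¹ : ℝ) • toBilin (fderiv ℝ G y N) := by
    ext W Z
    have e1 : toBilin T W Z = fderiv ℝ (fderiv ℝ f) y W Z - fderiv ℝ G y W N Z := rfl
    have e2 : A W Z = fderiv ℝ G y W N Z := rfl
    have e3 : A.flip W Z = fderiv ℝ G y Z N W := rfl
    simp only [LinearMap.add_apply, LinearMap.smul_apply, e1, e2, e3,
      hessianForm_apply, hΓ, christoffelLower_apply, toBilin_apply, smul_eq_mul,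
      hG.fderiv_symm hy _ N]
    ring
  have h4 := congrArg (metricTrace (G y)) hform
  simp only [metricTrace_add, metricTrace_smul, hG.metricTrace_flip hy] at h4
  rw [hdiv, coordLaplacian]
  linarith

/-- Green's identity in coordinates, for a density `ρ` with logarithmic derivative
`½ tr_G (D_N G) - Dφ(N)`. -/
theorem coordDiv_green (hG : IsMetricOn G U) {ρ φ : E → ℝ} (hρ : ContDiffOn ℝ ∞ ρ U)
    (hρ' : ∀ N, fderiv ℝ ρ y N =
      ρ y * (2⁻¹ * metricTrace (G y) (toBilin (fderiv ℝ G y N)) - fderiv ℝ φ y N))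
    (hf : ContDiffOn ℝ ∞ f U) (hh : ContDiffOn ℝ ∞ h U) (hy : y ∈ U) :
    coordDiv ((ρ * h) • coordGrad G f - (ρ * f) • coordGrad G h) y =
      ρ y * (h y * (coordLaplacian G f y - coordGradInner G φ f y)
        - f y * (coordLaplacian G h y - coordGradInner G φ h y)) := by
  have hd : ∀ {f : E → ℝ}, ContDiffOn ℝ ∞ f U → DifferentiableAt ℝ f y := fun hf =>
    differentiableAt_of_contDiffOn hG.isOpen hf hy
  have hd' : ∀ {f : E → ℝ}, ContDiffOn ℝ ∞ f U → DifferentiableAt ℝ (coordGrad G f) y := fun hf =>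
    differentiableAt_of_contDiffOn hG.isOpen (hG.contDiffOn_coordGrad hf) hy
  rw [coordDiv_sub (((hd hρ).mul (hd hh)).smul (hd' hf)) (((hd hρ).mul (hd hf)).smul (hd' hh)),
    coordDiv_smul ((hd hρ).mul (hd hh)) (hd' hf), coordDiv_smul ((hd hρ).mul (hd hf)) (hd' hh),
    hG.coordDiv_coordGrad hf hy, hG.coordDiv_coordGrad hh hy, fderiv_mul (hd hρ) (hd hh),
    fderiv_mul (hd hρ) (hd hf)]
  have h1 : fderiv ℝ h y (coordGrad G f y) = coordGradInner G h f y := rfl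
  -- By symmetry of the inverse metric, the two products of gradients are equal and cancel.
  have h2 : fderiv ℝ f y (coordGrad G h y) = coordGradInner G h f y :=
    hG.apply_inverse_comm hy _ _
  have h3 : fderiv ℝ φ y (coordGrad G f y) = coordGradInner G φ f y := rfl
  have h4 : fderiv ℝ φ y (coordGrad G h y) = coordGradInner G φ h y := rfl
  simp only [add_apply, smul_apply, smul_eq_mul, hρ', h1, h2, h3, h4, Pi.mul_apply]
  ring

end IsMetricOn

end Divergence

/-! ### The Riemannian density -/

section Density

variable {n : ℕ}

/-- The determinant of the Gram matrix of the standard basis. -/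
def gramDet (B : EuclideanSpace ℝ (Fin n) →L[ℝ] EuclideanSpace ℝ (Fin n) →L[ℝ] ℝ) : ℝ :=
  Matrix.det (Matrix.of fun i j : Fin n =>
    B (EuclideanSpace.single i 1) (EuclideanSpace.single j 1))

theorem EuclideanSpace.eq_sum_single (X : EuclideanSpace ℝ (Fin n)) :
    X = ∑ k, X k • EuclideanSpace.single k (1 : ℝ) := by
  ext i
  simp [Pi.single_apply]

theorem contDiff_det : ContDiff ℝ ∞ fun A : Fin n → Fin n → ℝ => Matrix.det (Matrix.of A) := by
  simp only [Matrix.det_apply, Matrix.of_apply]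
  fun_prop

/-- The derivative of `t ↦ det(1 + tA)` at `0` is the trace of `A`, read off from the expansion of
this polynomial. -/
theorem fderiv_det_one (A : Fin n → Fin n → ℝ) :
    fderiv ℝ (fun A : Fin n → Fin n → ℝ => Matrix.det (Matrix.of A))
      (fun i j => (1 : Matrix (Fin n) (Fin n) ℝ) i j) A = ∑ i, A i i := by
  have h1 : HasFDerivAt (fun A : Fin n → Fin n → ℝ => Matrix.det (Matrix.of A)) _
      (fun i j => (1 : Matrix (Fin n) (Fin n) ℝ) i j) :=
    ((contDiff_det (n := n)).differentiable (by simp) _).hasFDerivAt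
  have h2 : HasDerivAt (fun t : ℝ => (fun i j => (1 : Matrix (Fin n) (Fin n) ℝ) i j) + t • A) A 0 := by
    simpa using ((hasDerivAt_id (0 : ℝ)).smul_const A).const_add
      (fun i j => (1 : Matrix (Fin n) (Fin n) ℝ) i j)
  have h3 := HasFDerivAt.comp_hasDerivAt_of_eq (0 : ℝ) h1 h2 (by simp)
  -- The quotient left after removing the constant and linear terms, so that `det(1 + rA) = 1 + r tr
  -- A + p(r) r²`.
  let p : Polynomial ℝ := (Matrix.det (1 + (Polynomial.X : Polynomial ℝ) •
    (Matrix.of A).map Polynomial.C)).divX.divX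
  have h4 : HasDerivAt (fun r : ℝ => 1 + (Matrix.of A).trace * r + p.eval r * r ^ 2)
      (Matrix.of A).trace 0 := by
    have e1 : HasDerivAt (fun r : ℝ => 1 + (Matrix.of A).trace * r) (Matrix.of A).trace 0 := by
      simpa using ((hasDerivAt_id (0 : ℝ)).const_mul (Matrix.of A).trace).const_add 1
    have e2 := (p.hasDerivAt 0).mul ((hasDerivAt_id (0 : ℝ)).pow 2)
    refine (e1.add e2).congr_deriv ?_
    simp
  have h5 : ((fun A : Fin n → Fin n → ℝ => Matrix.det (Matrix.of A)) ∘
      fun t : ℝ => (fun i j => (1 : Matrix (Fin n) (Fin n) ℝ) i j) + t • A) =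
      fun r : ℝ => 1 + (Matrix.of A).trace * r + p.eval r * r ^ 2 := by
    ext r
    exact Matrix.det_one_add_smul r (Matrix.of A)
  rw [h5] at h3
  exact h3.unique h4

theorem contDiff_gramDet : ContDiff ℝ ∞ (gramDet (n := n)) := by
  refine (contDiff_det (n := n)).comp (f := fun B : EuclideanSpace ℝ (Fin n) →L[ℝ]
    EuclideanSpace ℝ (Fin n) →L[ℝ] ℝ => fun i j : Fin n =>
    B (EuclideanSpace.single i 1) (EuclideanSpace.single j 1)) ?_
  fun_prop

/-- The Gram determinant of `B(T ·, ·)`. -/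
theorem gramDet_comp_left
    (B B' : EuclideanSpace ℝ (Fin n) →L[ℝ] EuclideanSpace ℝ (Fin n) →L[ℝ] ℝ)
    (T : EuclideanSpace ℝ (Fin n) → EuclideanSpace ℝ (Fin n)) (h : ∀ X Y, B' X Y = B (T X) Y) :
    gramDet B' = Matrix.det (Matrix.of fun i j => T (EuclideanSpace.single i 1) j) * gramDet B := by
  rw [gramDet, gramDet, ← Matrix.det_mul]
  congr 1
  ext i j
  rw [Matrix.of_apply, Matrix.mul_apply, h]
  conv_lhs => rw [EuclideanSpace.eq_sum_single (T (EuclideanSpace.single i 1))]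
  simp

theorem gramDet_pos {B : EuclideanSpace ℝ (Fin n) →L[ℝ] EuclideanSpace ℝ (Fin n) →L[ℝ] ℝ}
    (hs : ∀ X Y, B X Y = B Y X) (hp : ∀ X, X ≠ 0 → 0 < B X X) : 0 < gramDet B := by
  refine Matrix.PosDef.det_pos (Matrix.PosDef.of_dotProduct_mulVec_pos ?_ fun x hx => ?_)
  · ext i j
    simp [Matrix.conjTranspose_apply, hs (EuclideanSpace.single j 1)]
  · have h1 : WithLp.toLp 2 x ≠ 0 := by simpa using hx
    have h2 := hp _ h1
    rw [EuclideanSpace.eq_sum_single (WithLp.toLp 2 x)] at h2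
    simp only [map_sum, map_smul, sum_apply, smul_apply, smul_eq_mul,
      Finset.mul_sum] at h2
    simp only [dotProduct, Matrix.mulVec, Matrix.of_apply, Pi.star_apply, star_trivial,
      Finset.mul_sum]
    refine h2.trans_eq (Finset.sum_congr rfl fun i _ => Finset.sum_congr rfl fun j _ => ?_)
    rw [hs]
    ring

/-- Jacobi's formula. -/
theorem IsMetricOn.fderiv_gramDet {G : EuclideanSpace ℝ (Fin n) → EuclideanSpace ℝ (Fin n) →L[ℝ]
    EuclideanSpace ℝ (Fin n) →L[ℝ] ℝ} {U : Set (EuclideanSpace ℝ (Fin n))} (hG : IsMetricOn G U)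
    {y : EuclideanSpace ℝ (Fin n)} (hy : y ∈ U) (N : EuclideanSpace ℝ (Fin n)) :
    fderiv ℝ (fun z => gramDet (G z)) y N =
      gramDet (G y) * metricTrace (G y) (toBilin (fderiv ℝ G y N)) := by
  -- With `y` frozen, `G_z = G_y(T_z ·, ·)` and `T_y` is the identity, so only the derivative of the
  -- determinant at the identity is needed.
  let T : EuclideanSpace ℝ (Fin n) → Fin n → Fin n → ℝ := fun z i j =>
    (G y).inverse (G z (EuclideanSpace.single i 1)) j
  have h1 : (fun z => gramDet (G z)) = fun z => Matrix.det (Matrix.of (T z)) * gramDet (G y) := by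
    ext z
    refine gramDet_comp_left (G y) (G z) (fun X => (G y).inverse (G z X)) fun X Y => ?_
    rw [hG.apply_inverse hy]
  have hGd := differentiableAt_of_contDiffOn hG.isOpen hG.contDiffOn hy
  have hT : HasFDerivAt T (ContinuousLinearMap.pi fun i => ContinuousLinearMap.pi fun j =>
      (EuclideanSpace.proj j ∘L (G y).inverse) ∘L
        ((fderiv ℝ G y).flip (EuclideanSpace.single i 1))) y := by
    rw [hasFDerivAt_pi]
    intro i
    rw [hasFDerivAt_pi]
    intro j
    exact (EuclideanSpace.proj j ∘L (G y).inverse).hasFDerivAt.comp y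
      (hasFDerivAt_clm_apply_const hGd (EuclideanSpace.single i 1))
  have hTy : T y = fun i j => (1 : Matrix (Fin n) (Fin n) ℝ) i j := by
    ext i j
    simp only [T]
    rw [(hG.isInvertible y hy).inverse_apply_self]
    simp [Matrix.one_apply, eq_comm]
  have h2 : HasFDerivAt (fun A : Fin n → Fin n → ℝ => Matrix.det (Matrix.of A)) _ (T y) :=
    ((contDiff_det (n := n)).differentiable (by simp) _).hasFDerivAt
  have h3 := (h2.comp y hT).mul_const (gramDet (G y))
  have h4 : fderiv ℝ (fun z => Matrix.det (Matrix.of (T z)) * gramDet (G y)) y = _ := h3.fderiv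
  rw [h1, h4, hTy]
  simp only [smul_apply, ContinuousLinearMap.comp_apply, smul_eq_mul]
  rw [fderiv_det_one, metricTrace, trace_eq_sum (EuclideanSpace.basisFun (Fin n) ℝ).toBasis]
  congr 1
  refine Finset.sum_congr rfl fun i _ => ?_
  simp
  rfl

/-- The density `√(det g_{ij}) e^{-φ}`. -/
def weightedDensity (G : EuclideanSpace ℝ (Fin n) → EuclideanSpace ℝ (Fin n) →L[ℝ]
    EuclideanSpace ℝ (Fin n) →L[ℝ] ℝ) (φ : EuclideanSpace ℝ (Fin n) → ℝ)
    (y : EuclideanSpace ℝ (Fin n)) : ℝ :=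
  Real.sqrt (gramDet (G y)) * Real.exp (-φ y)

namespace IsMetricOn

variable {G : EuclideanSpace ℝ (Fin n) → EuclideanSpace ℝ (Fin n) →L[ℝ]
    EuclideanSpace ℝ (Fin n) →L[ℝ] ℝ} {U : Set (EuclideanSpace ℝ (Fin n))}
    {φ : EuclideanSpace ℝ (Fin n) → ℝ}

theorem contDiffOn_weightedDensity (hG : IsMetricOn G U)
    (hpos : ∀ y ∈ U, ∀ X, X ≠ 0 → 0 < G y X X) (hφ : ContDiffOn ℝ ∞ φ U) :
    ContDiffOn ℝ ∞ (weightedDensity G φ) U :=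
  ((contDiff_gramDet.comp_contDiffOn hG.contDiffOn).sqrt fun y hy =>
    (gramDet_pos (hG.symm y hy) (hpos y hy)).ne').mul hφ.neg.exp

theorem fderiv_weightedDensity (hG : IsMetricOn G U)
    (hpos : ∀ y ∈ U, ∀ X, X ≠ 0 → 0 < G y X X) (hφ : ContDiffOn ℝ ∞ φ U)
    {y : EuclideanSpace ℝ (Fin n)} (hy : y ∈ U) (N : EuclideanSpace ℝ (Fin n)) :
    fderiv ℝ (weightedDensity G φ) y N = weightedDensity G φ y *
      (2⁻¹ * metricTrace (G y) (toBilin (fderiv ℝ G y N)) - fderiv ℝ φ y N) := by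
  have hd := gramDet_pos (hG.symm y hy) (hpos y hy)
  have h1 : DifferentiableAt ℝ (fun z => gramDet (G z)) y :=
    differentiableAt_of_contDiffOn hG.isOpen (contDiff_gramDet.comp_contDiffOn hG.contDiffOn) hy
  have h2 := differentiableAt_of_contDiffOn hG.isOpen hφ hy
  have h3 := (h1.hasFDerivAt.sqrt hd.ne').mul h2.hasFDerivAt.neg.exp
  have h4 : fderiv ℝ (weightedDensity G φ) y = _ := h3.fderiv
  rw [h4]
  simp only [add_apply, smul_apply, neg_apply, smul_eq_mul,
    hG.fderiv_gramDet hy, weightedDensity, Pi.neg_apply]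
  -- Writing the determinant as `s²` with `s ≠ 0` lets the factor `1/(2s)` from the square root
  -- cancel.
  have h5 : gramDet (G y) = Real.sqrt (gramDet (G y)) * Real.sqrt (gramDet (G y)) :=
    (Real.mul_self_sqrt hd.le).symm
  have h6 : Real.sqrt (gramDet (G y)) ≠ 0 := (Real.sqrt_pos.2 hd).ne'
  generalize Real.sqrt (gramDet (G y)) = s at h5 h6 ⊢
  rw [h5]
  field_simp
  ring

end IsMetricOn

end Density

/-! ### The Riemannian measure in charts -/

theorem Measure.iSup_restrict_of_agree {α ι : Type*} [MeasurableSpace α] {s : ι → Set α}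
    (hs : ∀ i, MeasurableSet (s i)) {μ : ι → Measure α} (h0 : ∀ i, μ i (s i)ᶜ = 0)
    (hμ : ∀ i j, ∀ A ⊆ s i ∩ s j, MeasurableSet A → μ i A = μ j A)
    {t : Set ι} (ht : t.Countable) (hcover : ⋃ i ∈ t, s i = Set.univ) (i : ι) :
    (⨆ j, μ j).restrict (s i) = μ i := by
  have hin : ∀ i A, μ i A = μ i (A ∩ s i) := fun i A =>
    (measure_inter_conull (h0 i)).symm
  -- An empty cover forces an empty space; otherwise the cover is enumerated by the naturals.
  rcases t.eq_empty_or_nonempty with rfl | hne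
  · have : IsEmpty α := by
      rw [← Set.univ_eq_empty_iff, ← hcover]
      simp
    exact Subsingleton.elim _ _
  obtain ⟨e, he⟩ := ht.exists_eq_range hne
  have hcov : ⋃ k, disjointed (s ∘ e) k = Set.univ := by
    rw [iUnion_disjointed, ← hcover, he, Set.biUnion_range]
    rfl
  have hD : ∀ k, MeasurableSet (disjointed (s ∘ e) k) :=
    MeasurableSet.disjointed fun k => hs (e k)
  -- The glued measure: the cover is made disjoint and each piece carries its own `μ`. It agrees
  -- with every `μ i` on `s i` and dominates all of them, hence also their supremum.
  let ν : Measure α := Measure.sum fun k => (μ (e k)).restrict (disjointed (s ∘ e) k)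
  have hsum : ∀ i A, MeasurableSet A → μ i A = ∑' k, μ i (A ∩ disjointed (s ∘ e) k) := by
    intro i A hA
    rw [← measure_iUnion _ fun k => hA.inter (hD k), ← Set.inter_iUnion, hcov, Set.inter_univ]
    exact fun k l hkl => (disjoint_disjointed (s ∘ e) hkl).mono Set.inter_subset_right
      Set.inter_subset_right
  have hν : ∀ i A, MeasurableSet A → μ i A = ν (A ∩ s i) := by
    intro i A hA
    rw [Measure.sum_apply _ (hA.inter (hs i)), hsum i A hA]
    refine tsum_congr fun k => ?_
    rw [Measure.restrict_apply (hA.inter (hs i)), hin i, Set.inter_right_comm]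
    exact hμ _ _ _ (fun z hz => ⟨hz.1.2, disjointed_subset (s ∘ e) k hz.2⟩)
      ((hA.inter (hs i)).inter (hD k))
  have hle : ⨆ j, μ j ≤ ν := iSup_le fun j => Measure.le_iff.2 fun A hA =>
    (hν j A hA).trans_le (measure_mono Set.inter_subset_left)
  refine Measure.ext fun A hA => ?_
  rw [Measure.restrict_apply hA]
  refine le_antisymm ((hle _).trans_eq (hν i A hA).symm) ?_
  rw [hin i A]
  exact le_iSup μ i _

section Gram

variable {n : ℕ}

/-- The one-sided formula is used in each argument, with a transposition in between. -/
theorem gramDet_pullback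
    {B B' : EuclideanSpace ℝ (Fin n) →L[ℝ] EuclideanSpace ℝ (Fin n) →L[ℝ] ℝ}
    {T : EuclideanSpace ℝ (Fin n) →L[ℝ] EuclideanSpace ℝ (Fin n)}
    (h : ∀ X Y, B' X Y = B (T X) (T Y)) : gramDet B' = T.det ^ 2 * gramDet B := by
  have hT : Matrix.det (Matrix.of fun i j => T (EuclideanSpace.single i 1) j) = T.det := by
    rw [ContinuousLinearMap.det, ← LinearMap.det_toMatrix (EuclideanSpace.basisFun (Fin n) ℝ).toBasis,
      ← Matrix.det_transpose]
    congr 1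
  have hflip : ∀ C : EuclideanSpace ℝ (Fin n) →L[ℝ] EuclideanSpace ℝ (Fin n) →L[ℝ] ℝ,
      gramDet C.flip = gramDet C := fun C => by
    rw [gramDet, gramDet, ← Matrix.det_transpose]
    rfl
  have h1 := gramDet_comp_left (B.flip ∘L T).flip B' T h
  have h2 := gramDet_comp_left B.flip (B.flip ∘L T) T fun _ _ => rfl
  rw [h1, hflip, h2, hflip, hT]
  ring

end Gram

section ChartDensity

variable {n : ℕ} {M : Type*} [TopologicalSpace M] [ChartedSpace (EuclideanSpace ℝ (Fin n)) M]
  [IsManifold (𝓡 n) ∞ M] (g : RMetric n M)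

theorem RMetric.chartMetric_pos {x : M} {y : EuclideanSpace ℝ (Fin n)}
    (hy : y ∈ (extChartAt (𝓡 n) x).target) {X : EuclideanSpace ℝ (Fin n)} (hX : X ≠ 0) :
    0 < chartMetric (𝓡 n) g.inner x y X X :=
  g.pos _ _ fun h => hX ((isInvertible_chartDeriv (I := 𝓡 n) hy).injective
    (h.trans (map_zero (chartDeriv (𝓡 n) x y)).symm))

/-- A smooth function with support in a compact subset of the chart at `x`, as a density in the
chart, extended by zero. -/
def chartDensity (φ : SmoothFn n M) (x : M) (F : M → ℝ) : EuclideanSpace ℝ (Fin n) → ℝ :=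
  (extChartAt (𝓡 n) x).target.indicator fun y =>
    weightedDensity (chartMetric (𝓡 n) g.inner x) (φ ∘ (extChartAt (𝓡 n) x).symm) y *
      F ((extChartAt (𝓡 n) x).symm y)

theorem RMetric.aemeasurable_sqrt_gramDet (x : M) :
    AEMeasurable (fun y => ENNReal.ofReal (Real.sqrt (gramDet (chartMetric (𝓡 n) g.inner x y))))
      (volume.restrict (extChartAt (𝓡 n) x).target) := by
  refine (ContinuousOn.aemeasurable ?_ (isOpen_extChartAt_target x).measurableSet).ennreal_ofReal
  refine (contDiff_gramDet.continuous.comp_continuousOn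
    ((RMetric.isMetricOn g x).contDiffOn.continuousOn.mono fun y hy => ?_)).sqrt
  exact ⟨hy, Set.mem_univ _⟩

theorem toReal_mul_eq_chartDensity (φ : SmoothFn n M) (x : M) (F : M → ℝ) :
    (extChartAt (𝓡 n) x).target.indicator (fun y =>
      (ENNReal.ofReal (Real.sqrt (gramDet (chartMetric (𝓡 n) g.inner x y)))).toReal •
        (ENNReal.ofReal (Real.exp (-φ ((extChartAt (𝓡 n) x).symm y)))).toReal •
          F ((extChartAt (𝓡 n) x).symm y)) = chartDensity g φ x F := by
  refine Set.indicator_congr fun y _ => ?_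
  rw [ENNReal.toReal_ofReal (Real.sqrt_nonneg _), ENNReal.toReal_ofReal (Real.exp_nonneg _),
    smul_eq_mul, smul_eq_mul, ← mul_assoc]
  rfl

end ChartDensity

section Volume

variable {n : ℕ} {M : Type*} [TopologicalSpace M] [ChartedSpace (EuclideanSpace ℝ (Fin n)) M]
  [MeasurableSpace M] [BorelSpace M]

theorem aemeasurable_extChartAt_symm (x : M) :
    AEMeasurable (extChartAt (𝓡 n) x).symm (volume.restrict (extChartAt (𝓡 n) x).target) :=
  (continuousOn_extChartAt_symm x).aemeasurable (isOpen_extChartAt_target x).measurableSet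

theorem measurableSet_chartSet (x : M) {A : Set M} (hA : MeasurableSet A) :
    MeasurableSet (chartSet (𝓡 n) x A) := by
  have h1 := (continuousOn_iff_continuous_domRestrict.1
    (continuousOn_extChartAt_symm (I := 𝓡 n) x)).measurable hA
  have h2 := (isOpen_extChartAt_target (I := 𝓡 n) x).measurableSet.subtype_image h1
  convert h2 using 1
  exact (Subtype.image_preimage_coe _ _).symm

theorem chartVolume_apply (g : ∀ x : M, TangentSpace (𝓡 n) x →L[ℝ] TangentSpace (𝓡 n) x →L[ℝ] ℝ)
    (x : M) {A : Set M} (hA : MeasurableSet A) :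
    chartVolume g x A = ∫⁻ y in chartSet (𝓡 n) x A,
      ENNReal.ofReal (Real.sqrt (gramDet (chartMetric (𝓡 n) g x y))) := by
  rw [chartVolume, Measure.map_apply_of_aemeasurable
    ((aemeasurable_extChartAt_symm x).mono_ac (withDensity_absolutelyContinuous _ _)) hA,
    withDensity_apply', Measure.restrict_restrict' (isOpen_extChartAt_target x).measurableSet,
    Set.inter_comm]
  rfl

theorem chartVolume_compl_source
    (g : ∀ x : M, TangentSpace (𝓡 n) x →L[ℝ] TangentSpace (𝓡 n) x →L[ℝ] ℝ) (x : M) :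
    chartVolume g x (extChartAt (𝓡 n) x).sourceᶜ = 0 := by
  rw [chartVolume_apply g x (isOpen_extChartAt_source x).measurableSet.compl]
  have : chartSet (𝓡 n) x (extChartAt (𝓡 n) x).sourceᶜ = ∅ :=
    Set.eq_empty_of_forall_notMem fun y hy => hy.2 ((extChartAt (𝓡 n) x).map_target hy.1)
  rw [this, Measure.restrict_empty, lintegral_zero_measure]

theorem measurable_exp_neg (φ : SmoothFn n M) :
    Measurable fun x => ENNReal.ofReal (Real.exp (-φ x)) :=
  (Real.continuous_exp.comp φ.contMDiff.continuous.neg).measurable.ennreal_ofReal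

variable [IsManifold (𝓡 n) ∞ M] (g : RMetric n M)

/-- Change of variables under the transition map `Φ`: the factor `|det DΦ|` is the one by which
`√det` changes under pullback. -/
theorem RMetric.chartVolume_agree (x x' : M) {A : Set M}
    (hA : A ⊆ (extChartAt (𝓡 n) x).source ∩ (extChartAt (𝓡 n) x').source) (hm : MeasurableSet A) :
    chartVolume g.inner x A = chartVolume g.inner x' A := by
  let Φ := extChartAt (𝓡 n) x' ∘ (extChartAt (𝓡 n) x).symm
  have hiso := (RMetric.isSmoothMetricOn g).isIsometryOn_chartChange x x'
  have hsub : ∀ y ∈ chartSet (𝓡 n) x A,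
      y ∈ chartSet (𝓡 n) x (Set.univ ∩ (extChartAt (𝓡 n) x').source) := fun y hy =>
    ⟨hy.1, Set.mem_univ _, (hA hy.2).2⟩
  have himage : Φ '' chartSet (𝓡 n) x A = chartSet (𝓡 n) x' A := by
    ext z
    constructor
    · rintro ⟨y, hy, rfl⟩
      exact mem_chartSet hy.2 (hA hy.2).2
    · intro hz
      refine ⟨extChartAt (𝓡 n) x ((extChartAt (𝓡 n) x').symm z), mem_chartSet hz.2 (hA hz.2).1, ?_⟩
      simp only [Φ, Function.comp_apply]
      rw [(extChartAt (𝓡 n) x).left_inv (hA hz.2).1, (extChartAt (𝓡 n) x').right_inv hz.1]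
  have hinj : Set.InjOn Φ (chartSet (𝓡 n) x A) := fun y hy z hz h =>
    (extChartAt (𝓡 n) x).symm.injOn hy.1 hz.1
      ((extChartAt (𝓡 n) x').injOn (hA hy.2).2 (hA hz.2).2 h)
  rw [chartVolume_apply _ _ hm, chartVolume_apply _ _ hm, ← himage,
    lintegral_image_eq_lintegral_abs_det_fderiv_mul volume (measurableSet_chartSet x hm)
      (fun y hy => (differentiableAt_of_contDiffOn hiso.source.isOpen hiso.contDiffOn
        (hsub y hy)).hasFDerivAt.hasFDerivWithinAt) hinj]
  refine setLIntegral_congr_fun (measurableSet_chartSet x hm) fun y hy => ?_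
  show ENNReal.ofReal (Real.sqrt (gramDet (chartMetric (𝓡 n) g.inner x y))) = _
  rw [gramDet_pullback (hiso.pullback y (hsub y hy)), Real.sqrt_mul (sq_nonneg _), Real.sqrt_sq_eq_abs,
    ENNReal.ofReal_mul (abs_nonneg _)]

/-- Second countability extracts a countable cover from all chart domains, so the agreeing chart
measures glue. -/
theorem RMetric.riemannianVolume_restrict [SecondCountableTopology M] (x : M) :
    (riemannianVolume g.inner).restrict (extChartAt (𝓡 n) x).source = chartVolume g.inner x := by
  obtain ⟨t, ht, hcover⟩ := TopologicalSpace.countable_cover_nhds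
    fun x : M => extChartAt_source_mem_nhds (I := 𝓡 n) x
  exact Measure.iSup_restrict_of_agree (fun x => (isOpen_extChartAt_source x).measurableSet)
    (chartVolume_compl_source g.inner) (fun x x' _ hA hm => RMetric.chartVolume_agree g x x' hA hm)
    ht hcover x

theorem weightedVolume_restrict [SecondCountableTopology M] (φ : SmoothFn n M) (x : M) :
    (weightedVolume g.inner φ).restrict (extChartAt (𝓡 n) x).source =
      (chartVolume g.inner x).withDensity fun x => ENNReal.ofReal (Real.exp (-φ x)) := by
  rw [weightedVolume, restrict_withDensity (isOpen_extChartAt_source x).measurableSet,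
    RMetric.riemannianVolume_restrict]

theorem integral_weightedVolume [SecondCountableTopology M] (φ : SmoothFn n M) {x : M} {F : M → ℝ}
    (hF : Continuous F) (h0 : ∀ z ∉ (extChartAt (𝓡 n) x).source, F z = 0) :
    ∫ z, F z ∂(weightedVolume g.inner φ) = ∫ y, chartDensity g φ x F y := by
  have hm := (aemeasurable_extChartAt_symm (n := n) x).mono_ac (withDensity_absolutelyContinuous _
    fun y => ENNReal.ofReal (Real.sqrt (gramDet (chartMetric (𝓡 n) g.inner x y))))
  have he := measurable_exp_neg φ
  have hc : Continuous fun z => (ENNReal.ofReal (Real.exp (-φ z))).toReal • F z := by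
    simp only [ENNReal.toReal_ofReal (Real.exp_nonneg _)]
    exact (Real.continuous_exp.comp φ.contMDiff.continuous.neg).smul hF
  rw [← setIntegral_eq_integral_of_forall_compl_eq_zero h0, weightedVolume_restrict,
    integral_withDensity_eq_integral_toReal_smul he (by simp)]
  refine (integral_map hm hc.aestronglyMeasurable).trans ?_
  rw [integral_withDensity_eq_integral_toReal_smul₀ (RMetric.aemeasurable_sqrt_gramDet g x)
      (by simp),
    ← integral_indicator (isOpen_extChartAt_target x).measurableSet, toReal_mul_eq_chartDensity]

theorem integrable_weightedVolume [SecondCountableTopology M] (φ : SmoothFn n M) {x : M} {F : M → ℝ}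
    (hF : Continuous F) (h0 : ∀ z ∉ (extChartAt (𝓡 n) x).source, F z = 0)
    (hi : Integrable (chartDensity g φ x F)) : Integrable F (weightedVolume g.inner φ) := by
  have hm := (aemeasurable_extChartAt_symm (n := n) x).mono_ac (withDensity_absolutelyContinuous _
    fun y => ENNReal.ofReal (Real.sqrt (gramDet (chartMetric (𝓡 n) g.inner x y))))
  have he := measurable_exp_neg φ
  have hc : Continuous fun z => (ENNReal.ofReal (Real.exp (-φ z))).toReal • F z := by
    simp only [ENNReal.toReal_ofReal (Real.exp_nonneg _)]
    exact (Real.continuous_exp.comp φ.contMDiff.continuous.neg).smul hF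
  refine (integrableOn_iff_integrable_of_support_subset
    (s := (extChartAt (𝓡 n) x).source) fun z hz => ?_).1 ?_
  · by_contra h
    exact hz (h0 z h)
  rw [IntegrableOn, weightedVolume_restrict, integrable_withDensity_iff_integrable_smul' he (by simp)]
  refine (integrable_map_measure hc.aestronglyMeasurable hm).2 ?_
  rw [integrable_withDensity_iff_integrable_smul₀' (RMetric.aemeasurable_sqrt_gramDet g x) (by simp)]
  refine (integrable_indicator_iff (isOpen_extChartAt_target x).measurableSet).1 ?_
  rw [← toReal_mul_eq_chartDensity] at hi
  exact hi

end Volume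

/-! ### Green's identity for functions supported in one chart -/

theorem contDiff_indicator_of_compact {E F : Type*} [NormedAddCommGroup E] [NormedSpace ℝ E]
    [NormedAddCommGroup F] [NormedSpace ℝ F] {U K : Set E} (hU : IsOpen U) (hK : IsCompact K)
    (hKU : K ⊆ U) {V : E → F} (hV : ContDiffOn ℝ ∞ V U) (h0 : ∀ y ∈ U, y ∉ K → V y = 0) :
    ContDiff ℝ ∞ (U.indicator V) ∧ HasCompactSupport (U.indicator V) := by
  have h1 : ∀ y ∉ K, U.indicator V y = 0 := fun y hy => by
    by_cases hyU : y ∈ U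
    · rw [Set.indicator_of_mem hyU, h0 y hyU hy]
    · exact Set.indicator_of_notMem hyU _
  refine ⟨contDiff_iff_contDiffAt.2 fun y => ?_, HasCompactSupport.intro hK h1⟩
  by_cases hyU : y ∈ U
  · refine (hV.contDiffAt (hU.mem_nhds hyU)).congr_of_eventuallyEq ?_
    filter_upwards [hU.mem_nhds hyU] with z hz
    exact Set.indicator_of_mem hz _
  · refine (contDiffAt_const (c := (0 : F))).congr_of_eventuallyEq ?_
    -- Off `U` the complement of the closed set `K` is a neighbourhood on which the extension
    -- vanishes.
    filter_upwards [hK.isClosed.isOpen_compl.mem_nhds fun h => hyU (hKU h)] with z hz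
    exact h1 z hz

theorem coordDiv_indicator {E : Type*} [NormedAddCommGroup E] [NormedSpace ℝ E]
    {U K : Set E} (hU : IsOpen U) (hK : IsCompact K)
    (hKU : K ⊆ U) {V : E → E} (h0 : ∀ y ∈ U, y ∉ K → V y = 0) :
    coordDiv (U.indicator V) = U.indicator (coordDiv V) := by
  ext y
  by_cases hyU : y ∈ U
  · have h1 : U.indicator V =ᶠ[𝓝 y] V := by
      filter_upwards [hU.mem_nhds hyU] with z hz
      exact Set.indicator_of_mem hz _
    rw [Set.indicator_of_mem hyU, coordDiv, coordDiv, h1.fderiv_eq]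
  · have h1 : U.indicator V =ᶠ[𝓝 y] fun _ => 0 := by
      filter_upwards [hK.isClosed.isOpen_compl.mem_nhds fun h => hyU (hKU h)] with z hz
      by_cases hzU : z ∈ U
      · rw [Set.indicator_of_mem hzU, h0 z hzU hz]
      · exact Set.indicator_of_notMem hzU _
    rw [Set.indicator_of_notMem hyU, coordDiv, h1.fderiv_eq]
    simp

variable {n : ℕ} {M : Type*} [TopologicalSpace M] [ChartedSpace (EuclideanSpace ℝ (Fin n)) M]

theorem isCompact_chart_image {x : M} {K : Set M} (hK : IsCompact K)
    (hKx : K ⊆ (extChartAt (𝓡 n) x).source) : IsCompact (extChartAt (𝓡 n) x '' K) :=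
  hK.image_of_continuousOn ((continuousOn_extChartAt x).mono hKx)

theorem chart_image_subset_target {x : M} {K : Set M}
    (hKx : K ⊆ (extChartAt (𝓡 n) x).source) :
    extChartAt (𝓡 n) x '' K ⊆ (extChartAt (𝓡 n) x).target := by
  rintro _ ⟨z, hz, rfl⟩
  exact (extChartAt (𝓡 n) x).map_source (hKx hz)

theorem symm_notMem_of_notMem_image {x : M} {K : Set M} {y : EuclideanSpace ℝ (Fin n)}
    (hy : y ∈ (extChartAt (𝓡 n) x).target) (h : y ∉ extChartAt (𝓡 n) x '' K) :
    (extChartAt (𝓡 n) x).symm y ∉ K :=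
  fun hK => h ⟨_, hK, (extChartAt (𝓡 n) x).right_inv hy⟩

theorem chartSet_univ (x : M) : chartSet (𝓡 n) x Set.univ = (extChartAt (𝓡 n) x).target := by
  rw [chartSet, Set.preimage_univ, Set.inter_univ]

variable [IsManifold (𝓡 n) ∞ M] (g : RMetric n M)

/-- The operator is local and linear, and `f` vanishes near `z`. -/
theorem gjmsEnd_eq_zero_of_notMem_tsupport (φ : SmoothFn n M) {f : SmoothFn n M} {z : M}
    (hz : z ∉ tsupport f) : gjmsEnd g φ f z = 0 := by
  have h1 : (f : M → ℝ) =ᶠ[𝓝 z] (0 : SmoothFn n M) := notMem_tsupport_iff_eventuallyEq.1 hz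
  have h2 : weightedLaplacian (𝓡 n) g.inner φ f z = weightedLaplacianEnd g φ 0 z :=
    weightedLaplacian_congr h1
  have h3 : gjmsEnd g φ f z = weightedLaplacian (𝓡 n) g.inner φ f z
    + -quarterCurvature g φ z * f z := rfl
  rw [h3, h2, map_zero, h1.self_of_nhds]
  simp

theorem tsupport_gjmsEnd_subset (φ f : SmoothFn n M) : tsupport (gjmsEnd g φ f) ⊆ tsupport f :=
  closure_minimal (fun z hz => by
    by_contra h
    exact hz (gjmsEnd_eq_zero_of_notMem_tsupport g φ h)) (isClosed_tsupport _)

theorem RMetric.contDiffOn_density (φ : SmoothFn n M) (x : M) :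
    ContDiffOn ℝ ∞ (weightedDensity (chartMetric (𝓡 n) g.inner x)
      (φ ∘ (extChartAt (𝓡 n) x).symm)) (extChartAt (𝓡 n) x).target := by
  have h := (RMetric.isMetricOn g x).contDiffOn_weightedDensity
    (fun y hy X hX => RMetric.chartMetric_pos g hy.1 hX) (φ.contDiffOn_chart x)
  rwa [chartSet_univ] at h

theorem integrable_chartDensity (φ : SmoothFn n M) {x : M} {K : Set M} (hK : IsCompact K)
    (hKx : K ⊆ (extChartAt (𝓡 n) x).source) {F : SmoothFn n M} (h0 : ∀ z ∉ K, F z = 0) :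
    Integrable (chartDensity g φ x F) := by
  have h1 := F.contDiffOn_chart x
  rw [chartSet_univ] at h1
  obtain ⟨h2, h3⟩ := contDiff_indicator_of_compact (isOpen_extChartAt_target x)
    (isCompact_chart_image hK hKx) (chart_image_subset_target hKx)
    ((RMetric.contDiffOn_density g φ x).mul h1) fun y hy hyK => by
      rw [Function.comp_apply, h0 _ (symm_notMem_of_notMem_image hy hyK), mul_zero]
  exact h2.continuous.integrable_of_hasCompactSupport h3

/-- Green's identity for a function supported in a chart. -/
theorem integral_chartDensity_green (φ h : SmoothFn n M) {x : M} {f : SmoothFn n M}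
    (hf : HasCompactSupport f) (hfx : tsupport f ⊆ (extChartAt (𝓡 n) x).source) :
    ∫ y, chartDensity g φ x (gjmsEnd g φ f * h - f * gjmsEnd g φ h : SmoothFn n M) y = 0 := by
  set e := extChartAt (𝓡 n) x
  set G := chartMetric (𝓡 n) g.inner x
  let ρ := weightedDensity G (φ ∘ e.symm)
  -- The weighted vector field `ρ(h∇f - f∇h)` of Green's identity; extended by zero, it is smooth
  -- with compact support.
  let V := (ρ * (h ∘ e.symm)) • coordGrad G (f ∘ e.symm)
    - (ρ * (f ∘ e.symm)) • coordGrad G (h ∘ e.symm)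
  have hG := RMetric.isMetricOn g x
  have hU : chartSet (𝓡 n) x Set.univ = e.target := chartSet_univ x
  have hρ := RMetric.contDiffOn_density g φ x
  rw [← chartSet_univ] at hρ
  have hV : ContDiffOn ℝ ∞ V e.target := by
    rw [← hU]
    exact ((hρ.mul (h.contDiffOn_chart x)).smul (hG.contDiffOn_coordGrad (f.contDiffOn_chart x))).sub
      ((hρ.mul (f.contDiffOn_chart x)).smul (hG.contDiffOn_coordGrad (h.contDiffOn_chart x)))
  have h0 : ∀ y ∈ e.target, y ∉ e '' tsupport f → V y = 0 := fun y hy hyK => by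
    have h1 := notMem_tsupport_iff_eventuallyEq.1 (symm_notMem_of_notMem_image hy hyK)
    have h2 : f ∘ e.symm =ᶠ[𝓝 y] fun _ => 0 :=
      ((continuousOn_extChartAt_symm x).continuousAt
        ((isOpen_extChartAt_target x).mem_nhds hy)).eventually h1
    have h3 : coordGrad G (f ∘ e.symm) y = 0 := by
      rw [coordGrad, h2.fderiv_eq]
      simp
    simp only [V, Pi.sub_apply, Pi.smul_apply', Pi.mul_apply, h3, h2.self_of_nhds]
    simp
  have hcK := isCompact_chart_image hf.isCompact hfx
  have hKU := chart_image_subset_target hfx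
  obtain ⟨h2, h3⟩ := contDiff_indicator_of_compact (isOpen_extChartAt_target x) hcK hKU hV h0
  rw [← integral_coordDiv_eq_zero volume h2 h3,
    coordDiv_indicator (isOpen_extChartAt_target x) hcK hKU h0]
  congr 1
  refine Set.indicator_congr fun y hy => ?_
  have hyU : y ∈ chartSet (𝓡 n) x Set.univ := by rwa [hU]
  have hz : e.symm y ∈ e.source := e.map_target hy
  have hgreen := hG.coordDiv_green hρ (fun N => hG.fderiv_weightedDensity
    (fun y hy X hX => RMetric.chartMetric_pos g hy.1 hX) (φ.contDiffOn_chart x) hyU N)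
    (f.contDiffOn_chart x) (h.contDiffOn_chart x) hyU
  have hL : ∀ f : SmoothFn n M, gjmsEnd g φ f (e.symm y) =
      coordLaplacian G (f ∘ e.symm) y - coordGradInner G (φ ∘ e.symm) (f ∘ e.symm) y
        - quarterCurvature g φ (e.symm y) * f (e.symm y) := fun f => by
    have h5 := (RMetric.isSmoothMetricOn g).laplacian_eq f.contMDiff.contMDiffOn
      (Set.mem_univ (e.symm y)) hz
    have h6 := (RMetric.isSmoothMetricOn g).gradInner_eq φ.contMDiff.contMDiffOn
      f.contMDiff.contMDiffOn (Set.mem_univ (e.symm y)) hz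
    rw [e.right_inv hy] at h5 h6
    have h7 : gjmsEnd g φ f (e.symm y) = laplacian (𝓡 n) g.inner f (e.symm y)
      - gradInner (𝓡 n) g.inner φ f (e.symm y)
        + -quarterCurvature g φ (e.symm y) * f (e.symm y) := rfl
    rw [h7, h5, h6]
    ring
  -- The terms in `¼ R_φ` are multiplications and cancel in the difference, leaving the two weighted
  -- Laplacians.
  refine Eq.trans ?_ hgreen.symm
  show _ * (gjmsEnd g φ f (e.symm y) * h (e.symm y) - f (e.symm y) * gjmsEnd g φ h (e.symm y)) = _
  rw [hL, hL]
  simp only [Function.comp_apply]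
  ring

/-! ### Formal self-adjointness -/

section SelfAdjoint

variable [MeasurableSpace M] [BorelSpace M] [SecondCountableTopology M]

theorem integrable_of_tsupport_subset (φ : SmoothFn n M) {x : M} {K : Set M} (hK : IsCompact K)
    (hKx : K ⊆ (extChartAt (𝓡 n) x).source) {F : SmoothFn n M} (h0 : ∀ z ∉ K, F z = 0) :
    Integrable F (weightedVolume g.inner φ) :=
  integrable_weightedVolume g φ F.contMDiff.continuous (fun z hz => h0 z fun h => hz (hKx h))
    (integrable_chartDensity g φ hK hKx h0)

theorem integral_gjmsEnd_mul_of_chart (φ h : SmoothFn n M) {x : M} {f : SmoothFn n M}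
    (hf : HasCompactSupport f) (hfx : tsupport f ⊆ (extChartAt (𝓡 n) x).source) :
    Integrable ⇑(gjmsEnd g φ f * h) (weightedVolume g.inner φ) ∧
    Integrable ⇑(f * gjmsEnd g φ h) (weightedVolume g.inner φ) ∧
    ∫ z, (gjmsEnd g φ f * h) z ∂(weightedVolume g.inner φ) =
      ∫ z, (f * gjmsEnd g φ h) z ∂(weightedVolume g.inner φ) := by
  have h1 : ∀ z ∉ tsupport f, (gjmsEnd g φ f * h) z = 0 := fun z hz => by
    rw [ContMDiffMap.coe_mul, Pi.mul_apply, gjmsEnd_eq_zero_of_notMem_tsupport g φ hz, zero_mul]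
  have h2 : ∀ z ∉ tsupport f, (f * gjmsEnd g φ h) z = 0 := fun z hz => by
    rw [ContMDiffMap.coe_mul, Pi.mul_apply, image_eq_zero_of_notMem_tsupport hz, zero_mul]
  have i1 := integrable_of_tsupport_subset g φ hf.isCompact hfx h1
  have i2 := integrable_of_tsupport_subset g φ hf.isCompact hfx h2
  refine ⟨i1, i2, ?_⟩
  rw [← sub_eq_zero, ← integral_sub i1 i2]
  refine (integral_weightedVolume g φ (x := x)
    (gjmsEnd g φ f * h - f * gjmsEnd g φ h : SmoothFn n M).contMDiff.continuous
    fun z hz => ?_).trans (integral_chartDensity_green g φ h hf hfx)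
  have hz' : z ∉ tsupport f := fun h => hz (hfx h)
  rw [ContMDiffMap.coe_sub, Pi.sub_apply, h1 z hz', h2 z hz', sub_zero]

variable [T2Space M]

/-- Only `f` is decomposed by a partition of unity subordinate to the charts; `h` is left whole, so
no cross terms between charts arise. -/
theorem integral_gjmsEnd_mul (φ h : SmoothFn n M) {f : SmoothFn n M} (hf : HasCompactSupport f) :
    ∫ z, gjmsEnd g φ f z * h z ∂(weightedVolume g.inner φ) =
      ∫ z, f z * gjmsEnd g φ h z ∂(weightedVolume g.inner φ) := by
  have : LocallyCompactSpace M := Manifold.locallyCompact_of_finiteDimensional (𝓡 n)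
  obtain ⟨p, hp⟩ := SmoothPartitionOfUnity.exists_isSubordinate_chartAt_source (𝓡 n) M
  -- Local finiteness leaves finitely many members that meet the compact support of `f`.
  have hfin := p.locallyFinite.finite_nonempty_inter_compact hf.isCompact
  let t := hfin.toFinset
  let q : M → SmoothFn n M := fun i => p i * f
  have hsum : f = ∑ i ∈ t, q i := by
    ext z
    have h1 : ∀ s : Finset M, (∑ i ∈ s, q i) z = (∑ i ∈ s, p i z) * f z := by
      intro s
      classical
      induction s using Finset.induction_on with
      | empty => simp
      | insert a s ha ih =>
        rw [Finset.sum_insert ha, Finset.sum_insert ha, ContMDiffMap.coe_add, Pi.add_apply, ih,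
          add_mul]
        rfl
    rw [h1]
    by_cases hz : z ∈ tsupport f
    · have h2 : ∑ i ∈ t, p i z = ∑ᶠ i, p i z := by
        refine (finsum_eq_sum_of_support_subset _ fun i hi => ?_).symm
        rw [Set.Finite.coe_toFinset]
        exact ⟨z, hi, hz⟩
      rw [h2, p.sum_eq_one (Set.mem_univ z), one_mul]
    · rw [image_eq_zero_of_notMem_tsupport hz, mul_zero]
  have hq : ∀ i, HasCompactSupport (q i) := fun i => hf.mul_left
  have hqs : ∀ i, tsupport (q i) ⊆ (extChartAt (𝓡 n) i).source := fun i => by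
    rw [extChartAt_source]
    exact (tsupport_mul_subset_left (f := p i) (g := f)).trans (hp i)
  have key := fun i => integral_gjmsEnd_mul_of_chart g φ h (hq i) (hqs i)
  have e1 : ∀ z, gjmsEnd g φ f z * h z = ∑ i ∈ t, (gjmsEnd g φ (q i) * h) z := by
    intro z
    have e2 : gjmsEnd g φ f * h = ∑ i ∈ t, gjmsEnd g φ (q i) * h := by
      rw [← Finset.sum_mul, ← map_sum, ← hsum]
    have e3 := congrArg (fun F : SmoothFn n M => F z) e2
    simp only [ContMDiffMap.coe_mul, Pi.mul_apply] at e3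
    rw [e3, ← ContMDiffMap.coeFnAddMonoidHom_apply, map_sum, Finset.sum_apply]
    rfl
  have e4 : ∀ z, f z * gjmsEnd g φ h z = ∑ i ∈ t, (q i * gjmsEnd g φ h) z := by
    intro z
    have e2 : f * gjmsEnd g φ h = ∑ i ∈ t, q i * gjmsEnd g φ h := by
      rw [← Finset.sum_mul, ← hsum]
    have e3 := congrArg (fun F : SmoothFn n M => F z) e2
    simp only [ContMDiffMap.coe_mul, Pi.mul_apply] at e3
    rw [e3, ← ContMDiffMap.coeFnAddMonoidHom_apply, map_sum, Finset.sum_apply]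
    rfl
  simp only [e1, e4]
  rw [integral_finsetSum _ fun i _ => (key i).1, integral_finsetSum _ fun i _ => (key i).2.1]
  exact Finset.sum_congr rfl fun i _ => (key i).2.2

/-- One factor is moved across at a time; locality keeps the support of the left function compact.
-/
theorem integral_gjmsEnd_pow_mul (φ : SmoothFn n M) (k : ℕ) (f h : SmoothFn n M)
    (hf : HasCompactSupport f) :
    ∫ z, (gjmsEnd g φ ^ k) f z * h z ∂(weightedVolume g.inner φ) =
      ∫ z, f z * (gjmsEnd g φ ^ k) h z ∂(weightedVolume g.inner φ) := by
  induction k generalizing f with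
  | zero => rfl
  | succ k ih =>
    -- The factor is peeled off on the inside for `f` and on the outside for `h`, so that the last
    -- one to move acts directly on `f`.
    have h1 : (gjmsEnd g φ ^ (k + 1)) f = (gjmsEnd g φ ^ k) (gjmsEnd g φ f) := by
      rw [pow_succ]; rfl
    have h2 : (gjmsEnd g φ ^ (k + 1)) h = gjmsEnd g φ ((gjmsEnd g φ ^ k) h) := by
      rw [pow_succ']; rfl
    rw [h1, h2, ih _ (hf.mono' ((subset_tsupport _).trans (tsupport_gjmsEnd_subset g φ f))),
      integral_gjmsEnd_mul g φ _ hf]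

end SelfAdjoint

end WeightedGJMS

end

/-! ### The theorem -/

open WeightedGJMS
theorem theorem1p15 {n : ℕ} {M : Type*} [TopologicalSpace M] [T2Space M]
    [SecondCountableTopology M] [ChartedSpace (EuclideanSpace ℝ (Fin n)) M]
    [IsManifold (𝓡 n) ∞ M] [MeasurableSpace M] [BorelSpace M]
    (g : RMetric n M) (k : ℕ) :
    ∃ L : SmoothFn n M → Module.End ℝ (SmoothFn n M),
      -- the operator equals `(Δ_φ - ¼ R_φ)^k`
      (∀ (φ f : SmoothFn n M), ⇑(L φ f) = (gjmsFactor (𝓡 n) g.inner φ)^[k] f) ∧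
      -- conformal invariance: the operators define a map of densities of weight `-1/2`
      (∀ φ : SmoothFn n M, ∃ T : ConformalDensity φ (-1 / 2) →ₗ[ℝ] ConformalDensity φ (-1 / 2),
        ∀ (f : ConformalDensity φ (-1 / 2)) (ψ : conformalClass φ),
          (T f).1 ψ = L ψ (f.1 ψ)) ∧
      -- formal self-adjointness with respect to `e^{-φ} dvol_g`
      (∀ φ f h : SmoothFn n M, HasCompactSupport f → HasCompactSupport h →
        ∫ x, L φ f x * h x ∂(weightedVolume g.inner φ) =
          ∫ x, f x * L φ h x ∂(weightedVolume g.inner φ)) ∧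
      -- the leading term is `Δ_φ^k`
      (∀ φ : SmoothFn n M, ∃ D : Module.End ℝ (SmoothFn n M), IsDiffOpOfOrderLT (2 * k) D ∧
        ∀ f : SmoothFn n M,
          ⇑(L φ f) = (weightedLaplacian (𝓡 n) g.inner φ)^[k] f + ⇑(D f)) ∧
      -- the operator is obtained from the `k`-th power of the ambient weighted Laplacian,
      -- for every normal ambient space and every smooth extension `fu` of `f`
      (∀ (φ : SmoothFn n M) (S : NormalAmbientSpace g φ) (f : SmoothFn n M) (fu : M × ℝ → ℝ),
        ContMDiffOn ((𝓡 n).prod 𝓘(ℝ, ℝ)) 𝓘(ℝ, ℝ) ∞ fu S.dom → (∀ x, fu (x, 0) = f x) →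
        ∀ (v : ℝ) (x : M),
          Real.exp (v / 2) *
            (S.weightedLaplacian^[k] fun p => Real.exp (-p.1 / 2) * fu p.2) (v, x, 0) =
          L φ f x) := by
  refine ⟨fun φ => gjmsEnd g φ ^ k, fun φ f => gjmsEnd_pow_apply g φ f k,
    fun φ => ⟨gjmsDensityMap g φ k, fun f ψ => rfl⟩,
    fun φ f h hf _ => integral_gjmsEnd_pow_mul g φ k f h hf, fun φ => ?_, ?_⟩
  · refine ⟨gjmsEnd g φ ^ k - weightedLaplacianEnd g φ ^ k,
      (isDiffOpOfOrderLT_weightedLaplacianEnd g φ).pow_add_sub_pow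
        (IsDiffOpOfOrderLT.mulLeft _) k, fun f => ?_⟩
    rw [← weightedLaplacianEnd_pow_apply, ← ContMDiffMap.coe_add, LinearMap.sub_apply,
      add_sub_cancel]
  · intro φ S f fu hfu h0 v x
    obtain ⟨h, -, heq, hzero⟩ := S.iterate_weightedLaplacian hfu k
    rw [heq (v, x, 0) (S.zero_mem x), ← mul_assoc, ← Real.exp_add, neg_div, add_neg_cancel,
      Real.exp_zero, one_mul, gjmsEnd_pow_apply, ← funext h0]
    exact congrFun hzero x
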